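/- **Setting.** Let $\Omega\subset\mathbb R^3$ be a bounded, simply connected, closed polyhedron (equal to the closure of its interior) with Lipschitz boundary $\partial\Omega=\bigcup_{i=1}^I\overline{F_i}$. The patches $F_i$ are open plane (not necessarily convex) quadrilaterals, each bounded by a simple closed polygonal chain through four of the vertices $\nu_1,\dots,\nu_N$ of $\Omega$; two different closed patches are disjoint, or meet in exactly one common vertex, or in exactly one common edge. Let $\kappa_i\colon[0,1]^2\to\overline{F_i}$ be bi-Lipschitz bijections which on $(0,1)^2$ are $k$ times continuously differentiable with bounded derivatives up to order $k$ (for example $C^k$-diffeomorphisms of $[0,1]^2$ onto $\overline{F_i}$). Put $\langle u,v\rangle=\sum_i\int_{[0,1]^2}(u\circ\kappa_i)\,\overline{(v\circ\kappa_i)}\,dx$. Let $C^\infty_{\rm pw}(\partial\Omega)$ be the set of continuous $u\colon\partial\Omega\to\mathbb C$ such that each $u|_{\overline{F_i}}$ is the restriction of a $C^\infty$ function. $\operatorname{dist}$ denotes the infimum of the distances ($\infty$ if one of the sets is empty). *Cones.* For each vertex $\nu_n$ and each patch $F_i$ having $\nu_n$ as a corner, $\Gamma^{n,i}$ is the open infinite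 plane sector with apex $\nu_n$ that coincides with $F_i$ near $\nu_n$; these sectors are the faces of the boundary of the tangent cone $\mathcal C_n$ of $\Omega$ at $\nu_n$. Let $\gamma_{n,i}\in(0,2\pi)$ be the opening angle of $\Gamma^{n,i}$ and $R_{n,i}$ an isometric parametrization of $\Gamma^{n,i}$ by $\{(r\cos\phi,r\sin\phi): r>0,\ 0<\phi<\gamma_{n,i}\}$, mapping $0$ to $\nu_n$. *Resolution of unity.* Let $\varphi_n\ge0$, $\varphi_n\in C^\infty_{\rm pw}(\partial\Omega)$, $n=1,\dots,N$, with $\sum_n\varphi_n=1$ on $\partial\Omega$, and let $\nu_n\in U_{n,0}\subsetneq U_{n,1}\subsetneq\partial\Omega$ be relatively open sets with $\varphi_n=1$ on $U_{n,0}$ and $\varphi_n=0$ on $\partial\Omega\setminus U_{n,1}$, such that for some $C_1>0$: $\operatorname{dist}(U_{n,1},F_\ell)\ge C_1$ whenever $\nu_n\notin\overline{F_\ell}$; and, for each patch $F_i$ with corner $\nu_n$, $\operatorname{dist}(U_{n,1}\cap\Gamma^{n,i},F_i\setminus\Gamma^{n,i})\ge C_1$ and $U_{n,1}\cap F_i\subset\Gamma^{n,i}$.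 *Weighted Sobolev space.* For $u\in C^\infty_{\rm pw}(\partial\Omega)$ let $f_{n,i}$ be the function $\varphi_nu$ on $\Gamma^{n,i}\cap\overline{F_i}$, extended by $0$ to $\Gamma^{n,i}$ and written in the polar coordinates $(r,\phi)$ given by $R_{n,i}$; let $q=\min\{\phi,\gamma_{n,i}-\phi\}$, and $$\|u\,|\,X^k_\rho(\partial\Omega)\|=\sum_{n=1}^N\Big[\Big(\sum_i\|f_{n,i}\|^2\Big)^{1/2}+\sum_i\sum_{1\le a+b\le k}\big\|r^{-\rho}(1+r)^\rho(qr)^{a}q^{b-\rho}\,\partial_r^{a}\partial_\phi^{b}f_{n,i}\big\|\Big],$$ where the sums run over the patches $F_i$ with corner $\nu_n$ and over $a,b\in\mathbb N_0$, and the norms are those of $L_2\big((0,\infty)\times(0,\gamma_{n,i}),\,r\,dr\,d\phi\big)$. $X^k_\rho(\partial\Omega)$ is the completion, inside $L_2(\partial\Omega)$, of the functions in $C^\infty_{\rm pw}(\partial\Omega)$ with finite norm: it consists of all $u\in L_2(\partial\Omega)$ that are $L_2$-limits of sequences of such functions which are Cauchy in this norm, and $\|u\,|\,X^k_\rho(\partial\Omega)\|$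 is the limit of the norms along such a sequence. *Dual wavelets.* Let $\tilde d\in\mathbb N$ and let $\tilde\psi_{j,\xi}\in L_2(\partial\Omega)$, $j\ge j^*$, $\xi\in\nabla_j=\bigcup_i\nabla_j^{F_i}$, be functions such that, with constants independent of $j,\xi$ and $i$: $\#\nabla_j^{F_i}\sim2^{2j}$; $\|\tilde\psi_{j,\xi}\,|\,L_2(\partial\Omega)\|\sim1$; $|\operatorname{supp}\tilde\psi_{j,\xi}|\sim2^{-2j}$; each $x\in\partial\Omega$ lies in at most $M$ of the supports $\operatorname{supp}\tilde\psi_{j,\xi}$, $\xi\in\nabla_j$; and $\int_{[0,1]^2}P\,\overline{(\tilde\psi_{j,\xi}\circ\kappa_i)}\,dx=0$ for all polynomials $P$ of total degree less than $\tilde d$ whenever $\operatorname{supp}\tilde\psi_{j,\xi}\subset F_i$. (The dual system of a biorthogonal wavelet Riesz basis on $\partial\Omega$ with these properties is the main example.) *Interior wavelets.* Fix constants $0<c,C<\infty$. Let $\nabla_{j,\rm int}=\bigcup_i\nabla_{j,\rm int}^{F_i}$, where $\nabla_{j,\rm int}^{F_i}$ is the set of $\xi\in\nabla_j^{F_i}$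 for which there are an axis-parallel closed square $Q\subset(0,1)^2$ and an open disc $B$ in the plane of $F_i$ with $\operatorname{supp}\tilde\psi_{j,\xi}\subset\kappa_i(Q)\subset B\subset F_i$, with $c\,|\operatorname{supp}\tilde\psi_{j,\xi}|^{1/2}\le\operatorname{rad}B\le C\,|\operatorname{supp}\tilde\psi_{j,\xi}|^{1/2}$, and with $\operatorname{dist}(B,\partial F_i)>2^{-j}$. **Proposition.** Let $k\in\{1,\dots,\tilde d\}$, $\rho\in(0,k)$ and $\frac12\le\frac1\tau<\frac12+\min\{\rho,k-\rho\}$. Then there is a finite constant $K$ such that for all $u\in X^k_\rho(\partial\Omega)$ $$\sum_{j\ge j^*}\ \sum_{\xi\in\nabla_{j,\rm int}}|\langle u,\tilde\psi_{j,\xi}\rangle|^\tau\ \le\ K\,\|u\,|\,X^k_\rho(\partial\Omega)\|^\tau .$$ -/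

import Mathlib

open Set Filter Topology MeasureTheory
open scoped ENNReal NNReal ComplexConjugate

noncomputable section

namespace BesovSurface

/-- The Euclidean plane. -/
abbrev E2 := EuclideanSpace ℝ (Fin 2)

/-- Euclidean three-space. -/
abbrev E3 := EuclideanSpace ℝ (Fin 3)

/-- The distance `inf {|a - b| : a ∈ A, b ∈ B}` of two sets (it is `∞` if one of them is empty). -/
def setDist {X : Type*} [PseudoEMetricSpace X] (A B : Set X) : ℝ≥0∞ :=
  ⨅ a ∈ A, ⨅ b ∈ B, edist a b

/-- The closed square `[a₀, a₀ + h] × [a₁, a₁ + h]`. -/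
def closedSquare (a : E2) (h : ℝ) : Set E2 := {x | ∀ m, x m ∈ Icc (a m) (a m + h)}

/-- The closed unit square `[0,1]²`. -/
def unitSquare : Set E2 := {x | ∀ m, x m ∈ Icc (0 : ℝ) 1}

/-- The open unit square `(0,1)²`. -/
def openUnitSquare : Set E2 := {x | ∀ m, x m ∈ Ioo (0 : ℝ) 1}

/-- `Ω` has a Lipschitz boundary: near each boundary point, and in suitable Cartesian coordinates
with vertical direction `e`, the set `Ω` consists of the points on or below the graph of a
Lipschitz function `f` of the other coordinates. -/
def HasLipschitzBoundary (Ω : Set E3) : Prop :=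
  ∀ x ∈ frontier Ω, ∃ (e : E3) (r : ℝ) (K : ℝ≥0) (f : E3 → ℝ),
    ‖e‖ = 1 ∧ 0 < r ∧ LipschitzWith K f ∧ (∀ (y : E3) (t : ℝ), f (y + t • e) = f y) ∧
      ∀ y ∈ Metric.ball x r, (y ∈ Ω ↔ inner ℝ e y ≤ f y)

/-- The tangent cone on `Ω` subordinate to the point `ν`. -/
def vertexCone (Ω : Set E3) (ν : E3) : Set E3 :=
  {x | x = ν ∨ ∃ c : ℝ, 0 < c ∧ ∀ γ ∈ Ico (0 : ℝ) c, ν + γ • (x - ν) ∈ Ω}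

/-- The point of the plane with polar coordinates `(r, φ)`. -/
def polarPoint (r φ : ℝ) : E2 := !₂[r * Real.cos φ, r * Real.sin φ]

/-- The open infinite plane sector with opening angle `γ`. -/
def sector (γ : ℝ) : Set E2 := {y | ∃ r φ : ℝ, 0 < r ∧ φ ∈ Ioo 0 γ ∧ y = polarPoint r φ}

/-- The surface of a bounded, simply connected, closed polyhedron `Ω ⊆ ℝ³` with Lipschitz boundary,
decomposed into `I` flat (not necessarily convex) quadrilateral patches, with vertices
`ν_1, …, ν_N` and with parametrizations of the patches over the unit square. -/
structure PolyhedralSurface (I N : ℕ) where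
  Ω : Set E3
  isCompact : IsCompact Ω
  regularClosed : closure (interior Ω) = Ω
  simplyConnected : SimplyConnectedSpace Ω
  lipschitz : HasLipschitzBoundary Ω
  /-- the vertices -/
  vertex : Fin N → E3
  vertex_injective : Function.Injective vertex
  /-- the four corners of each patch, in cyclic order -/
  corner : Fin I → Fin 4 → Fin N
  corner_injective : ∀ i, Function.Injective (corner i)
  vertex_used : ∀ n, ∃ i a, corner i a = n
  /-- Cartesian coordinates on the plane which contains the patch -/
  plane : Fin I → (E2 →ᵃⁱ[ℝ] E3)
  /-- the (open) patch in these Cartesian coordinates -/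
  region : Fin I → Set E2
  region_isOpen : ∀ i, IsOpen (region i)
  region_nonempty : ∀ i, (region i).Nonempty
  region_isBounded : ∀ i, Bornology.IsBounded (region i)
  /-- the patch is bounded by the closed polygonal chain through its four corners -/
  region_frontier : ∀ i, plane i '' frontier (region i) =
    ⋃ a, segment ℝ (vertex (corner i a)) (vertex (corner i (a + 1)))
  /-- adjacent edges of a patch meet in the common corner only -/
  chain_adjacent : ∀ i a,
    segment ℝ (vertex (corner i a)) (vertex (corner i (a + 1))) ∩
      segment ℝ (vertex (corner i (a + 1))) (vertex (corner i (a + 2))) =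
        {vertex (corner i (a + 1))}
  /-- opposite edges of a patch do not meet -/
  chain_opposite : ∀ i a,
    segment ℝ (vertex (corner i a)) (vertex (corner i (a + 1))) ∩
      segment ℝ (vertex (corner i (a + 2))) (vertex (corner i (a + 3))) = ∅
  /-- the patches decompose the boundary -/
  boundary_eq : frontier Ω = ⋃ i, closure (plane i '' region i)
  /-- two different closed patches are disjoint, or share exactly one vertex, or exactly one edge -/
  essentially_disjoint : ∀ i l, i ≠ l →
    closure (plane i '' region i) ∩ closure (plane l '' region l) = ∅ ∨
    (∃ a b, corner i a = corner l b ∧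
      closure (plane i '' region i) ∩ closure (plane l '' region l) = {vertex (corner i a)}) ∨
    (∃ a b, segment ℝ (vertex (corner i a)) (vertex (corner i (a + 1))) =
        segment ℝ (vertex (corner l b)) (vertex (corner l (b + 1))) ∧
      closure (plane i '' region i) ∩ closure (plane l '' region l) =
        segment ℝ (vertex (corner i a)) (vertex (corner i (a + 1))))
  /-- the parametrizations: bi-Lipschitz bijections of `[0,1]²` onto the closed patches -/
  κ : Fin I → E2 → E3
  κ_bijOn : ∀ i, BijOn (κ i) unitSquare (closure (plane i '' region i))
  κ_bilipschitz : ∀ i, ∃ L : ℝ, 0 < L ∧ ∀ x ∈ unitSquare, ∀ y ∈ unitSquare,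
    dist (κ i x) (κ i y) ≤ L * dist x y ∧ dist x y ≤ L * dist (κ i x) (κ i y)

namespace PolyhedralSurface

variable {I N : ℕ} (S : PolyhedralSurface I N)

/-- The surface `∂Ω`. -/
def bd : Set E3 := frontier S.Ω

/-- The (relatively open) patch `F_i`. -/
def patch (i : Fin I) : Set E3 := S.plane i '' S.region i

/-- The boundary `∂F_i` of the patch `F_i` within its plane. -/
def patchBd (i : Fin I) : Set E3 := S.plane i '' frontier (S.region i)

/-- The vertex `ν_n` is a corner of the patch `F_i`. -/
def Incident (n : Fin N) (i : Fin I) : Prop := ∃ a, S.corner i a = n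

/-- The surface measure on `∂Ω`. -/
def surfaceMeasure : Measure E3 :=
  ∑ i, (volume.restrict (S.region i)).map (S.plane i)

/-- The parametrizations are `k` times continuously differentiable on the open square, with bounded
derivatives up to order `k`. -/
def SmoothParam (k : ℕ) : Prop :=
  ∀ i, ContDiffOn ℝ k (S.κ i) openUnitSquare ∧
    ∀ m ≤ k, ∃ C : ℝ, ∀ x ∈ openUnitSquare, ‖iteratedFDeriv ℝ m (S.κ i) x‖ ≤ C

/-- The inner product `⟨u, v⟩ = ∑_i ⟨u ∘ κ_i, v ∘ κ_i⟩` given by the `L₂`-inner products on the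
unit square. -/
def pairing (u v : E3 → ℂ) : ℂ :=
  ∑ i, ∫ x in unitSquare, u (S.κ i x) * conj (v (S.κ i x))

/-- The class of patchwise smooth functions: globally continuous on `∂Ω`, and smooth up to the
boundary on each patch. -/
def PatchwiseSmooth (u : E3 → ℂ) : Prop :=
  ContinuousOn u S.bd ∧
    ∀ i, ∃ g : E3 → ℂ, ContDiff ℝ (⊤ : ℕ∞) g ∧ EqOn u g (closure (S.patch i))

/-- The support of a function on `∂Ω`. -/
def supp (f : E3 → ℂ) : Set E3 := closure (S.bd ∩ Function.support f)

end PolyhedralSurface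

/-- Local Cartesian coordinates on the faces of the tangent cones. The faces of the cone at `ν_n`
are in one-to-one correspondence with the patches `F_i` which have `ν_n` as a corner, so that they
are indexed by these `i`: the face `Γ^{n,i}` is the sector that coincides with `F_i` near `ν_n`.
The values of `chart n i` and `angle n i` for other `i` play no role. -/
structure ConeCharts {I N : ℕ} (S : PolyhedralSurface I N) where
  /-- the distance preserving maps `R_{n,i}` -/
  chart : Fin N → Fin I → (E2 →ᵃⁱ[ℝ] E3)
  /-- the opening angles -/
  angle : Fin N → Fin I → ℝ
  angle_mem : ∀ n i, S.Incident n i → angle n i ∈ Ioo 0 (2 * Real.pi)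
  chart_zero : ∀ n i, S.Incident n i → chart n i 0 = S.vertex n
  face_germ : ∀ n i, S.Incident n i → ∃ ε : ℝ, 0 < ε ∧
    Metric.ball (S.vertex n) ε ∩ (chart n i '' sector (angle n i)) =
      Metric.ball (S.vertex n) ε ∩ S.patch i
  cone_boundary : ∀ n, frontier (vertexCone S.Ω (S.vertex n)) =
    ⋃ i, ⋃ _ : S.Incident n i, closure (chart n i '' sector (angle n i))

namespace ConeCharts

variable {I N : ℕ} {S : PolyhedralSurface I N} (R : ConeCharts S)

/-- The open face `Γ^{n,i}` of the tangent cone at `ν_n`. -/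
def face (n : Fin N) (i : Fin I) : Set E3 := R.chart n i '' sector (R.angle n i)

end ConeCharts

/-- A special resolution of unity on `∂Ω` subordinate to the vertices. -/
structure SpecialResolution {I N : ℕ} (S : PolyhedralSurface I N) (R : ConeCharts S) where
  φ : Fin N → E3 → ℝ
  U₀ : Fin N → Set E3
  U₁ : Fin N → Set E3
  C₁ : ℝ
  C₁_pos : 0 < C₁
  nonneg : ∀ n, ∀ x ∈ S.bd, 0 ≤ φ n x
  smooth : ∀ n, S.PatchwiseSmooth (fun x => (φ n x : ℂ))
  sum_eq_one : ∀ x ∈ S.bd, ∑ n, φ n x = 1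
  U₀_open : ∀ n, ∃ V : Set E3, IsOpen V ∧ U₀ n = V ∩ S.bd
  U₁_open : ∀ n, ∃ V : Set E3, IsOpen V ∧ U₁ n = V ∩ S.bd
  vertex_mem : ∀ n, S.vertex n ∈ U₀ n
  U₀_ssubset : ∀ n, U₀ n ⊂ U₁ n
  U₁_ssubset : ∀ n, U₁ n ⊂ S.bd
  dist_patch : ∀ n l, S.vertex n ∉ closure (S.patch l) →
    ENNReal.ofReal C₁ ≤ setDist (U₁ n) (S.patch l)
  dist_face : ∀ n i, S.Incident n i →
    ENNReal.ofReal C₁ ≤ setDist (U₁ n ∩ R.face n i) (S.patch i \ R.face n i)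
  /-- within each patch at `ν_n`, the neighbourhood lies in the corresponding face of the cone -/
  U₁_face : ∀ n i, S.Incident n i → U₁ n ∩ S.patch i ⊆ R.face n i
  eq_one : ∀ n, ∀ x ∈ U₀ n, φ n x = 1
  eq_zero : ∀ n, ∀ x ∈ S.bd \ U₁ n, φ n x = 0

/-- The distance `q(φ) = min {φ, γ - φ}` to the boundary of the interval `(0, γ)`. -/
def angDist (γ φ : ℝ) : ℝ := min φ (γ - φ)

/-- The Lebesgue measure `r dr dφ` of the sector with opening angle `γ`, in polar coordinates. -/
def polarMeasure (γ : ℝ) : Measure (ℝ × ℝ) :=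
  (volume.restrict (Ioi (0 : ℝ) ×ˢ Ioo (0 : ℝ) γ)).withDensity (fun p => ENNReal.ofReal p.1)

/-- The mixed derivative `(∂/∂r)^a (∂/∂φ)^b` of a function `g` of the polar coordinates. -/
def polarDeriv (a b : ℕ) (g : ℝ → ℝ → ℂ) (p : ℝ × ℝ) : ℂ :=
  iteratedDeriv a (fun r => iteratedDeriv b (fun φ => g r φ) p.2) p.1

/-- The summand of the weighted Sobolev norm on a face with opening angle `γ` that belongs to the
multi-index `(a, b)`, for a function `g` on the sector given in polar coordinates. -/
def faceTerm (γ ρ μ : ℝ) (a b : ℕ) (g : ℝ → ℝ → ℂ) : ℝ≥0∞ :=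
  eLpNorm (fun p : ℝ × ℝ =>
    (p.1 ^ (-μ) * (1 + p.1) ^ μ * (angDist γ p.2 * p.1) ^ a *
      angDist γ p.2 ^ ((b : ℝ) - ρ)) • polarDeriv a b g p) 2 (polarMeasure γ)

/-- The pairs `(a, b)` of natural numbers with `1 ≤ a + b ≤ k`. -/
def multiIndices (k : ℕ) : Finset (ℕ × ℕ) :=
  (Finset.range (k + 1) ×ˢ Finset.range (k + 1)).filter
    (fun β => 1 ≤ β.1 + β.2 ∧ β.1 + β.2 ≤ k)

namespace SpecialResolution

variable {I N : ℕ} {S : PolyhedralSurface I N} {R : ConeCharts S} (Φ : SpecialResolution S R)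

open Classical in
/-- The function `φ_n u`, extended by zero to the boundary of the cone at `ν_n`, on the face
`Γ^{n,i}` and in polar coordinates. -/
def localPolar (n : Fin N) (i : Fin I) (u : E3 → ℂ) (r φ : ℝ) : ℂ :=
  if R.chart n i (polarPoint r φ) ∈ closure (S.patch i) then
    (Φ.φ n (R.chart n i (polarPoint r φ)) : ℂ) * u (R.chart n i (polarPoint r φ))
  else 0

open Classical in
/-- The weighted Sobolev norm with parameters `k, ρ, μ` of `φ_n u` on the boundary of the cone at
`ν_n`, for patchwise smooth `u`. -/
def coneNorm (k : ℕ) (ρ μ : ℝ) (n : Fin N) (u : E3 → ℂ) : ℝ≥0∞ :=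
  (∑ i with S.Incident n i,
      eLpNorm (fun p : ℝ × ℝ => Φ.localPolar n i u p.1 p.2) 2
        (polarMeasure (R.angle n i)) ^ (2 : ℝ)) ^ (1 / 2 : ℝ) +
    ∑ i with S.Incident n i, ∑ β ∈ multiIndices k,
      faceTerm (R.angle n i) ρ μ β.1 β.2 (Φ.localPolar n i u)

/-- The norm `∑_n ‖φ_n u | X^k_ρ(∂C_n)‖` of a patchwise smooth function `u`. -/
def smoothNorm (k : ℕ) (ρ : ℝ) (u : E3 → ℂ) : ℝ≥0∞ :=
  ∑ n, Φ.coneNorm k ρ ρ n u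

/-- `v` is a Cauchy sequence, for the norm of `X^k_ρ(∂Ω)`, of patchwise smooth functions of finite
norm, and it represents `u` (that is, it converges to `u` in `L₂(∂Ω)`). -/
def Approximates (k : ℕ) (ρ : ℝ) (v : ℕ → E3 → ℂ) (u : E3 → ℂ) : Prop :=
  (∀ m, S.PatchwiseSmooth (v m) ∧ Φ.smoothNorm k ρ (v m) < ⊤) ∧
  (∀ ε : ℝ≥0∞, 0 < ε → ∃ M, ∀ m ≥ M, ∀ l ≥ M, Φ.smoothNorm k ρ (v m - v l) ≤ ε) ∧
  Tendsto (fun m => eLpNorm (v m - u) 2 S.surfaceMeasure) atTop (𝓝 0)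

/-- The space `X^k_ρ(∂Ω)`, the completion of the patchwise smooth functions, inside `L₂(∂Ω)`. -/
def MemX (k : ℕ) (ρ : ℝ) (u : E3 → ℂ) : Prop :=
  MemLp u 2 S.surfaceMeasure ∧ ∃ v, Φ.Approximates k ρ v u

/-- The norm on `X^k_ρ(∂Ω)`: the limit of the norms of any sequence of patchwise smooth functions
that represents `u`. (The limit does not depend on the sequence, as differential operators are
closable; the infimum makes a choice of the sequence unnecessary.) -/
def xNorm (k : ℕ) (ρ : ℝ) (u : E3 → ℂ) : ℝ≥0∞ :=
  ⨅ (v : ℕ → E3 → ℂ) (_ : Φ.Approximates k ρ v u),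
    limsup (fun m => Φ.smoothNorm k ρ (v m)) atTop

end SpecialResolution

/-- A system of dual wavelets on `∂Ω` with vanishing moments of order `d`, indexed by the levels
`j ≥ j₀` and the elements `ξ` of the index sets `∇_j = ⋃_i ∇_j^{F_i}`. -/
structure DualWavelets {I N : ℕ} (S : PolyhedralSurface I N) (d : ℕ) (Ξ : Type*) where
  j₀ : ℕ
  /-- the index sets `∇_j^{F_i}` -/
  grid : ℕ → Fin I → Finset Ξ
  /-- the dual wavelets -/
  ψ : ℕ → Ξ → E3 → ℂ
  memLp : ∀ j ≥ j₀, ∀ i, ∀ ξ ∈ grid j i, MemLp (ψ j ξ) 2 S.surfaceMeasure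
  card_grid : ∃ c C : ℝ, 0 < c ∧ ∀ j ≥ j₀, ∀ i,
    c * 2 ^ (2 * j) ≤ ((grid j i).card : ℝ) ∧ ((grid j i).card : ℝ) ≤ C * 2 ^ (2 * j)
  normalized : ∃ c C : ℝ, 0 < c ∧ ∀ j ≥ j₀, ∀ i, ∀ ξ ∈ grid j i,
    ENNReal.ofReal c ≤ eLpNorm (ψ j ξ) 2 S.surfaceMeasure ∧
      eLpNorm (ψ j ξ) 2 S.surfaceMeasure ≤ ENNReal.ofReal C
  supp_area : ∃ c C : ℝ, 0 < c ∧ ∀ j ≥ j₀, ∀ i, ∀ ξ ∈ grid j i,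
    ENNReal.ofReal (c / 2 ^ (2 * j)) ≤ S.surfaceMeasure (S.supp (ψ j ξ)) ∧
      S.surfaceMeasure (S.supp (ψ j ξ)) ≤ ENNReal.ofReal (C / 2 ^ (2 * j))
  vanishing_moments : ∀ j ≥ j₀, ∀ i', ∀ ξ ∈ grid j i', ∀ i, S.supp (ψ j ξ) ⊆ S.patch i →
    ∀ P : MvPolynomial (Fin 2) ℂ, P.totalDegree < d →
      ∫ x in unitSquare, MvPolynomial.eval (fun m => (x m : ℂ)) P * conj (ψ j ξ (S.κ i x)) = 0
  finite_overlap : ∃ M : ℕ, ∀ j ≥ j₀, ∀ x ∈ S.bd,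
    {ξ | (∃ i, ξ ∈ grid j i) ∧ x ∈ S.supp (ψ j ξ)}.ncard ≤ M

namespace DualWavelets

variable {I N : ℕ} {S : PolyhedralSurface I N} {d : ℕ} {Ξ : Type*} (W : DualWavelets S d Ξ)

/-- The index sets `∇_{j,int}^{F_i}` of the interior wavelets; `c` and `C` are the constants in the
equivalence of the radius of the ball and the root of the area of the support. The square is
`closedSquare a h`, and the ball in the plane of `F_i` is the image of `Metric.ball z r`. -/
def interiorGridPatch (c C : ℝ) (j : ℕ) (i : Fin I) : Set Ξ :=
  {ξ | ξ ∈ W.grid j i ∧ ∃ (a : E2) (h : ℝ) (z : E2) (r : ℝ), 0 < h ∧ 0 < r ∧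
    closedSquare a h ⊆ openUnitSquare ∧
    S.supp (W.ψ j ξ) ⊆ S.κ i '' closedSquare a h ∧
    S.κ i '' closedSquare a h ⊆ S.plane i '' Metric.ball z r ∧
    S.plane i '' Metric.ball z r ⊆ S.patch i ∧
    c * √(S.surfaceMeasure.real (S.supp (W.ψ j ξ))) ≤ r ∧
    r ≤ C * √(S.surfaceMeasure.real (S.supp (W.ψ j ξ))) ∧
    ENNReal.ofReal (1 / 2 ^ j) < setDist (S.plane i '' Metric.ball z r) (S.patchBd i)}

/-- The index set `∇_{j,int}` of all interior wavelets at level `j`. -/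
def interiorGrid (c C : ℝ) (j : ℕ) : Set Ξ := ⋃ i, W.interiorGridPatch c C j i

end DualWavelets

end BesovSurface

end

open BesovSurface

/-! Fix a level j, put ε = 2^(-j), and let u be patchwise smooth. After localization by φ_n and
passage to Cartesian coordinates of one face, an interior coefficient is the integral of f ∘ lam
against a function with vanishing moments on a square Q of side ≲ ε; here f is smooth and lam is a
C^k bi-Lipschitz parametrization. Subtracting Taylor polynomials bounds it by ε^k times the
L₂(Q)-norm of the k-th derivative of f ∘ lam (`enorm_integral_mul_le_of_vanishing_moments`). By the
chain rule only derivatives of f of orders 1, …, k enter, and where q r ≥ t the weighted polar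
derivatives dominate these up to a factor t^(ρ-k). Hence a coefficient is ≲ ε^k t_ξ^(ρ-k) μ_ξ^(1/2)
(`exists_enorm_coefficient_le`), where t_ξ is the maximum of ε and the distance to the two lines
bounding the sector, and μ_ξ is the weighted energy of f over the image of Q.

The supports have area ≳ ε² and bounded overlap, so at most ≲ ε^(-2) x of the indices have t_ξ ≤ x,
by the area of a strip. Hölder's inequality with exponents 2/(2-τ) and 2/τ separates weights from
energies. The energies add up to at most a multiple of the squared norm; the sum of the weights over
dyadic shells is dominated by its innermost shell because 1/τ < 1/2 + (k-ρ). One level thus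
contributes ε^(ρτ-(2-τ)/2) times the τ-th power of the norm (`exists_sum_coefficient_rpow_le`). The
exponent of ε is positive because 1/τ < 1/2 + ρ, so the levels form a geometric series.

Hölder's inequality needs τ < 2; a slightly smaller exponent and the inclusion of sequence spaces
ℓ^p ⊆ ℓ^τ cover τ = 2 as well (`exists_coefficientSum_le`). For general u, each coefficient is
continuous in L₂, so finite partial sums pass to the limit along approximating sequences
(`coefficientSum_le_of_approximates`). -/

noncomputable section
namespace BesovSurface

/-! ### Taylor's formula along segments, with integral remainder. -/

section Taylor

variable {k : ℕ} {g : E2 → ℂ} {U : Set E2}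

/-- The Taylor polynomial of degree less than `k` of `g` at `y`, as a function of the increment. -/
def taylorSum (k : ℕ) (g : E2 → ℂ) (y v : E2) : ℂ :=
  ∑ l ∈ Finset.range k, ((l.factorial : ℝ)⁻¹) • iteratedFDeriv ℝ l g y (fun _ => v)

theorem hasDerivAt_iteratedFDeriv_line (hU : IsOpen U) (hg : ContDiffOn ℝ k g U) {l : ℕ}
    (hl : l < k) (y v : E2) {t : ℝ} (ht : y + t • v ∈ U) :
    HasDerivAt (fun t : ℝ => iteratedFDeriv ℝ l g (y + t • v) (fun _ => v))
      (iteratedFDeriv ℝ (l + 1) g (y + t • v) (fun _ => v)) t := by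
  have hc : ContDiffAt ℝ k g (y + t • v) := hg.contDiffAt (hU.mem_nhds ht)
  have hd : DifferentiableAt ℝ (iteratedFDeriv ℝ l g) (y + t • v) :=
    hc.differentiableAt_iteratedFDeriv (by exact_mod_cast hl)
  have hline : HasDerivAt (fun t : ℝ => y + t • v) v t := by
    simpa using ((hasDerivAt_id t).smul_const v).const_add y
  have h1 := hd.hasFDerivAt.comp_hasDerivAt t hline
  have h2 := (ContinuousMultilinearMap.apply ℝ (fun _ : Fin l => E2) ℂ
    (fun _ => v)).hasFDerivAt.comp_hasDerivAt t h1
  rw [iteratedFDeriv_succ_apply_left]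
  exact h2

/-- The base point moves along the segment while the increment shrinks, so their sum stays at y + v.
Differentiation telescopes and leaves only the top-order term; integrating it gives the remainder.
-/
theorem hasDerivAt_taylorSum_line (hU : IsOpen U) (y v : E2) {t : ℝ} (ht : y + t • v ∈ U) (m : ℕ)
    (hg : ContDiffOn ℝ (m + 1 : ℕ) g U) :
    HasDerivAt (fun t : ℝ => taylorSum (m + 1) g (y + t • v) ((1 - t) • v))
      (((1 - t) ^ m * (m.factorial : ℝ)⁻¹) • iteratedFDeriv ℝ (m + 1) g (y + t • v)
        (fun _ => v)) t := by
  induction m with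
  | zero =>
    have := hasDerivAt_iteratedFDeriv_line hU hg (l := 0) (by omega) y v ht
    simpa [taylorSum] using this
  | succ m ih =>
    have h1 := ih (hg.of_le (by exact_mod_cast Nat.le_succ _))
    have h2 := hasDerivAt_iteratedFDeriv_line hU hg (l := m + 1) (by omega) y v ht
    have h3 : HasDerivAt (fun t : ℝ => (1 - t) ^ (m + 1) * ((m + 1).factorial : ℝ)⁻¹)
        (-((1 - t) ^ m * (m.factorial : ℝ)⁻¹)) t := by
      have h4 : HasDerivAt (fun t : ℝ => 1 - t) (-1) t := by
        simpa using (hasDerivAt_id t).const_sub 1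
      have h5 := (h4.pow (m + 1)).mul_const (((m + 1).factorial : ℝ)⁻¹)
      refine h5.congr_deriv ?_
      rw [Nat.factorial_succ]
      have : (m.factorial : ℝ) ≠ 0 := by positivity
      have : ((m : ℝ) + 1) ≠ 0 := by positivity
      push_cast
      field_simp
    have h6 := h1.add (h3.smul h2)
    refine (h6.congr_deriv ?_).congr_of_eventuallyEq (Eventually.of_forall fun s => ?_)
    · simp only [neg_smul]
      abel
    · simp only [taylorSum, Pi.add_apply]
      rw [Finset.sum_range_succ]
      congr 1
      have : (fun _ : Fin (m + 1) => (1 - s) • v) = fun i => (fun _ => 1 - s) i • (fun _ => v) i :=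
        rfl
      rw [this, ContinuousMultilinearMap.map_smul_univ]
      simp only [Finset.prod_const, Finset.card_univ, Fintype.card_fin, smul_smul, Pi.smul_apply']
      rw [mul_comm]

theorem enorm_sub_taylorSum_le (hU : IsOpen U) (hk : 1 ≤ k) (hg : ContDiffOn ℝ k g U) {x y : E2}
    (hseg : ∀ s ∈ Icc (0 : ℝ) 1, y + s • (x - y) ∈ U) :
    ‖g x - taylorSum k g y (x - y)‖ₑ ≤
      ∫⁻ s in Icc (0 : ℝ) 1, ‖iteratedFDeriv ℝ k g (y + s • (x - y))‖ₑ * ‖x - y‖ₑ ^ k := by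
  obtain ⟨m, rfl⟩ : ∃ m, k = m + 1 := ⟨k - 1, by omega⟩
  set v := x - y
  set R' : ℝ → ℂ := fun t => ((1 - t) ^ m * (m.factorial : ℝ)⁻¹) •
    iteratedFDeriv ℝ (m + 1) g (y + t • v) (fun _ => v)
  have hcont : ContinuousOn R' (Icc 0 1) := by
    have h0 : ContinuousOn (iteratedFDeriv ℝ (m + 1) g) U := by
      intro z hz
      exact ((hg.contDiffAt (hU.mem_nhds hz)).iteratedFDeriv_right (m := 0) (i := m + 1)
        (by simp)).continuousAt.continuousWithinAt
    have h1 : ContinuousOn (fun t : ℝ => iteratedFDeriv ℝ (m + 1) g (y + t • v)) (Icc 0 1) :=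
      h0.comp (by fun_prop) hseg
    have h2 := (ContinuousMultilinearMap.apply ℝ (fun _ : Fin (m + 1) => E2) ℂ
      (fun _ => v)).continuous.comp_continuousOn h1
    exact ContinuousOn.smul (f := fun t : ℝ => (1 - t) ^ m * (m.factorial : ℝ)⁻¹) (by fun_prop) h2
  have hder : ∀ t ∈ uIcc (0 : ℝ) 1, HasDerivAt
      (fun t : ℝ => taylorSum (m + 1) g (y + t • v) ((1 - t) • v)) (R' t) t := by
    intro t ht
    rw [uIcc_of_le zero_le_one] at ht
    exact hasDerivAt_taylorSum_line hU y v (hseg t ht) m hg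
  have hint : IntervalIntegrable R' volume 0 1 := by
    apply ContinuousOn.intervalIntegrable
    rwa [uIcc_of_le zero_le_one]
  have h := intervalIntegral.integral_eq_sub_of_hasDerivAt hder hint
  -- At t = 1 the increment is zero, so every term of positive order drops out.
  have hx : taylorSum (m + 1) g (y + (1 : ℝ) • v) ((1 - 1 : ℝ) • v) = g x := by
    simp only [taylorSum, sub_self, zero_smul, one_smul]
    rw [Finset.sum_range_succ', Finset.sum_eq_zero]
    · simp [v]
    · intro l _
      rw [(iteratedFDeriv ℝ (l + 1) g (y + v)).map_coord_zero 0 rfl, smul_zero]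
  rw [hx] at h
  simp only [zero_smul, add_zero, sub_zero, one_smul] at h
  rw [← h, intervalIntegral.integral_of_le zero_le_one, ← integral_Icc_eq_integral_Ioc]
  refine (enorm_integral_le_lintegral_enorm _).trans ?_
  refine setLIntegral_mono' measurableSet_Icc fun t ht => ?_
  simp only [R', enorm_smul]
  -- The remainder kernel is at most 1 and is discarded, as constants do not matter.
  have h1 : ‖(1 - t) ^ m * (m.factorial : ℝ)⁻¹‖ₑ ≤ 1 := by
    rw [← ofReal_norm, ENNReal.ofReal_le_one, Real.norm_eq_abs,
      abs_of_nonneg (mul_nonneg (pow_nonneg (by linarith [ht.2]) _) (by positivity))]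
    have ha : (1 - t) ^ m ≤ 1 := pow_le_one₀ (by linarith [ht.2]) (by linarith [ht.1])
    have hb : (m.factorial : ℝ)⁻¹ ≤ 1 := inv_le_one_of_one_le₀ (by exact_mod_cast m.factorial_pos)
    exact mul_le_one₀ ha (by positivity) hb
  refine (mul_le_of_le_one_left' h1).trans ?_
  have h2 := (iteratedFDeriv ℝ (m + 1) g (y + t • v)).le_opNorm (fun _ => v)
  simp only [Finset.prod_const, Finset.card_univ, Fintype.card_fin] at h2
  rw [← ofReal_norm, ← ofReal_norm, ← ofReal_norm,
    ← ENNReal.ofReal_pow (norm_nonneg _), ← ENNReal.ofReal_mul (norm_nonneg _)]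
  exact ENNReal.ofReal_le_ofReal h2

/-- Expanding each argument x - y in the standard basis yields one product of m affine factors for
each word of length m. -/
theorem exists_mvPolynomial_eval_multilinear (m : ℕ)
    (M : ContinuousMultilinearMap ℝ (fun _ : Fin m => E2) ℂ) (y : E2) :
    ∃ P : MvPolynomial (Fin 2) ℂ, P.totalDegree ≤ m ∧
      ∀ x : E2, MvPolynomial.eval (fun i => (x i : ℂ)) P = M (fun _ => x - y) := by
  classical
  let e : Fin 2 → E2 := fun i => EuclideanSpace.single i (1 : ℝ)
  refine ⟨∑ r : Fin m → Fin 2, MvPolynomial.C (M fun j => e (r j)) *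
    ∏ j, (MvPolynomial.X (r j) - MvPolynomial.C (y (r j) : ℂ)), ?_, fun x => ?_⟩
  · refine MvPolynomial.totalDegree_finsetSum_le fun r _ => ?_
    refine (MvPolynomial.totalDegree_mul _ _).trans ?_
    rw [MvPolynomial.totalDegree_C, zero_add]
    refine (MvPolynomial.totalDegree_finsetProd _ _).trans ?_
    calc _ ≤ ∑ j : Fin m, 1 := Finset.sum_le_sum fun j _ => by
          refine (MvPolynomial.totalDegree_sub_C_le _ _).trans ?_
          rw [MvPolynomial.totalDegree_X]
      _ = m := by simp
  · have hx : ∀ z : E2, z = ∑ i, z i • e i := by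
      intro z
      ext i
      fin_cases i <;> simp [e, Fin.sum_univ_two]
    have h1 : (fun _ : Fin m => x - y) = fun _ => ∑ i, (x - y) i • e i := by
      funext _; exact hx _
    rw [h1]
    have h2 := M.toMultilinearMap.map_sum (fun _ i => (x - y) i • e i)
    simp only [ContinuousMultilinearMap.coe_coe] at h2
    rw [h2, map_sum]
    refine Finset.sum_congr rfl fun r _ => ?_
    have h3 := M.map_smul_univ (fun j => (x - y) (r j)) (fun j => e (r j))
    rw [h3]
    simp [mul_comm]

theorem exists_mvPolynomial_eval_taylorSum (hk : 1 ≤ k) (g : E2 → ℂ) (y : E2) :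
    ∃ P : MvPolynomial (Fin 2) ℂ, P.totalDegree < k ∧
      ∀ x : E2, MvPolynomial.eval (fun i => (x i : ℂ)) P = taylorSum k g y (x - y) := by
  choose P hP hPx using fun l => exists_mvPolynomial_eval_multilinear l (iteratedFDeriv ℝ l g y) y
  refine ⟨∑ l ∈ Finset.range k, MvPolynomial.C (((l.factorial : ℝ)⁻¹ : ℝ) : ℂ) * P l, ?_,
    fun x => ?_⟩
  · refine lt_of_le_of_lt (MvPolynomial.totalDegree_finsetSum_le (d := k - 1) fun l hl => ?_)
      (by omega)
    refine (MvPolynomial.totalDegree_mul _ _).trans ?_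
    rw [MvPolynomial.totalDegree_C, zero_add]
    exact (hP l).trans (by have := Finset.mem_range.1 hl; omega)
  · simp [taylorSum, hPx]

end Taylor

/-! ### Vanishing moments against smooth functions on a square. -/

section Moments

theorem lintegral_comp_smul_add {N : E2 → ℝ≥0∞} (hN : Measurable N) {c : ℝ} (hc : c ≠ 0) (b : E2) :
    ∫⁻ y, N (c • y + b) = ENNReal.ofReal |(c ^ 2)⁻¹| * ∫⁻ y, N y := by
  have h1 : ∫⁻ y, N (c • y + b) = ∫⁻ y, N (y + b) ∂(Measure.map (c • ·) volume) :=
    (lintegral_map (hN.comp (measurable_add_const b)) (measurable_const_smul c)).symm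
  rw [h1, Measure.map_addHaar_smul _ hc, lintegral_smul_measure,
    lintegral_add_right_eq_self (fun y => N y) b]
  simp

/-- Applied with c = s or c = 1 - s, whichever is at least 1/2; the Jacobian factor c^(-2) is then
at most 4. -/
theorem lintegral_comp_smul_add_le {N : E2 → ℝ≥0∞} (hN : Measurable N) {c : ℝ} (hc : 1 / 2 ≤ c)
    (b : E2) : ∫⁻ y, N (c • y + b) ≤ 4 * ∫⁻ y, N y := by
  rw [lintegral_comp_smul_add hN (by linarith) b]
  gcongr
  rw [show (4 : ℝ≥0∞) = ENNReal.ofReal 4 by norm_num]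
  apply ENNReal.ofReal_le_ofReal
  rw [abs_of_nonneg (by positivity), inv_le_comm₀ (by positivity) (by norm_num)]
  nlinarith

theorem lintegral_mul_le_sqrt {α : Type*} [MeasurableSpace α] (μ : Measure α) {f g : α → ℝ≥0∞}
    (hf : AEMeasurable f μ) (hg : AEMeasurable g μ) :
    ∫⁻ x, f x * g x ∂μ ≤
      (∫⁻ x, f x ^ 2 ∂μ) ^ (1 / 2 : ℝ) * (∫⁻ x, g x ^ 2 ∂μ) ^ (1 / 2 : ℝ) := by
  have := ENNReal.lintegral_mul_le_Lp_mul_Lq μ Real.HolderConjugate.two_two hf hg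
  simpa using this

theorem ENNReal_sqrt_four_mul (x : ℝ≥0∞) : (4 * x) ^ (1 / 2 : ℝ) = 2 * x ^ (1 / 2 : ℝ) := by
  rw [ENNReal.mul_rpow_of_nonneg _ _ (by norm_num)]
  congr 1
  rw [show (4 : ℝ≥0∞) = 2 ^ (2 : ℝ) by norm_num, ← ENNReal.rpow_mul]
  norm_num

theorem ENNReal_sqrt_mul_sqrt (x : ℝ≥0∞) : x ^ (1 / 2 : ℝ) * x ^ (1 / 2 : ℝ) = x := by
  rw [← ENNReal.rpow_add_of_nonneg _ _ (by norm_num) (by norm_num)]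
  norm_num

/-- The point y + s(x - y) is substituted for x when s ≥ 1/2 and for y when s ≤ 1/2. In both cases
the Jacobian is bounded, and the Cauchy–Schwarz inequality gives a bound uniform in s. -/
theorem lintegral_segment_average_le {Q : Set E2} {w N : E2 → ℝ≥0∞}
    (hw : Measurable w) (hN : Measurable N) :
    ∫⁻ y in Q, ∫⁻ x in Q, ∫⁻ s in Icc (0 : ℝ) 1, w x * N (y + s • (x - y)) ≤
      2 * volume Q * (∫⁻ x in Q, w x ^ 2) ^ (1 / 2 : ℝ) * (∫⁻ x, N x ^ 2) ^ (1 / 2 : ℝ) := by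
  set W := (∫⁻ x in Q, w x ^ 2) ^ (1 / 2 : ℝ)
  set V := (∫⁻ x, N x ^ 2) ^ (1 / 2 : ℝ)
  have hm : Measurable fun p : E2 × E2 × ℝ => w p.2.1 * N (p.1 + p.2.2 • (p.2.1 - p.1)) :=
    (hw.comp (by fun_prop)).mul (hN.comp (by fun_prop))
  have hsw : ∫⁻ y in Q, ∫⁻ x in Q, ∫⁻ s in Icc (0 : ℝ) 1, w x * N (y + s • (x - y)) =
      ∫⁻ s in Icc (0 : ℝ) 1, ∫⁻ y in Q, ∫⁻ x in Q, w x * N (y + s • (x - y)) := by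
    have h1 : ∀ y, ∫⁻ x in Q, ∫⁻ s in Icc (0 : ℝ) 1, w x * N (y + s • (x - y)) =
        ∫⁻ s in Icc (0 : ℝ) 1, ∫⁻ x in Q, w x * N (y + s • (x - y)) := fun y =>
      lintegral_lintegral_swap (hm.comp (by fun_prop : Measurable fun p : E2 × ℝ =>
        (y, p.1, p.2))).aemeasurable
    simp_rw [h1]
    refine lintegral_lintegral_swap (Measurable.aemeasurable ?_)
    exact Measurable.lintegral_prod_right' (f := fun p : (E2 × ℝ) × E2 =>
      w p.2 * N (p.1.1 + p.1.2 • (p.2 - p.1.1))) (hm.comp (by fun_prop :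
        Measurable fun p : (E2 × ℝ) × E2 => (p.1.1, p.2, p.1.2)))
  rw [hsw]
  have key : ∀ s ∈ Icc (0 : ℝ) 1, ∫⁻ y in Q, ∫⁻ x in Q, w x * N (y + s • (x - y)) ≤
      2 * volume Q * W * V := by
    intro s hs
    have hN2 : Measurable fun x => N x ^ 2 := hN.pow_const 2
    rcases le_total (1 / 2) s with h | h
    · have h1 : ∀ y, ∫⁻ x in Q, w x * N (y + s • (x - y)) ≤ W * (2 * V) := by
        intro y
        refine (lintegral_mul_le_sqrt _ hw.aemeasurable
          (hN.comp (by fun_prop)).aemeasurable).trans ?_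
        gcongr
        rw [← ENNReal_sqrt_four_mul]
        refine ENNReal.rpow_le_rpow ?_ (by norm_num)
        refine (setLIntegral_le_lintegral _ _).trans ?_
        refine le_trans (le_of_eq ?_) (lintegral_comp_smul_add_le hN2 h (y - s • y))
        refine lintegral_congr fun x => ?_
        simp only [Function.comp_apply]
        rw [show y + s • (x - y) = s • x + (y - s • y) by module]
      refine (lintegral_mono h1).trans ?_
      simp only [lintegral_const, Measure.restrict_apply, MeasurableSet.univ, univ_inter]
      apply le_of_eq; ring
    · have h1 : ∀ x, ∫⁻ y in Q, w x * N (y + s • (x - y)) ≤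
          w x * ((volume Q) ^ (1 / 2 : ℝ) * (2 * V)) := by
        intro x
        have hNx : Measurable fun y : E2 => N (y + s • (x - y)) := hN.comp (by fun_prop)
        rw [lintegral_const_mul _ hNx]
        gcongr
        have h2 := lintegral_mul_le_sqrt (volume.restrict Q) (f := fun _ => 1)
          (g := fun y => N (y + s • (x - y))) (by fun_prop) (hN.comp (by fun_prop)).aemeasurable
        simp only [one_mul, one_pow, lintegral_const, Measure.restrict_apply, MeasurableSet.univ,
          univ_inter] at h2
        refine h2.trans ?_
        gcongr
        rw [← ENNReal_sqrt_four_mul]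
        refine ENNReal.rpow_le_rpow ?_ (by norm_num)
        refine (setLIntegral_le_lintegral _ _).trans ?_
        refine le_trans (le_of_eq ?_) (lintegral_comp_smul_add_le hN2
          (show 1 / 2 ≤ 1 - s by linarith) (s • x))
        refine lintegral_congr fun y => ?_
        rw [show y + s • (x - y) = (1 - s) • y + s • x by module]
      rw [lintegral_lintegral_swap (f := fun y x => w x * N (y + s • (x - y)))
        (hm.comp (by fun_prop : Measurable fun p : E2 × E2 => (p.1, p.2, s))).aemeasurable]
      refine (lintegral_mono h1).trans ?_
      rw [lintegral_mul_const _ hw]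
      have h3 := lintegral_mul_le_sqrt (volume.restrict Q) (f := w) (g := fun _ => 1)
        hw.aemeasurable (by fun_prop)
      simp only [mul_one, one_pow, lintegral_const, Measure.restrict_apply, MeasurableSet.univ,
          univ_inter, one_mul] at h3
      calc _ ≤ (W * (volume Q) ^ (1 / 2 : ℝ)) * ((volume Q) ^ (1 / 2 : ℝ) * (2 * V)) := by gcongr
        _ = 2 * ((volume Q) ^ (1 / 2 : ℝ) * (volume Q) ^ (1 / 2 : ℝ)) * W * V := by ring
        _ = _ := by rw [ENNReal_sqrt_mul_sqrt]
  refine (setLIntegral_mono' measurableSet_Icc key).trans ?_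
  simp

theorem closedSquare_eq_image (a : E2) (h : ℝ) :
    closedSquare a h = (MeasurableEquiv.toLp 2 (Fin 2 → ℝ)).symm ⁻¹'
      (Set.pi univ fun m => Icc (a m) (a m + h)) := by
  ext x
  simp only [closedSquare, mem_ofPred_eq, mem_preimage, mem_univ_pi]
  rfl

theorem isClosed_closedSquare (a : E2) (h : ℝ) : IsClosed (closedSquare a h) := by
  simp only [closedSquare, ofPred_forall]
  exact isClosed_iInter fun m => isClosed_Icc.preimage (by fun_prop)

theorem convex_closedSquare (a : E2) (h : ℝ) : Convex ℝ (closedSquare a h) := by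
  intro x hx y hy s t hs ht hst m
  exact convex_Icc _ _ (hx m) (hy m) hs ht hst

theorem dist_le_of_mem_closedSquare {a x y : E2} {h : ℝ} (hx : x ∈ closedSquare a h)
    (hy : y ∈ closedSquare a h) : dist x y ≤ 2 * h := by
  have hx0 := hx 0; have hx1 := hx 1; have hy0 := hy 0; have hy1 := hy 1
  simp only [mem_Icc] at *
  have hh : 0 ≤ h := by linarith
  rw [EuclideanSpace.dist_eq, Fin.sum_univ_two, Real.sqrt_le_left (by linarith)]
  simp only [Real.dist_eq, sq_abs]
  have e0 : (x 0 - y 0) ^ 2 ≤ h ^ 2 := sq_le_sq' (by linarith) (by linarith)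
  have e1 : (x 1 - y 1) ^ 2 ≤ h ^ 2 := sq_le_sq' (by linarith) (by linarith)
  nlinarith

theorem isCompact_closedSquare (a : E2) (h : ℝ) : IsCompact (closedSquare a h) := by
  refine Metric.isCompact_of_isClosed_isBounded (isClosed_closedSquare a h) ?_
  rw [Metric.isBounded_iff]
  exact ⟨2 * h, fun x hx y hy => dist_le_of_mem_closedSquare hx hy⟩

theorem volume_closedSquare (a : E2) {h : ℝ} (hh : 0 ≤ h) :
    volume (closedSquare a h) = ENNReal.ofReal (h ^ 2) := by
  rw [closedSquare_eq_image, (EuclideanSpace.volume_preserving_symm_measurableEquiv_toLp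
    (Fin 2)).measure_preimage (MeasurableSet.univ_pi fun _ => measurableSet_Icc).nullMeasurableSet,
    volume_pi_pi]
  simp [ENNReal.ofReal_pow hh, Finset.prod_const]

/-- Functions with vanishing moments of order `k` annihilate smooth functions up to order `h ^ k`
on squares of side length `h`. -/
theorem enorm_integral_mul_le_of_vanishing_moments {k : ℕ} (hk : 1 ≤ k) {g ψ : E2 → ℂ} {U : Set E2}
    (hU : IsOpen U) (hg : ContDiffOn ℝ k g U) {a : E2} {h : ℝ} (hh : 0 < h)
    (hQU : closedSquare a h ⊆ U) (hψ : MemLp ψ 2 (volume.restrict (closedSquare a h)))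
    (hmom : ∀ P : MvPolynomial (Fin 2) ℂ, P.totalDegree < k →
      ∫ x in closedSquare a h, MvPolynomial.eval (fun m => (x m : ℂ)) P * conj (ψ x) = 0) :
    ‖∫ x in closedSquare a h, g x * conj (ψ x)‖ₑ ≤
      2 * ENNReal.ofReal (2 * h) ^ k * (∫⁻ x in closedSquare a h, ‖ψ x‖ₑ ^ 2) ^ (1 / 2 : ℝ) *
        (∫⁻ x in closedSquare a h, ‖iteratedFDeriv ℝ k g x‖ₑ ^ 2) ^ (1 / 2 : ℝ) := by
  set Q := closedSquare a h with hQ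
  have hQm : MeasurableSet Q := (isClosed_closedSquare a h).measurableSet
  have hvol : volume Q = ENNReal.ofReal (h ^ 2) := volume_closedSquare a hh.le
  have hvol0 : volume Q ≠ 0 := by rw [hvol]; simpa using by positivity
  have hvolt : volume Q ≠ ⊤ := by rw [hvol]; simp
  have : IsFiniteMeasure (volume.restrict Q) := ⟨by simpa using hvolt.lt_top⟩
  have hD : ContinuousOn (iteratedFDeriv ℝ k g) U := fun z hz =>
    ((hg.contDiffAt (hU.mem_nhds hz)).iteratedFDeriv_right (m := 0) (i := k)
      (by simp)).continuousAt.continuousWithinAt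
  -- Extension by zero allows substitutions over the whole plane. Nothing is lost on the segments
  -- used, since they stay in the convex square.
  set N : E2 → ℝ≥0∞ := Q.indicator fun z => ‖iteratedFDeriv ℝ k g z‖ₑ with hNdef
  have hN : Measurable N := by
    classical
    rw [hNdef, ← Set.piecewise_eq_indicator]
    exact ContinuousOn.measurable_piecewise ((hD.mono hQU).enorm) continuousOn_const hQm
  have hNsq : ∫⁻ x, N x ^ 2 = ∫⁻ x in Q, ‖iteratedFDeriv ℝ k g x‖ₑ ^ 2 := by
    rw [← lintegral_indicator hQm]
    congr 1 with x
    by_cases hx : x ∈ Q <;> simp [N, hx]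
  have hwae : AEMeasurable (fun x => ‖ψ x‖ₑ) (volume.restrict Q) := hψ.1.enorm
  set w := hwae.mk
  have hw : Measurable w := hwae.measurable_mk
  have hwψ : (fun x => ‖ψ x‖ₑ) =ᵐ[volume.restrict Q] w := hwae.ae_eq_mk
  have hwsq : ∫⁻ x in Q, ‖ψ x‖ₑ ^ 2 = ∫⁻ x in Q, w x ^ 2 :=
    lintegral_congr_ae (hwψ.fun_comp (· ^ 2))
  have hψint : Integrable (fun x => conj (ψ x)) (volume.restrict Q) := by
    have := (hψ.integrable (by norm_num)).norm
    refine (integrable_norm_iff ?_).1 (by simpa using this)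
    exact (Complex.continuous_conj.comp_aestronglyMeasurable hψ.1)
  have hmulint : ∀ f : E2 → ℂ, ContinuousOn f Q →
      Integrable (fun x => f x * conj (ψ x)) (volume.restrict Q) := by
    intro f hf
    obtain ⟨B, hB⟩ := (isCompact_closedSquare a h).exists_bound_of_continuousOn hf
    refine hψint.bdd_mul (c := B) (hf.aestronglyMeasurable hQm) ?_
    exact (ae_restrict_iff' hQm).2 (Eventually.of_forall hB)
  -- The moments permit subtracting the Taylor polynomial at any y in the square.
  have step1 : ∀ y ∈ Q, ‖∫ x in Q, g x * conj (ψ x)‖ₑ ≤ ENNReal.ofReal (2 * h) ^ k *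
      ∫⁻ x in Q, ∫⁻ s in Icc (0 : ℝ) 1, w x * N (y + s • (x - y)) := by
    intro y hy
    obtain ⟨P, hPd, hP⟩ := exists_mvPolynomial_eval_taylorSum hk g y
    have hcg : ContinuousOn g Q := hg.continuousOn.mono hQU
    have hcP : Continuous fun x : E2 => taylorSum k g y (x - y) := by
      simp_rw [← hP]
      exact (MvPolynomial.continuous_eval P).comp (by fun_prop)
    have e1 : ∫ x in Q, g x * conj (ψ x) =
        ∫ x in Q, (g x - taylorSum k g y (x - y)) * conj (ψ x) := by
      simp_rw [sub_mul]
      rw [integral_sub (hmulint _ hcg) (hmulint _ hcP.continuousOn)]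
      simp_rw [← hP]
      rw [hmom P hPd, sub_zero]
    rw [e1]
    refine (enorm_integral_le_lintegral_enorm _).trans ?_
    rw [← lintegral_const_mul]
    swap
    · exact Measurable.lintegral_prod_right' (f := fun p : E2 × ℝ =>
        w p.1 * N (y + p.2 • (p.1 - y))) ((hw.comp (by fun_prop)).mul (hN.comp (by fun_prop)))
    have hNs : ∀ x, Measurable fun s : ℝ => N (y + s • (x - y)) := fun x => hN.comp (by fun_prop)
    refine lintegral_mono_ae ?_
    filter_upwards [hwψ, ae_restrict_mem hQm] with x hx hxQ
    have hseg : ∀ s ∈ Icc (0 : ℝ) 1, y + s • (x - y) ∈ Q := fun s hs =>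
      (convex_closedSquare a h).add_smul_sub_mem hy hxQ hs
    rw [enorm_mul, lintegral_const_mul _ (hNs x), ← hx]
    have h1 := enorm_sub_taylorSum_le hU hk hg fun s hs => hQU (hseg s hs)
    have h2 : ∫⁻ s in Icc (0 : ℝ) 1, ‖iteratedFDeriv ℝ k g (y + s • (x - y))‖ₑ * ‖x - y‖ₑ ^ k ≤
        ENNReal.ofReal (2 * h) ^ k * ∫⁻ s in Icc (0 : ℝ) 1, N (y + s • (x - y)) := by
      rw [← lintegral_const_mul _ (hNs x)]
      refine setLIntegral_mono' measurableSet_Icc fun s hs => ?_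
      rw [mul_comm]
      simp only [N, indicator_of_mem (hseg s hs)]
      gcongr
      rw [← ofReal_norm, ← dist_eq_norm]
      exact ENNReal.ofReal_le_ofReal (dist_le_of_mem_closedSquare hxQ hy)
    have h3 : ‖conj (ψ x)‖ₑ = ‖ψ x‖ₑ := by simp [← ofReal_norm]
    rw [h3]
    calc _ ≤ (ENNReal.ofReal (2 * h) ^ k * ∫⁻ s in Icc (0 : ℝ) 1, N (y + s • (x - y))) *
          ‖ψ x‖ₑ := by gcongr; exact h1.trans h2
      _ = _ := by ring
  -- Averaging over y turns the segment integrals into an L₂-norm over the square, which they do not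
  -- obey for one fixed y. The factor `volume Q` produced on the left cancels at the end.
  have step2 := setLIntegral_mono' (μ := volume) hQm step1
  rw [lintegral_const, Measure.restrict_apply_univ] at step2
  rw [lintegral_const_mul] at step2
  swap
  · refine Measurable.lintegral_prod_right' (f := fun p : E2 × E2 =>
      ∫⁻ s in Icc (0 : ℝ) 1, w p.2 * N (p.1 + s • (p.2 - p.1))) ?_
    exact Measurable.lintegral_prod_right' (f := fun p : (E2 × E2) × ℝ =>
      w p.1.2 * N (p.1.1 + p.2 • (p.1.2 - p.1.1)))
      ((hw.comp (by fun_prop)).mul (hN.comp (by fun_prop)))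
  have step3 := step2.trans (mul_le_mul_right (lintegral_segment_average_le (Q := Q) hw hN) _)
  rw [← ENNReal.mul_le_mul_iff_left hvol0 hvolt, hwsq, ← hNsq]
  refine step3.trans (le_of_eq ?_)
  ring

end Moments

/-! ### Derivatives of compositions. -/

section Composition

variable {E F G : Type*} [NormedAddCommGroup E] [NormedSpace ℝ E] [NormedAddCommGroup F]
  [NormedSpace ℝ F] [NormedAddCommGroup G] [NormedSpace ℝ G]

theorem iteratedFDeriv_sub_const_apply {g : E → G} {z : E} {i : ℕ} (hi : 1 ≤ i)
    (hg : ContDiffAt ℝ i g z) (c : G) :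
    iteratedFDeriv ℝ i (fun y => g y - c) z = iteratedFDeriv ℝ i g z := by
  rw [fun_iteratedFDeriv_sub_apply hg contDiffAt_const, iteratedFDeriv_const_of_ne (by omega)]
  simp

/-- A bound of the `m`-th derivative of a composition that does not involve the values of the outer
function. -/
theorem norm_iteratedFDeriv_comp_le_sum {m : ℕ} {f : F → G} (hf : ContDiff ℝ m f) {lam : E → F}
    {x : E} (hlam : ContDiffAt ℝ m lam x) (hm : 1 ≤ m) {D : ℝ}
    (hD : ∀ i, 1 ≤ i → i ≤ m → ‖iteratedFDeriv ℝ i lam x‖ ≤ D ^ i) :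
    ‖iteratedFDeriv ℝ m (f ∘ lam) x‖ ≤
      m.factorial * (∑ i ∈ Finset.Icc 1 m, ‖iteratedFDeriv ℝ i f (lam x)‖) * D ^ m := by
  obtain ⟨u, hu, hlu⟩ := hlam.contDiffOn (m := m) le_rfl (by simp)
  obtain ⟨s, hsu, hs, hxs⟩ := mem_nhds_iff.1 hu
  -- Subtracting the value at the point removes the term of order zero from the chain-rule bound.
  -- This is needed because the weighted part of the norm contains only orders at least 1.
  set c := f (lam x)
  have hcomp : ContDiffAt ℝ m (f ∘ lam) x := hf.contDiffAt.comp x hlam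
  rw [← iteratedFDeriv_sub_const_apply hm hcomp c, ← iteratedFDerivWithin_of_isOpen m hs hxs]
  refine norm_iteratedFDerivWithin_comp_le (g := fun y => f y - c) (f := lam) (t := univ)
    (hf.sub contDiff_const).contDiffOn (hlu.mono hsu) le_rfl uniqueDiffOn_univ
    hs.uniqueDiffOn (mapsTo_univ _ _) hxs ?_ ?_
  · intro i hi
    rw [iteratedFDerivWithin_univ]
    rcases Nat.eq_zero_or_pos i with rfl | hi0
    · simp only [norm_iteratedFDeriv_zero, c, sub_self, norm_zero]
      exact Finset.sum_nonneg fun _ _ => norm_nonneg _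
    · rw [iteratedFDeriv_sub_const_apply hi0 (hf.contDiffAt.of_le (by exact_mod_cast hi))]
      exact Finset.single_le_sum (f := fun i => ‖iteratedFDeriv ℝ i f (lam x)‖)
        (fun _ _ => norm_nonneg _) (Finset.mem_Icc.2 ⟨hi0, hi⟩)
  · intro i h1 hi
    rw [iteratedFDerivWithin_of_isOpen i hs hxs]
    exact hD i h1 hi

end Composition

/-! ### Mixed partial derivatives in the polar parameters. -/

section Mixed

/-- The partial derivative in the direction `e`. -/
def dirDeriv (e : ℝ × ℝ) (F : ℝ × ℝ → ℂ) (p : ℝ × ℝ) : ℂ := fderiv ℝ F p e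

theorem contDiff_dirDeriv {F : ℝ × ℝ → ℂ} (hF : ContDiff ℝ (⊤ : ℕ∞) F) (e : ℝ × ℝ) :
    ContDiff ℝ (⊤ : ℕ∞) (dirDeriv e F) :=
  (hF.fderiv_right (m := (⊤ : ℕ∞)) (by simp)).clm_apply contDiff_const

theorem contDiff_dirDeriv_iterate {F : ℝ × ℝ → ℂ} (hF : ContDiff ℝ (⊤ : ℕ∞) F) (e : ℝ × ℝ)
    (a : ℕ) : ContDiff ℝ (⊤ : ℕ∞) ((dirDeriv e)^[a] F) := by
  induction a with
  | zero => exact hF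
  | succ a ih => rw [Function.iterate_succ_apply']; exact contDiff_dirDeriv ih e

theorem dirDeriv_comm {F : ℝ × ℝ → ℂ} (hF : ContDiff ℝ (⊤ : ℕ∞) F) (e e' : ℝ × ℝ) :
    dirDeriv e (dirDeriv e' F) = dirDeriv e' (dirDeriv e F) := by
  have h : ∀ e e' p, dirDeriv e (dirDeriv e' F) p = fderiv ℝ (fderiv ℝ F) p e e' := by
    intro e e' p
    have hd : DifferentiableAt ℝ (fderiv ℝ F) p :=
      (hF.fderiv_right (m := (⊤ : ℕ∞)) (by simp)).differentiable (by simp) p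
    change fderiv ℝ (fun q => fderiv ℝ F q e') p e = _
    rw [fderiv_clm_apply hd (differentiableAt_const _)]
    simp
  funext p
  rw [h, h]
  exact (hF.contDiffAt.isSymmSndFDerivAt (by
    rw [minSmoothness_of_isRCLikeNormedField]
    exact WithTop.coe_le_coe.2 (le_top (a := (2 : ℕ∞))))) e e'

theorem dirDeriv_iterate_comm {F : ℝ × ℝ → ℂ} (hF : ContDiff ℝ (⊤ : ℕ∞) F) (e e' : ℝ × ℝ)
    (a : ℕ) : dirDeriv e ((dirDeriv e')^[a] F) = (dirDeriv e')^[a] (dirDeriv e F) := by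
  induction a with
  | zero => rfl
  | succ a ih =>
    rw [Function.iterate_succ_apply', Function.iterate_succ_apply',
      dirDeriv_comm (contDiff_dirDeriv_iterate hF e' a), ih]

/-- Iterated one-variable derivatives become iterated directional derivatives of a function of two
variables, which commute. -/
theorem polarDeriv_eq_dirDeriv {F : ℝ × ℝ → ℂ} (hF : ContDiff ℝ (⊤ : ℕ∞) F) (a b : ℕ)
    (p : ℝ × ℝ) : polarDeriv a b (fun r φ => F (r, φ)) p =
      (dirDeriv (1, 0))^[a] ((dirDeriv (0, 1))^[b] F) p := by
  have h2 : ∀ (b : ℕ) (r : ℝ), iteratedDeriv b (fun φ => F (r, φ)) =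
      fun φ => (dirDeriv (0, 1))^[b] F (r, φ) := by
    intro b r
    induction b with
    | zero => simp
    | succ b ih =>
      rw [iteratedDeriv_succ, ih]
      funext φ
      rw [Function.iterate_succ_apply']
      have hd := ((contDiff_dirDeriv_iterate hF (0, 1) b).differentiable (by simp) (r, φ)).hasFDerivAt
      have hl : HasDerivAt (fun φ : ℝ => (r, φ)) ((0 : ℝ), (1 : ℝ)) φ :=
        (hasDerivAt_const φ r).prodMk (hasDerivAt_id φ)
      exact (hd.comp_hasDerivAt φ hl).deriv
  have h1 : ∀ (a : ℕ) {H : ℝ × ℝ → ℂ}, ContDiff ℝ (⊤ : ℕ∞) H → ∀ φ : ℝ,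
      iteratedDeriv a (fun r => H (r, φ)) = fun r => (dirDeriv (1, 0))^[a] H (r, φ) := by
    intro a H hH φ
    induction a with
    | zero => simp
    | succ b ih =>
      rw [iteratedDeriv_succ, ih]
      funext r
      rw [Function.iterate_succ_apply']
      have hd := ((contDiff_dirDeriv_iterate hH (1, 0) b).differentiable (by simp) (r, φ)).hasFDerivAt
      have hl : HasDerivAt (fun r : ℝ => (r, φ)) ((1 : ℝ), (0 : ℝ)) r :=
        (hasDerivAt_id r).prodMk (hasDerivAt_const r φ)
      exact (hd.comp_hasDerivAt r hl).deriv
  unfold polarDeriv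
  simp_rw [h2]
  rw [h1 a (contDiff_dirDeriv_iterate hF (0, 1) b)]

theorem continuous_polarDeriv {F : ℝ × ℝ → ℂ} (hF : ContDiff ℝ (⊤ : ℕ∞) F) (a b : ℕ) :
    Continuous (polarDeriv a b fun r φ => F (r, φ)) := by
  rw [show polarDeriv a b (fun r φ => F (r, φ)) =
    (dirDeriv (1, 0))^[a] ((dirDeriv (0, 1))^[b] F) from funext (polarDeriv_eq_dirDeriv hF a b)]
  exact (contDiff_dirDeriv_iterate (contDiff_dirDeriv_iterate hF _ b) _ a).continuous

/-- The standard basis vectors of the parameter plane. -/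
def basisVec (i : Fin 2) : ℝ × ℝ := if i = 0 then (1, 0) else (0, 1)

/-- By symmetry of second derivatives, any word in the two basis directions can be sorted into the
order used by `polarDeriv`. -/
theorem iteratedFDeriv_basisVec {F : ℝ × ℝ → ℂ} (hF : ContDiff ℝ (⊤ : ℕ∞) F) (m : ℕ)
    (w : Fin m → Fin 2) : ∃ a b, a + b = m ∧ ∀ p, iteratedFDeriv ℝ m F p (fun j => basisVec (w j)) =
      (dirDeriv (1, 0))^[a] ((dirDeriv (0, 1))^[b] F) p := by
  induction m with
  | zero => exact ⟨0, 0, rfl, fun p => by simp⟩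
  | succ m ih =>
    obtain ⟨a, b, hab, h⟩ := ih (Fin.tail w)
    have key : ∀ p, iteratedFDeriv ℝ (m + 1) F p (fun j => basisVec (w j)) =
        dirDeriv (basisVec (w 0)) ((dirDeriv (1, 0))^[a] ((dirDeriv (0, 1))^[b] F)) p := by
      intro p
      rw [← funext h, iteratedFDeriv_succ_apply_left]
      have hd : DifferentiableAt ℝ (iteratedFDeriv ℝ m F) p :=
        hF.differentiable_iteratedFDeriv (by exact_mod_cast WithTop.coe_lt_top m) p
      have := ((ContinuousMultilinearMap.apply ℝ (fun _ : Fin m => ℝ × ℝ) ℂ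
        (fun j => basisVec (Fin.tail w j))).hasFDerivAt.comp p hd.hasFDerivAt).fderiv
      unfold dirDeriv
      erw [this]
      rfl
    by_cases hw : w 0 = 0
    · refine ⟨a + 1, b, by omega, fun p => ?_⟩
      rw [key, Function.iterate_succ_apply']
      simp [basisVec, hw]
    · refine ⟨a, b + 1, by omega, fun p => ?_⟩
      rw [key, Function.iterate_succ_apply',
        ← dirDeriv_iterate_comm (contDiff_dirDeriv_iterate hF _ b)]
      simp [basisVec, hw]

/-- The full derivatives are controlled by the mixed partial derivatives. -/
theorem norm_iteratedFDeriv_le_polarDeriv {F : ℝ × ℝ → ℂ} (hF : ContDiff ℝ (⊤ : ℕ∞) F) {m : ℕ}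
    (hm : 1 ≤ m) (p : ℝ × ℝ) : ‖iteratedFDeriv ℝ m F p‖ ≤
      2 ^ m * ∑ β ∈ multiIndices m, ‖polarDeriv β.1 β.2 (fun r φ => F (r, φ)) p‖ := by
  set A := ∑ β ∈ multiIndices m, ‖polarDeriv β.1 β.2 (fun r φ => F (r, φ)) p‖
  have hA : 0 ≤ A := Finset.sum_nonneg fun _ _ => norm_nonneg _
  have hword : ∀ w : Fin m → Fin 2, ‖iteratedFDeriv ℝ m F p (fun j => basisVec (w j))‖ ≤ A := by
    intro w
    obtain ⟨a, b, hab, h⟩ := iteratedFDeriv_basisVec hF m w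
    rw [h, ← polarDeriv_eq_dirDeriv hF]
    refine Finset.single_le_sum
      (f := fun β : ℕ × ℕ => ‖polarDeriv β.1 β.2 (fun r φ => F (r, φ)) p‖)
      (fun _ _ => norm_nonneg _) (a := (a, b)) ?_
    simp only [multiIndices, Finset.mem_filter, Finset.mem_product, Finset.mem_range]
    omega
  refine ContinuousMultilinearMap.opNorm_le_bound (by positivity) fun v => ?_
  -- Expanding every argument in the basis gives 2^m words, each controlled by A.
  have hv : v = fun j => ∑ i : Fin 2, (if i = 0 then (v j).1 else (v j).2) • basisVec i := by
    funext j
    simp [Fin.sum_univ_two, basisVec]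
  have h2 := (iteratedFDeriv ℝ m F p).toMultilinearMap.map_sum
    (fun j i => (if i = 0 then (v j).1 else (v j).2) • basisVec i)
  simp only [ContinuousMultilinearMap.coe_coe] at h2
  rw [← hv] at h2
  rw [h2]
  refine (norm_sum_le _ _).trans ?_
  calc _ ≤ ∑ w : Fin m → Fin 2, A * ∏ j, ‖v j‖ := by
        refine Finset.sum_le_sum fun w _ => ?_
        have h3 := (iteratedFDeriv ℝ m F p).map_smul_univ
          (fun j => if w j = 0 then (v j).1 else (v j).2) (fun j => basisVec (w j))
        rw [h3, norm_smul, mul_comm, norm_prod]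
        gcongr with j
        · exact hword w
        · split_ifs
          · exact norm_fst_le (v j)
          · exact norm_snd_le (v j)
    _ = _ := by simp; ring

end Mixed


/-! ### Comparison of Cartesian and polar derivatives. -/

section Polar

/-- The rotation of the plane by the angle `θ`. -/
def planeRotation (θ : ℝ) : E2 ≃ₗᵢ[ℝ] E2 :=
  LinearIsometry.toLinearIsometryEquiv
    { toFun := fun y => !₂[Real.cos θ * y 0 - Real.sin θ * y 1, Real.sin θ * y 0 + Real.cos θ * y 1]
      map_add' := fun x y => by
        ext i; fin_cases i <;> simp <;> ring
      map_smul' := fun c y => by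
        ext i; fin_cases i <;> simp <;> ring
      norm_map' := fun y => by
        simp only [LinearMap.coe_mk, AddHom.coe_mk, EuclideanSpace.norm_eq, Fin.sum_univ_two,
          Real.norm_eq_abs, sq_abs]
        congr 1
        simp
        linear_combination (y 0 ^ 2 + y 1 ^ 2) * Real.sin_sq_add_cos_sq θ } rfl

theorem planeRotation_apply (θ : ℝ) (y : E2) : planeRotation θ y =
    !₂[Real.cos θ * y 0 - Real.sin θ * y 1, Real.sin θ * y 0 + Real.cos θ * y 1] := rfl

theorem planeRotation_polarPoint (θ r φ : ℝ) :
    planeRotation θ (polarPoint r φ) = polarPoint r (θ + φ) := by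
  rw [planeRotation_apply]
  ext i
  fin_cases i
  · simp [polarPoint, Real.cos_add]; ring
  · simp [polarPoint, Real.sin_add]; ring

theorem smul_polarPoint (c r φ : ℝ) : c • polarPoint r φ = polarPoint (c * r) φ := by
  ext i
  fin_cases i <;> simp [polarPoint, mul_assoc]

theorem contDiff_polarPoint : ContDiff ℝ (⊤ : ℕ∞) fun p : ℝ × ℝ => polarPoint p.1 p.2 := by
  rw [contDiff_euclidean]
  intro i
  fin_cases i
  · simp only [polarPoint]
    exact contDiff_fst.mul (Real.contDiff_cos.comp contDiff_snd)
  · simp only [polarPoint]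
    exact contDiff_fst.mul (Real.contDiff_sin.comp contDiff_snd)

theorem norm_polarPoint {r : ℝ} (hr : 0 ≤ r) (φ : ℝ) : ‖polarPoint r φ‖ = r := by
  rw [EuclideanSpace.norm_eq, Fin.sum_univ_two]
  simp only [polarPoint, Real.norm_eq_abs, sq_abs]
  rw [Real.sqrt_eq_iff_mul_self_eq (by positivity) hr]
  simp
  linear_combination r ^ 2 * Real.sin_sq_add_cos_sq φ

/-- Polar coordinates on the right half plane. -/
def polarInverse (y : E2) : ℝ × ℝ := (√(y 0 ^ 2 + y 1 ^ 2), Real.arctan (y 1 / y 0))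

theorem polarPoint_polarInverse {y : E2} (hy : 0 < y 0) :
    polarPoint (polarInverse y).1 (polarInverse y).2 = y := by
  have h1 : √(1 + (y 1 / y 0) ^ 2) = √(y 0 ^ 2 + y 1 ^ 2) / y 0 := by
    rw [show 1 + (y 1 / y 0) ^ 2 = (y 0 ^ 2 + y 1 ^ 2) / y 0 ^ 2 by field_simp,
      Real.sqrt_div (by positivity), Real.sqrt_sq hy.le]
  have h2 : 0 < √(y 0 ^ 2 + y 1 ^ 2) := Real.sqrt_pos.2 (by positivity)
  ext i
  fin_cases i
  · simp only [polarPoint, polarInverse, Real.cos_arctan, h1]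
    simp
    field_simp
  · simp only [polarPoint, polarInverse, Real.sin_arctan, h1]
    simp
    field_simp

theorem contDiffAt_polarInverse {y : E2} (hy : 0 < y 0) (n : ℕ) :
    ContDiffAt ℝ n polarInverse y := by
  have h0 : ContDiffAt ℝ n (fun y : E2 => y 0) y := by fun_prop
  have h1 : ContDiffAt ℝ n (fun y : E2 => y 1) y := by fun_prop
  refine ContDiffAt.prodMk ?_ ?_
  · exact ((h0.pow 2).add (h1.pow 2)).sqrt (by positivity)
  · exact (h1.div h0 hy.ne').arctan

theorem polarInverse_one : polarInverse (polarPoint 1 0) = (1, 0) := by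
  simp [polarInverse, polarPoint]

/-- The derivatives in Cartesian coordinates are controlled by those in polar coordinates. -/
theorem exists_norm_iteratedFDeriv_le_polarDeriv (m : ℕ) (hm : 1 ≤ m) : ∃ K : ℝ, 0 ≤ K ∧
    ∀ f : E2 → ℂ, ContDiff ℝ (⊤ : ℕ∞) f → ∀ r φ : ℝ, 0 < r →
      ‖iteratedFDeriv ℝ m f (polarPoint r φ)‖ ≤ K * ∑ β ∈ multiIndices m,
        r⁻¹ ^ m * r ^ β.1 * ‖polarDeriv β.1 β.2 (fun r φ => f (polarPoint r φ)) (r, φ)‖ := by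
  set e := polarPoint 1 0
  have he : (0 : ℝ) < e 0 := by simp [e, polarPoint]
  -- Rotations and dilations carry every point to e = (1, 0), so polar coordinates are inverted only
  -- near e. Hence D is independent of the point.
  set D : ℝ := 1 + ∑ i ∈ Finset.Icc 1 m, ‖iteratedFDeriv ℝ i polarInverse e‖
  have hD1 : 1 ≤ D := le_add_of_nonneg_right (Finset.sum_nonneg fun _ _ => norm_nonneg _)
  have hD : ∀ i, 1 ≤ i → i ≤ m → ‖iteratedFDeriv ℝ i polarInverse e‖ ≤ D ^ i := by
    intro i h1 hi
    have : ‖iteratedFDeriv ℝ i polarInverse e‖ ≤ D := by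
      have := Finset.single_le_sum (f := fun i => ‖iteratedFDeriv ℝ i polarInverse e‖)
        (fun _ _ => norm_nonneg _) (Finset.mem_Icc.2 ⟨h1, hi⟩)
      simp only [D]
      linarith
    exact this.trans (le_self_pow₀ hD1 (by omega))
  refine ⟨m.factorial * (m * 2 ^ m) * D ^ m, by positivity, fun f hf r φ hr => ?_⟩
  -- A maps e to the given point and B is its inverse. Composition with B costs a factor r⁻¹ for
  -- each derivative.
  set A : E2 →L[ℝ] E2 := r • (planeRotation φ : E2 →L[ℝ] E2)
  set B : E2 →L[ℝ] E2 := r⁻¹ • ((planeRotation φ).symm : E2 →L[ℝ] E2)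
  have hA : ∀ y, A y = r • planeRotation φ y := fun y => rfl
  have hB : ∀ y, B y = r⁻¹ • (planeRotation φ).symm y := fun y => rfl
  have hApol : ∀ t ω, A (polarPoint t ω) = polarPoint (r * t) (φ + ω) := by
    intro t ω
    rw [hA, planeRotation_polarPoint, smul_polarPoint]
  have hBe : B (polarPoint r φ) = e := by
    rw [hB, show polarPoint r φ = planeRotation φ (polarPoint r 0) by
      rw [planeRotation_polarPoint, add_zero], LinearIsometryEquiv.symm_apply_apply,
      smul_polarPoint, inv_mul_cancel₀ hr.ne']
  have hBnorm : ‖B‖ ≤ r⁻¹ := by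
    refine ContinuousLinearMap.opNorm_le_bound _ (by positivity) fun y => ?_
    rw [hB, norm_smul, LinearIsometryEquiv.norm_map, Real.norm_of_nonneg (by positivity)]
  have hAB : f = (f ∘ A) ∘ B := by
    funext y
    simp [hA, hB, smul_smul, hr.ne']
  set F : ℝ × ℝ → ℂ := fun p => f (polarPoint p.1 p.2)
  have hF : ContDiff ℝ (⊤ : ℕ∞) F := hf.comp contDiff_polarPoint
  set F' : ℝ × ℝ → ℂ := fun p => F (r * p.1, φ + p.2)
  have hF' : ContDiff ℝ (⊤ : ℕ∞) F' := hF.comp (by fun_prop)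
  have hcongr : f ∘ A =ᶠ[𝓝 e] F' ∘ polarInverse := by
    filter_upwards [(isOpen_lt continuous_const (by fun_prop : Continuous fun y : E2 => y 0)).mem_nhds he]
      with y hy
    have hy' : (0 : ℝ) < y 0 := hy
    simp only [Function.comp_apply, F', F]
    rw [← hApol, polarPoint_polarInverse hy']
  -- In the rescaled coordinates each radial derivative gains a factor r, and angular derivatives
  -- gain none.
  have hder : ∀ a b, polarDeriv a b (fun r φ => F' (r, φ)) (1, 0) =
      r ^ a • polarDeriv a b (fun r φ => F (r, φ)) (r, φ) := by
    intro a b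
    have h1 : ∀ t, iteratedDeriv b (fun ω => F' (t, ω)) 0 =
        iteratedDeriv b (fun ω => F (r * t, ω)) φ := by
      intro t
      have := congrFun (iteratedDeriv_comp_const_add b (fun ω => F (r * t, ω)) φ) 0
      simpa using this
    have h2 : ContDiff ℝ a (fun s => iteratedDeriv b (fun ω => F (s, ω)) φ) := by
      have h3 := polarDeriv_eq_dirDeriv hF 0 b
      have h4 : (fun s => iteratedDeriv b (fun ω => F (s, ω)) φ) =
          fun s => (dirDeriv (0, 1))^[b] F (s, φ) := by
        funext s
        have := h3 (s, φ)
        simpa [polarDeriv] using this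
      rw [h4]
      exact ((contDiff_dirDeriv_iterate hF (0, 1) b).comp (by fun_prop)).of_le
        (by exact_mod_cast le_top)
    unfold polarDeriv
    simp only [h1]
    have := congrFun (iteratedDeriv_comp_const_smul h2 r) 1
    simpa using this
  have hAe : ContDiff ℝ m (f ∘ A) := (hf.comp A.contDiff).of_le (by exact_mod_cast le_top)
  have h0 : iteratedFDeriv ℝ m f (polarPoint r φ) =
      (iteratedFDeriv ℝ m (f ∘ A) e).compContinuousLinearMap fun _ => B := by
    conv_lhs => rw [hAB]
    rw [B.iteratedFDeriv_comp_right hAe _ le_rfl, hBe]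
  rw [h0]
  refine (ContinuousMultilinearMap.norm_compContinuousLinearMap_le _ _).trans ?_
  rw [Finset.prod_const, Finset.card_univ, Fintype.card_fin]
  rw [hcongr.iteratedFDeriv ℝ m |>.eq_of_nhds]
  have h1 := norm_iteratedFDeriv_comp_le_sum (m := m) (hF'.of_le (by exact_mod_cast le_top))
    (contDiffAt_polarInverse he m) hm hD
  have h2 : ∑ i ∈ Finset.Icc 1 m, ‖iteratedFDeriv ℝ i F' (polarInverse e)‖ ≤
      (m * 2 ^ m) * ∑ β ∈ multiIndices m,
        r ^ β.1 * ‖polarDeriv β.1 β.2 (fun r φ => F (r, φ)) (r, φ)‖ := by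
    rw [mul_assoc]
    refine (Finset.sum_le_card_nsmul _ _ (2 ^ m * ∑ β ∈ multiIndices m,
        r ^ β.1 * ‖polarDeriv β.1 β.2 (fun r φ => F (r, φ)) (r, φ)‖) ?_).trans ?_
    · intro i hi
      rw [Finset.mem_Icc] at hi
      rw [polarInverse_one]
      refine (norm_iteratedFDeriv_le_polarDeriv hF' hi.1 _).trans ?_
      have hsub : multiIndices i ⊆ multiIndices m := by
        intro β
        simp only [multiIndices, Finset.mem_filter, Finset.mem_product, Finset.mem_range]
        omega
      gcongr ?_ * ?_
      · exact pow_le_pow_right₀ (by norm_num) hi.2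
      · refine (Finset.sum_le_sum_of_subset_of_nonneg hsub fun _ _ _ => norm_nonneg _).trans ?_
        refine Finset.sum_le_sum fun β _ => ?_
        rw [hder, norm_smul, Real.norm_of_nonneg (by positivity)]
    · simp
  calc _ ≤ (m.factorial * ((m * 2 ^ m) * ∑ β ∈ multiIndices m,
        r ^ β.1 * ‖polarDeriv β.1 β.2 (fun r φ => F (r, φ)) (r, φ)‖) * D ^ m) * r⁻¹ ^ m := by
        gcongr
        exact h1.trans (by gcongr)
    _ = _ := by
      simp only [mul_assoc, ← Finset.mul_sum]
      ring

end Polar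


/-! ### Distances in a sector and the area of strips around its bounding lines. -/

section Sector

theorem polarPoint_inj {r r' φ φ' : ℝ} (hr : 0 < r) (hr' : 0 < r')
    (hφ : |φ - φ'| < 2 * Real.pi) (h : polarPoint r φ = polarPoint r' φ') : r = r' ∧ φ = φ' := by
  have hrr : r = r' := by
    rw [← norm_polarPoint hr.le φ, ← norm_polarPoint hr'.le φ', h]
  subst hrr
  refine ⟨rfl, ?_⟩
  have h0 := congrArg (fun y : E2 => y 0) h
  have h1 := congrArg (fun y : E2 => y 1) h
  simp only [polarPoint] at h0 h1
  have hc : Real.cos φ = Real.cos φ' := mul_left_cancel₀ hr.ne' (by simpa using h0)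
  have hs : Real.sin φ = Real.sin φ' := mul_left_cancel₀ hr.ne' (by simpa using h1)
  obtain ⟨n, hn⟩ := Real.Angle.angle_eq_iff_two_pi_dvd_sub.1 (Real.Angle.cos_sin_inj hc hs)
  rw [hn, abs_mul, abs_of_pos Real.two_pi_pos] at hφ
  have hn1 : |(n : ℝ)| < 1 := by
    by_contra hcon
    push Not at hcon
    nlinarith [Real.pi_pos]
  have hn0 : n = 0 := by
    rw [← Int.cast_abs] at hn1
    exact Int.abs_lt_one_iff.1 (by exact_mod_cast hn1)
  rw [hn0] at hn
  simp at hn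
  linarith

theorem dist_polarPoint_le {r : ℝ} (hr : 0 ≤ r) (φ φ' : ℝ) :
    dist (polarPoint r φ) (polarPoint r φ') ≤ |φ - φ'| * r := by
  rw [EuclideanSpace.dist_eq, Fin.sum_univ_two]
  apply Real.sqrt_le_iff.2 ⟨by positivity, ?_⟩
  simp only [polarPoint, Real.dist_eq, sq_abs, mul_pow]
  have h1 := Real.one_sub_sq_div_two_le_cos (x := φ - φ')
  rw [Real.cos_sub] at h1
  simp
  nlinarith [Real.sin_sq_add_cos_sq φ, Real.sin_sq_add_cos_sq φ', sq_nonneg r,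
    mul_le_mul_of_nonneg_left h1 (sq_nonneg r)]

theorem polarPoint_zero_notMem_sector {γ : ℝ} (hγ : γ < 2 * Real.pi) {r : ℝ} (hr : 0 < r) :
    polarPoint r 0 ∉ sector γ := by
  rintro ⟨r', φ', hr', hφ', h⟩
  have := (polarPoint_inj hr hr' (by rw [zero_sub, abs_neg, abs_of_pos hφ'.1]; linarith [hφ'.2]) h).2
  linarith [hφ'.1]

theorem polarPoint_angle_notMem_sector {γ : ℝ} (hγ : γ < 2 * Real.pi) {r : ℝ} (hr : 0 < r) :
    polarPoint r γ ∉ sector γ := by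
  rintro ⟨r', φ', hr', hφ', h⟩
  have := (polarPoint_inj hr hr' (by rw [abs_of_pos (by linarith [hφ'.2])]; linarith [hφ'.1]) h).2
  linarith [hφ'.2]

/-- Each point of the sector has distance at most `q r` to its complement. -/
theorem exists_notMem_sector_dist_le {γ : ℝ} (hγ : γ < 2 * Real.pi) {r φ : ℝ} (hr : 0 < r)
    (hφ : φ ∈ Ioo 0 γ) : ∃ p ∉ sector γ, dist (polarPoint r φ) p ≤ angDist γ φ * r := by
  rcases le_total φ (γ - φ) with h | h
  · refine ⟨_, polarPoint_zero_notMem_sector hγ hr, ?_⟩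
    have := dist_polarPoint_le hr.le φ 0
    rw [sub_zero, abs_of_pos hφ.1] at this
    rwa [angDist, min_eq_left h]
  · refine ⟨_, polarPoint_angle_notMem_sector hγ hr, ?_⟩
    have := dist_polarPoint_le hr.le φ γ
    rw [abs_sub_comm, abs_of_pos (by linarith [hφ.2])] at this
    rwa [angDist, min_eq_right h]

/-- The segment from y to p is connected, so it meets the frontier, and none of its points is
farther from y than p. -/
theorem exists_mem_frontier_dist_le {G : Set E2} {y p : E2} (hy : y ∈ G) (hp : p ∉ G) :
    ∃ z ∈ frontier G, dist y z ≤ dist y p := by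
  have hconn : IsPreconnected (segment ℝ y p) := (convex_segment y p).isPreconnected
  by_contra hcon
  push Not at hcon
  have hdist : ∀ z ∈ segment ℝ y p, z ∉ frontier G := by
    intro z hz hzf
    refine absurd (hcon z hzf) (not_lt.2 ?_)
    have := dist_add_dist_of_mem_segment hz
    linarith [dist_nonneg (x := z) (y := p)]
  have hyi : y ∈ interior G := by
    by_contra h
    exact hdist y (left_mem_segment ℝ y p) ⟨subset_closure hy, h⟩
  have hpc : p ∈ (closure G)ᶜ := by
    intro h
    exact hdist p (right_mem_segment ℝ y p) ⟨h, fun h' => hp (interior_subset h')⟩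
  obtain ⟨z, -, hz1, hz2⟩ := hconn (interior G) (closure G)ᶜ isOpen_interior
    isClosed_closure.isOpen_compl (fun z hz => by
      by_contra h
      simp only [mem_union, mem_compl_iff, not_or, not_not] at h
      exact hdist z hz ⟨h.2, h.1⟩)
    ⟨y, left_mem_segment ℝ y p, hyi⟩ ⟨p, right_mem_segment ℝ y p, hpc⟩
  exact hz2 (interior_subset_closure hz1)

/-- The distance to the pair of lines which bound the sector. -/
def lineDist (γ : ℝ) (y : E2) : ℝ := min |y 1| |planeRotation (-γ) y 1|

theorem abs_coord_le_norm (y : E2) (i : Fin 2) : |y i| ≤ ‖y‖ := by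
  simpa using PiLp.norm_apply_le y i

theorem lineDist_le_add_dist (γ : ℝ) (y z : E2) : lineDist γ y ≤ lineDist γ z + dist y z := by
  have h : ∀ T : E2 ≃ₗᵢ[ℝ] E2, |T y 1| ≤ |T z 1| + dist y z := by
    intro T
    have h1 := abs_coord_le_norm (T y - T z) 1
    rw [← dist_eq_norm, T.dist_map] at h1
    have h2 := abs_sub_abs_le_abs_sub (T y 1) (T z 1)
    simp only [PiLp.sub_apply] at h1
    linarith
  unfold lineDist
  rw [← min_add_add_right]
  exact min_le_min (h (LinearIsometryEquiv.refl ℝ E2)) (h _)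

/-- This is |sin ω| ≤ |ω|. Whole lines serve instead of bounding rays: the distance to them still
stays below q r, is 1-Lipschitz, and has strips as sublevel sets. -/
theorem lineDist_polarPoint_le {γ r φ : ℝ} (hr : 0 < r) (hφ : φ ∈ Ioo 0 γ) :
    lineDist γ (polarPoint r φ) ≤ angDist γ φ * r := by
  rw [lineDist, angDist, min_mul_of_nonneg _ _ hr.le, planeRotation_polarPoint]
  have h : ∀ ω : ℝ, |polarPoint r ω 1| ≤ |ω| * r := by
    intro ω
    simp only [polarPoint]
    simp only [Matrix.cons_val_one, Matrix.cons_val_zero]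
    rw [abs_mul, abs_of_pos hr, mul_comm]
    exact mul_le_mul_of_nonneg_right Real.abs_sin_le_abs hr.le
  refine min_le_min ?_ ?_
  · simpa [abs_of_pos hφ.1] using h φ
  · have := h (-γ + φ)
    rwa [show |-γ + φ| = γ - φ by rw [abs_of_neg] <;> linarith [hφ.2]] at this

theorem volume_abs_coord_le (R t : ℝ) :
    volume {y : E2 | ‖y‖ ≤ R ∧ |y 1| ≤ t} ≤ ENNReal.ofReal (2 * R) * ENNReal.ofReal (2 * t) := by
  have hsub : {y : E2 | ‖y‖ ≤ R ∧ |y 1| ≤ t} ⊆ (MeasurableEquiv.toLp 2 (Fin 2 → ℝ)).symm ⁻¹'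
      (Set.pi univ ![Icc (-R) R, Icc (-t) t]) := by
    rintro y ⟨hy, hyt⟩
    have h0 := (abs_coord_le_norm y 0).trans hy
    rw [mem_preimage, mem_univ_pi, Fin.forall_fin_two]
    exact ⟨abs_le.1 h0, abs_le.1 hyt⟩
  refine (measure_mono hsub).trans ?_
  rw [(EuclideanSpace.volume_preserving_symm_measurableEquiv_toLp
    (Fin 2)).measure_preimage (MeasurableSet.univ_pi fun i => by
      fin_cases i <;> exact measurableSet_Icc).nullMeasurableSet, volume_pi_pi]
  simp [two_mul]

theorem volume_lineDist_le (γ R t : ℝ) : volume {y : E2 | ‖y‖ ≤ R ∧ lineDist γ y ≤ t} ≤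
    2 * (ENNReal.ofReal (2 * R) * ENNReal.ofReal (2 * t)) := by
  set T := planeRotation (-γ)
  have hsub : {y : E2 | ‖y‖ ≤ R ∧ lineDist γ y ≤ t} ⊆ {y : E2 | ‖y‖ ≤ R ∧ |y 1| ≤ t} ∪
      T ⁻¹' {y : E2 | ‖y‖ ≤ R ∧ |y 1| ≤ t} := by
    rintro y ⟨hy, hyt⟩
    rcases min_le_iff.1 hyt with h | h
    · exact Or.inl ⟨hy, h⟩
    · exact Or.inr ⟨by rwa [LinearIsometryEquiv.norm_map], h⟩
  have hm : MeasurableSet {y : E2 | ‖y‖ ≤ R ∧ |y 1| ≤ t} :=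
    ((isClosed_le continuous_norm continuous_const).inter (isClosed_le
      (by fun_prop : Continuous fun y : E2 => |y 1|) continuous_const)).measurableSet
  refine (measure_mono hsub).trans ((measure_union_le _ _).trans ?_)
  rw [T.measurePreserving.measure_preimage hm.nullMeasurableSet, two_mul]
  gcongr <;> exact volume_abs_coord_le R t

end Sector

/-! ### Integration in polar coordinates and under bi-Lipschitz maps. -/

section ChangeOfVariables

theorem measurable_polarPoint : Measurable fun p : ℝ × ℝ => polarPoint p.1 p.2 :=
  contDiff_polarPoint.continuous.measurable

/-- The change of variables to polar coordinates on a sector. -/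
theorem setLIntegral_inter_sector {γ : ℝ} (hγ : γ ≤ 2 * Real.pi) {E : Set E2}
    (hE : MeasurableSet E) {H : E2 → ℝ≥0∞} (hH : Measurable H) :
    ∫⁻ y in E ∩ sector γ, H y =
      ∫⁻ p in {p : ℝ × ℝ | polarPoint p.1 p.2 ∈ E}, H (polarPoint p.1 p.2) ∂(polarMeasure γ) := by
  set e : E2 ≃ᵐ ℝ × ℝ := (MeasurableEquiv.toLp 2 (Fin 2 → ℝ)).symm.trans MeasurableEquiv.finTwoArrow
  have he : MeasurePreserving e :=
    (volume_preserving_finTwoArrow ℝ).comp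
      (EuclideanSpace.volume_preserving_symm_measurableEquiv_toLp (Fin 2))
  have hep : ∀ p : ℝ × ℝ, e (polarPoint p.1 p.2) = polarCoord.symm p := fun p => rfl
  have hesymm : ∀ p : ℝ × ℝ, e.symm (polarCoord.symm p) = polarPoint p.1 p.2 := fun p => by
    rw [← hep, e.symm_apply_apply]
  set T : Set (ℝ × ℝ) := Ioi (0 : ℝ) ×ˢ Ioo (0 : ℝ) γ
  have hT : MeasurableSet T := measurableSet_Ioi.prod measurableSet_Ioo
  set P : Set (ℝ × ℝ) := {p : ℝ × ℝ | polarPoint p.1 p.2 ∈ E}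
  have hP : MeasurableSet P := measurable_polarPoint hE
  have hset : E ∩ sector γ = e ⁻¹' (polarCoord.symm '' (P ∩ T)) := by
    ext y
    constructor
    · rintro ⟨hyE, r, φ, hr, hφ, rfl⟩
      exact ⟨(r, φ), ⟨hyE, hr, hφ⟩, (hep (r, φ)).symm⟩
    · rintro ⟨p, ⟨hpE, hpr, hpφ⟩, hp⟩
      rw [← hep] at hp
      rw [← e.injective hp]
      exact ⟨hpE, p.1, p.2, hpr, hpφ, rfl⟩
  -- The angles fill (0, γ) with γ ≤ 2π instead of the range (-π, π) of `polarCoord`, so injectivity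
  -- is checked directly.
  have hinj : InjOn polarCoord.symm (P ∩ T) := by
    rintro p ⟨-, hp1, hp2⟩ p' ⟨-, hp1', hp2'⟩ h
    have h' : polarPoint p.1 p.2 = polarPoint p'.1 p'.2 := by rw [← hesymm, h, hesymm]
    have := polarPoint_inj hp1 hp1' (abs_lt.2
      ⟨by linarith [hp2.1, hp2'.2], by linarith [hp2.2, hp2'.1]⟩) h'
    exact Prod.ext this.1 this.2
  have hH' : ∀ y, H y = (H ∘ e.symm) (e y) := fun y => by simp
  rw [hset]
  simp_rw [hH']
  rw [he.setLIntegral_comp_preimage_emb e.measurableEmbedding,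
    lintegral_image_eq_lintegral_abs_det_fderiv_mul volume (hP.inter hT)
      (fun p _ => (hasFDerivAt_polarCoord_symm p).hasFDerivWithinAt) hinj, polarMeasure,
    restrict_withDensity hP, Measure.restrict_restrict hP,
    lintegral_withDensity_eq_lintegral_mul _ (by fun_prop) (by
      exact hH.comp (by simpa using measurable_polarPoint))]
  refine setLIntegral_congr_fun (hP.inter hT) fun p hp => ?_
  simp only [det_fderivPolarCoordSymm, Function.comp_apply, Pi.mul_apply, hesymm, e.symm_apply_apply]
  rw [abs_of_pos hp.2.1]

/-- The inverse of lam on its image is L-Lipschitz, so it enlarges two-dimensional Hausdorff measure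
by at most L². Lebesgue measure is a constant multiple of that measure, and the constant appears on
both sides. -/
theorem volume_inter_preimage_le {lam : E2 → E2} {S : Set E2} {L : ℝ≥0}
    (hL : ∀ x ∈ S, ∀ y ∈ S, dist x y ≤ L * dist (lam x) (lam y)) (A : Set E2) :
    volume (S ∩ lam ⁻¹' A) ≤ (L : ℝ≥0∞) ^ 2 * volume A := by
  have hle : (μH[2] : Measure E2) (S ∩ lam ⁻¹' A) ≤ (L : ℝ≥0∞) ^ 2 * μH[2] A := by
    set ν := Function.invFunOn lam S
    have hinj : InjOn lam S := by
      intro x hx y hy hxy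
      have := hL x hx y hy
      rw [hxy, dist_self, mul_zero] at this
      exact dist_le_zero.1 this
    have hν : ∀ x ∈ S, ν (lam x) = x := fun x hx => hinj.leftInvOn_invFunOn hx
    have hlip : LipschitzOnWith L ν (lam '' S ∩ A) := by
      refine LipschitzOnWith.of_dist_le_mul ?_
      rintro _ ⟨⟨x, hx, rfl⟩, -⟩ _ ⟨⟨y, hy, rfl⟩, -⟩
      rw [hν x hx, hν y hy]
      exact hL x hx y hy
    have hsub : S ∩ lam ⁻¹' A ⊆ ν '' (lam '' S ∩ A) := by
      rintro x ⟨hx, hxA⟩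
      exact ⟨lam x, ⟨⟨x, hx, rfl⟩, hxA⟩, hν x hx⟩
    have h := hlip.hausdorffMeasure_image_le (d := 2) (by norm_num)
    rw [ENNReal.rpow_ofNat] at h
    exact (measure_mono hsub).trans (h.trans (by gcongr; exact inter_subset_right))
  have hHaar : (μH[2] : Measure E2).IsAddHaarMeasure := by
    have := isAddHaarMeasure_hausdorffMeasure (E := E2)
    simpa using this
  rw [Measure.isAddLeftInvariant_eq_smul (volume : Measure E2) μH[2]]
  simp only [Measure.smul_apply]
  rw [ENNReal.smul_def, ENNReal.smul_def, smul_eq_mul, smul_eq_mul]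
  calc _ ≤ _ * ((L : ℝ≥0∞) ^ 2 * μH[2] A) := by gcongr
    _ = _ := by ring

theorem map_restrict_le_of_dist_le {lam : E2 → E2} {S : Set E2} (hSm : MeasurableSet S)
    (hlam : ContinuousOn lam S) {L : ℝ≥0}
    (hL : ∀ x ∈ S, ∀ y ∈ S, dist x y ≤ L * dist (lam x) (lam y)) {A : Set E2}
    (hSA : MapsTo lam S A) :
    (volume.restrict S).map lam ≤ (L : ℝ≥0∞) ^ 2 • volume.restrict A := by
  refine Measure.le_iff.2 fun s hs => ?_
  rw [Measure.map_apply_of_aemeasurable (hlam.aemeasurable hSm) hs, Measure.smul_apply,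
    smul_eq_mul, Measure.restrict_apply hs, Measure.restrict_apply' hSm]
  refine le_trans (measure_mono ?_) (volume_inter_preimage_le hL (s ∩ A))
  exact fun x hx => ⟨hx.2, hx.1, hSA hx.2⟩

end ChangeOfVariables


/-! ### The estimate of a single coefficient by the weighted energy. -/

section Coefficient

/-- The sum of the moduli of the weighted derivatives of order at most `k` in polar coordinates. -/
def weightedSum (γ ρ : ℝ) (k : ℕ) (g : ℝ → ℝ → ℂ) (p : ℝ × ℝ) : ℝ :=
  ∑ β ∈ multiIndices k, ‖(p.1 ^ (-ρ) * (1 + p.1) ^ ρ * (angDist γ p.2 * p.1) ^ β.1 *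
      angDist γ p.2 ^ ((β.2 : ℝ) - ρ)) • polarDeriv β.1 β.2 g p‖

/-- The sum of the norms of the derivatives of orders `1, …, k`. -/
def derivSum (k : ℕ) (f : E2 → ℂ) (y : E2) : ℝ := ∑ m ∈ Finset.Icc 1 k, ‖iteratedFDeriv ℝ m f y‖

theorem continuous_derivSum (k : ℕ) {f : E2 → ℂ} (hf : ContDiff ℝ (⊤ : ℕ∞) f) :
    Continuous (derivSum k f) :=
  continuous_finsetSum _ fun m _ =>
    (hf.continuous_iteratedFDeriv (m := m) (by exact_mod_cast le_top)).norm

/-- With c = m - a - b and d = k - m, the left side equals (q r)^d q^c (q r)^(ρ-k) times the weight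
without its factor (1 + r)^ρ ≥ 1. Since ρ < k, (q r)^(ρ-k) ≤ t^(ρ-k); the other powers of q and q r
are absorbed by B^k. -/
theorem inv_pow_mul_pow_le_weight {ρ r q t B : ℝ} {k m a b : ℕ} (hρ0 : 0 < ρ) (hρ : ρ < k)
    (hr : 0 < r) (hq : 0 < q) (hB : 1 ≤ B) (hqB : q ≤ B) (hqr : q * r ≤ B) (ht : 0 < t)
    (htq : t ≤ q * r) (hab : a + b ≤ m) (hmk : m ≤ k) :
    r⁻¹ ^ m * r ^ a ≤ B ^ k * t ^ (ρ - k) *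
      (r ^ (-ρ) * (1 + r) ^ ρ * (q * r) ^ a * q ^ ((b : ℝ) - ρ)) := by
  obtain ⟨c, rfl⟩ := Nat.exists_eq_add_of_le hab
  obtain ⟨d, rfl⟩ := Nat.exists_eq_add_of_le hmk
  have hA : 0 < r ^ ρ := Real.rpow_pos_of_pos hr _
  have hQ : 0 < q ^ ρ := Real.rpow_pos_of_pos hq _
  have hqr0 : 0 < q * r := mul_pos hq hr
  have e1 : r ^ (-ρ) = (r ^ ρ)⁻¹ := Real.rpow_neg hr.le _
  have e2 : q ^ ((b : ℝ) - ρ) = q ^ b / q ^ ρ := by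
    rw [Real.rpow_sub hq, Real.rpow_natCast]
  have e3 : (q * r) ^ (ρ - (a + b + c + d : ℕ)) = q ^ ρ * r ^ ρ / (q * r) ^ (a + b + c + d) := by
    rw [Real.rpow_sub hqr0, Real.rpow_natCast, Real.mul_rpow hq.le hr.le]
  have h1 : r⁻¹ ^ (a + b + c) * r ^ a = ((q * r) ^ d * q ^ c) *
      (q * r) ^ (ρ - (a + b + c + d : ℕ)) *
      (r ^ (-ρ) * 1 * (q * r) ^ a * q ^ ((b : ℝ) - ρ)) := by
    rw [e1, e2, e3, inv_pow]
    field_simp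
    ring
  rw [h1]
  have h2 : (q * r) ^ (ρ - (a + b + c + d : ℕ)) ≤ t ^ (ρ - (a + b + c + d : ℕ)) :=
    Real.rpow_le_rpow_of_nonpos ht htq (by linarith)
  have h3 : (q * r) ^ d * q ^ c ≤ B ^ (a + b + c + d) := by
    calc (q * r) ^ d * q ^ c ≤ B ^ d * B ^ c := by gcongr
      _ = B ^ (d + c) := (pow_add _ _ _).symm
      _ ≤ _ := pow_le_pow_right₀ hB (by omega)
  have h4 : (1 : ℝ) ≤ (1 + r) ^ ρ := Real.one_le_rpow (by linarith) hρ0.le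
  have h5 : 0 ≤ r ^ (-ρ) := Real.rpow_nonneg hr.le _
  have h6 : 0 ≤ q ^ ((b : ℝ) - ρ) := Real.rpow_nonneg hq.le _
  have h7 : 0 ≤ (q * r) ^ (ρ - (a + b + c + d : ℕ)) := Real.rpow_nonneg hqr0.le _
  gcongr

/-- The derivatives are controlled by the weighted derivatives in polar coordinates. -/
theorem exists_derivSum_le_weightedSum {γ ρ R₀ : ℝ} {k : ℕ} (hγ : γ < 2 * Real.pi) (hρ0 : 0 < ρ)
    (hρ : ρ < k) : ∃ K : ℝ, 0 ≤ K ∧ ∀ f : E2 → ℂ, ContDiff ℝ (⊤ : ℕ∞) f → ∀ r φ t : ℝ, 0 < r →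
      φ ∈ Ioo 0 γ → r ≤ R₀ → 0 < t → t ≤ angDist γ φ * r →
      derivSum k f (polarPoint r φ) ≤
        K * t ^ (ρ - k) * weightedSum γ ρ k (fun r φ => f (polarPoint r φ)) (r, φ) := by
  choose! K hK0 hK using exists_norm_iteratedFDeriv_le_polarDeriv
  -- Since q ≤ γ/2 < π < 4 and r ≤ |R₀|, this B dominates both q and q r.
  set B : ℝ := 4 * (1 + |R₀|)
  have hB1 : 1 ≤ B := by simp only [B]; linarith [abs_nonneg R₀]
  refine ⟨∑ m ∈ Finset.Icc 1 k, K m * B ^ k, Finset.sum_nonneg fun m hm =>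
    mul_nonneg (hK0 m (Finset.mem_Icc.1 hm).1) (by positivity), fun f hf r φ t hr hφ hrR ht htq => ?_⟩
  rw [mul_assoc, Finset.sum_mul]
  refine Finset.sum_le_sum fun m hm => ?_
  rw [Finset.mem_Icc] at hm
  refine (hK m hm.1 f hf r φ hr).trans ?_
  rw [mul_assoc]
  refine mul_le_mul_of_nonneg_left ?_ (hK0 m hm.1)
  set q := angDist γ φ
  have hq : 0 < q := lt_min hφ.1 (by linarith [hφ.2])
  have hq4 : q ≤ 4 := by
    have h1 : q ≤ φ := min_le_left _ _
    have h2 : q ≤ γ - φ := min_le_right _ _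
    linarith [Real.pi_le_four]
  have hr0 : r ≤ |R₀| := hrR.trans (le_abs_self _)
  have hqB : q ≤ B := hq4.trans (by simp only [B]; linarith [abs_nonneg R₀])
  have hqrB : q * r ≤ B := by
    calc q * r ≤ 4 * |R₀| := by gcongr
      _ ≤ B := by simp only [B]; linarith
  have hsub : multiIndices m ⊆ multiIndices k := by
    intro β
    simp only [multiIndices, Finset.mem_filter, Finset.mem_product, Finset.mem_range]
    omega
  rw [← mul_assoc, weightedSum, Finset.mul_sum]
  refine le_trans (Finset.sum_le_sum fun β hβ => ?_)
    (Finset.sum_le_sum_of_subset_of_nonneg hsub fun β _ _ => ?_)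
  · simp only [multiIndices, Finset.mem_filter, Finset.mem_product, Finset.mem_range] at hβ
    have hw := inv_pow_mul_pow_le_weight (a := β.1) (b := β.2) hρ0 hρ hr hq hB1 hqB hqrB ht htq
      hβ.2.2 hm.2
    rw [norm_smul, ← mul_assoc (B ^ k * t ^ (ρ - k))]
    refine mul_le_mul_of_nonneg_right (hw.trans ?_) (norm_nonneg _)
    have := Real.rpow_nonneg ht.le (ρ - k)
    exact mul_le_mul_of_nonneg_left (le_abs_self _) (by positivity)
  · have := Real.rpow_nonneg ht.le (ρ - k)
    positivity

theorem isOpen_openUnitSquare : IsOpen openUnitSquare := by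
  simp only [openUnitSquare, ofPred_forall]
  exact isOpen_iInter_of_finite fun m => isOpen_Ioo.preimage (by fun_prop)

/-- The bound for a single wavelet coefficient. -/
theorem exists_enorm_coefficient_le {γ ρ R₀ : ℝ} {k : ℕ} (hk : 1 ≤ k) (hγ : γ < 2 * Real.pi)
    (hρ0 : 0 < ρ) (hρ : ρ < k) {lam : E2 → E2} (hlam : ContDiffOn ℝ k lam openUnitSquare) {D : ℝ}
    (hD : ∀ x ∈ openUnitSquare, ∀ i, 1 ≤ i → i ≤ k → ‖iteratedFDeriv ℝ i lam x‖ ≤ D ^ i) {L : ℝ≥0}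
    (hL : ∀ x ∈ openUnitSquare, ∀ y ∈ openUnitSquare, dist x y ≤ L * dist (lam x) (lam y)) :
    ∃ K : ℝ≥0, ∀ f : E2 → ℂ, ContDiff ℝ (⊤ : ℕ∞) f → ∀ (a : E2) (h t : ℝ) (ψ : E2 → ℂ), 0 < h →
      0 < t → closedSquare a h ⊆ openUnitSquare → MemLp ψ 2 (volume.restrict (closedSquare a h)) →
      (∀ P : MvPolynomial (Fin 2) ℂ, P.totalDegree < k →
        ∫ x in closedSquare a h, MvPolynomial.eval (fun m => (x m : ℂ)) P * conj (ψ x) = 0) →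
      (∀ y ∈ lam '' closedSquare a h, derivSum k f y ≠ 0 → ∃ r φ, 0 < r ∧ φ ∈ Ioo 0 γ ∧
        y = polarPoint r φ ∧ t ≤ angDist γ φ * r ∧ r ≤ R₀) →
      ‖∫ x in closedSquare a h, f (lam x) * conj (ψ x)‖ₑ ≤ K * ENNReal.ofReal (h ^ k * t ^ (ρ - k)) *
        (∫⁻ x in closedSquare a h, ‖ψ x‖ₑ ^ 2) ^ (1 / 2 : ℝ) *
        (∫⁻ p in {p : ℝ × ℝ | polarPoint p.1 p.2 ∈ lam '' closedSquare a h},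
          ENNReal.ofReal (weightedSum γ ρ k (fun r φ => f (polarPoint r φ)) p) ^ 2
            ∂(polarMeasure γ)) ^ (1 / 2 : ℝ) := by
  obtain ⟨K₂, hK₂0, hK₂⟩ := exists_derivSum_le_weightedSum (R₀ := R₀) hγ hρ0 hρ
  obtain ⟨K₁, hK₁⟩ : ∃ K : ℝ, K = k.factorial * |D| ^ k := ⟨_, rfl⟩
  have hK₁0 : 0 ≤ K₁ := by rw [hK₁]; positivity
  refine ⟨(2 * 2 ^ k * K₁ * L * K₂).toNNReal, fun f hf a h t ψ hh ht hQ hψ hmom hsupp => ?_⟩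
  set Q := closedSquare a h
  have hQc : IsCompact Q := isCompact_closedSquare a h
  have hQm : MeasurableSet Q := hQc.measurableSet
  have hlamQ : ContinuousOn lam Q := hlam.continuousOn.mono hQ
  set A := lam '' Q
  have hAm : MeasurableSet A := (hQc.image_of_continuousOn hlamQ).measurableSet
  set S : E2 → ℝ≥0∞ := fun y => ENNReal.ofReal (derivSum k f y) ^ 2
  have hS : Measurable S := ((continuous_derivSum k hf).measurable.ennreal_ofReal).pow_const 2
  set V : ℝ × ℝ → ℝ≥0∞ := fun p =>
    ENNReal.ofReal (weightedSum γ ρ k (fun r φ => f (polarPoint r φ)) p) ^ 2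
  set P : Set (ℝ × ℝ) := {p : ℝ × ℝ | polarPoint p.1 p.2 ∈ A}
  have hPm : MeasurableSet P := measurable_polarPoint hAm
  have hcomp : ContDiffOn ℝ k (f ∘ lam) openUnitSquare :=
    (hf.of_le (by exact_mod_cast le_top)).comp_contDiffOn hlam
  have h1 := enorm_integral_mul_le_of_vanishing_moments hk isOpen_openUnitSquare hcomp hh hQ hψ hmom
  have h2 : ∫⁻ x in Q, ‖iteratedFDeriv ℝ k (f ∘ lam) x‖ₑ ^ 2 ≤
      ENNReal.ofReal K₁ ^ 2 * ∫⁻ x in Q, S (lam x) := by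
    rw [← lintegral_const_mul' _ _ (by finiteness)]
    refine setLIntegral_mono' hQm fun x hx => ?_
    rw [← mul_pow, ← ENNReal.ofReal_mul hK₁0, ← ofReal_norm]
    gcongr
    have hxo := isOpen_openUnitSquare.mem_nhds (hQ hx)
    refine (norm_iteratedFDeriv_comp_le_sum (hf.of_le (by exact_mod_cast le_top))
      (hlam.contDiffAt hxo) hk (D := |D|) fun i hi1 hik => ?_).trans (le_of_eq ?_)
    · refine (hD x (hQ hx) i hi1 hik).trans ?_
      rw [← abs_pow]
      exact le_abs_self _
    · simp only [hK₁, derivSum]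
      ring
  have h3 : ∫⁻ x in Q, S (lam x) ≤ (L : ℝ≥0∞) ^ 2 * ∫⁻ y in A, S y := by
    rw [← lintegral_map' hS.aemeasurable (hlamQ.aemeasurable hQm), ← smul_eq_mul,
      ← lintegral_smul_measure]
    exact lintegral_mono' (map_restrict_le_of_dist_le hQm hlamQ
      (fun x hx y hy => hL x (hQ hx) y (hQ hy)) (mapsTo_image _ _)) le_rfl
  -- By `hsupp` all relevant derivatives vanish on the part of A outside the sector, so restricting
  -- to the sector loses nothing.
  have h4 : ∫⁻ y in A, S y ≤ ∫⁻ y in A ∩ sector γ, S y := by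
    have hz : ∫⁻ y in A \ sector γ, S y = 0 := by
      have hzm : MeasurableSet {y | S y = 0} := hS (measurableSet_singleton 0)
      refine le_antisymm ((lintegral_mono_set (t := {y | S y = 0}) ?_).trans ?_) bot_le
      · rintro y ⟨hyA, hys⟩
        by_contra hne
        have hd : derivSum k f y ≠ 0 := fun h0 => hne (by simp [S, h0])
        obtain ⟨r, φ, hr, hφ, rfl, -⟩ := hsupp y hyA hd
        exact hys ⟨r, φ, hr, hφ, rfl⟩
      · rw [setLIntegral_congr_fun hzm (g := fun _ => 0) fun y hy => hy]
        simp
    calc _ = ∫⁻ y in (A ∩ sector γ) ∪ (A \ sector γ), S y := by rw [inter_union_sdiff]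
      _ ≤ _ := (lintegral_union_le _ _ _).trans (by rw [hz, add_zero])
  have h5 : ∫⁻ y in A ∩ sector γ, S y ≤
      ENNReal.ofReal (K₂ * t ^ (ρ - k)) ^ 2 * ∫⁻ p in P, V p ∂(polarMeasure γ) := by
    rw [setLIntegral_inter_sector hγ.le hAm hS, ← lintegral_const_mul' _ _ (by finiteness)]
    have hae : ∀ᵐ p ∂((polarMeasure γ).restrict P), p ∈ Ioi (0 : ℝ) ×ˢ Ioo (0 : ℝ) γ := by
      refine ae_restrict_of_ae ((withDensity_absolutelyContinuous _ _).ae_le ?_)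
      exact ae_restrict_mem (measurableSet_Ioi.prod measurableSet_Ioo)
    refine lintegral_mono_ae ?_
    filter_upwards [hae, ae_restrict_mem hPm] with p hp hpP
    have hp1 : 0 < p.1 := hp.1
    have hp2 := hp.2
    by_cases hd : derivSum k f (polarPoint p.1 p.2) = 0
    · simp [S, hd]
    · obtain ⟨r, φ, hr, hφ, he, htq, hrR⟩ := hsupp _ hpP hd
      obtain ⟨rfl, rfl⟩ := polarPoint_inj hp1 hr (abs_lt.2
        ⟨by linarith [hp2.1, hφ.2], by linarith [hp2.2, hφ.1]⟩) he
      have h6 := hK₂ f hf p.1 p.2 t hp1 hp2 hrR ht htq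
      simp only [S, V]
      rw [← mul_pow, ← ENNReal.ofReal_mul (mul_nonneg hK₂0 (Real.rpow_nonneg ht.le _))]
      gcongr
  have h7 : (∫⁻ x in Q, ‖iteratedFDeriv ℝ k (f ∘ lam) x‖ₑ ^ 2) ^ (1 / 2 : ℝ) ≤
      ENNReal.ofReal K₁ * L * ENNReal.ofReal (K₂ * t ^ (ρ - k)) *
        (∫⁻ p in P, V p ∂(polarMeasure γ)) ^ (1 / 2 : ℝ) := by
    have h8 : ∫⁻ x in Q, ‖iteratedFDeriv ℝ k (f ∘ lam) x‖ₑ ^ 2 ≤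
        (ENNReal.ofReal K₁ * L * ENNReal.ofReal (K₂ * t ^ (ρ - k))) ^ 2 *
          ∫⁻ p in P, V p ∂(polarMeasure γ) := by
      calc _ ≤ ENNReal.ofReal K₁ ^ 2 * ((L : ℝ≥0∞) ^ 2 *
            (ENNReal.ofReal (K₂ * t ^ (ρ - k)) ^ 2 * ∫⁻ p in P, V p ∂(polarMeasure γ))) := by
              refine h2.trans ?_
              gcongr
              refine h3.trans ?_
              gcongr
              exact h4.trans h5
        _ = _ := by ring
    refine (ENNReal.rpow_le_rpow h8 (by norm_num)).trans (le_of_eq ?_)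
    rw [ENNReal.mul_rpow_of_nonneg _ _ (by norm_num), ← ENNReal.rpow_natCast, ← ENNReal.rpow_mul]
    norm_num
  refine h1.trans ((mul_le_mul_right h7 _).trans (le_of_eq ?_))
  have e1 : ((2 * 2 ^ k * K₁ * L * K₂).toNNReal : ℝ≥0∞) =
      2 * 2 ^ k * ENNReal.ofReal K₁ * L * ENNReal.ofReal K₂ := by
    change ENNReal.ofReal _ = _
    rw [ENNReal.ofReal_mul (by positivity), ENNReal.ofReal_mul (by positivity),
      ENNReal.ofReal_mul (by positivity), ENNReal.ofReal_mul (by positivity),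
      ENNReal.ofReal_pow (by norm_num), ENNReal.ofReal_coe_nnreal]
    norm_num
  rw [e1, ENNReal.ofReal_mul (p := 2) (by positivity), ENNReal.ofReal_mul hK₂0,
    ENNReal.ofReal_mul (p := h ^ k) (by positivity), ENNReal.ofReal_pow hh.le, mul_pow,
    show ENNReal.ofReal 2 = 2 by norm_num]
  ring

end Coefficient


/-! ### Overlap counting and the summation over one level. -/

section Counting

/-- The sum of the indicator functions is at most M and lives on E; integrating it compares areas. A
measurable hull replaces E, which need not be measurable. -/
theorem card_mul_le_of_overlap {α ι : Type*} [MeasurableSpace α] (μ : Measure α) (T : Finset ι)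
    (s : ι → Set α) (hs : ∀ ξ ∈ T, MeasurableSet (s ξ)) {E : Set α} (hE : ∀ ξ ∈ T, s ξ ⊆ E)
    {v : ℝ≥0∞} (hv : ∀ ξ ∈ T, v ≤ μ (s ξ)) {M : ℕ} (hM : ∀ x, {ξ ∈ (T : Set ι) | x ∈ s ξ}.ncard ≤ M) :
    T.card * v ≤ M * μ E := by
  classical
  set E' := toMeasurable μ E
  have hE' : MeasurableSet E' := measurableSet_toMeasurable μ E
  calc (T.card : ℝ≥0∞) * v = ∑ _ξ ∈ T, v := by simp
    _ ≤ ∑ ξ ∈ T, μ (s ξ) := Finset.sum_le_sum hv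
    _ = ∑ ξ ∈ T, ∫⁻ x, (s ξ).indicator 1 x ∂μ :=
        Finset.sum_congr rfl fun ξ hξ => (lintegral_indicator_one (hs ξ hξ)).symm
    _ = ∫⁻ x, ∑ ξ ∈ T, (s ξ).indicator 1 x ∂μ :=
        (lintegral_finsetSum' T fun ξ hξ => (measurable_one.indicator (hs ξ hξ)).aemeasurable).symm
    _ ≤ ∫⁻ x, E'.indicator (fun _ => (M : ℝ≥0∞)) x ∂μ := by
        refine lintegral_mono fun x => ?_
        by_cases hx : x ∈ E'
        · rw [indicator_of_mem hx]
          have h1 : ∑ ξ ∈ T, (s ξ).indicator (1 : α → ℝ≥0∞) x = (T.filter fun ξ => x ∈ s ξ).card := by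
            simp [indicator_apply]
          have h2 := hM x
          rw [show {ξ ∈ (T : Set ι) | x ∈ s ξ} = (T.filter fun ξ => x ∈ s ξ : Finset ι) by
            ext; simp, ncard_coe_finset] at h2
          simp only [h1]
          exact_mod_cast h2
        · rw [Finset.sum_eq_zero]
          · exact zero_le
          · intro ξ hξ
            exact indicator_of_notMem (fun h => hx (subset_toMeasurable μ E (hE ξ hξ h))) _
    _ = M * μ E := by
        rw [lintegral_indicator_const hE', measure_toMeasurable]

theorem sum_setLIntegral_le_of_overlap {α ι : Type*} [MeasurableSpace α] (μ : Measure α)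
    (T : Finset ι) (s : ι → Set α) (hs : ∀ ξ ∈ T, MeasurableSet (s ξ)) {E : Set α}
    (hEm : MeasurableSet E) (hE : ∀ ξ ∈ T, s ξ ⊆ E) {V : α → ℝ≥0∞} (hV : Measurable V) {M : ℝ≥0∞}
    (hM : ∀ x, ({ξ ∈ (T : Set ι) | x ∈ s ξ}.ncard : ℝ≥0∞) ≤ M) :
    ∑ ξ ∈ T, ∫⁻ x in s ξ, V x ∂μ ≤ M * ∫⁻ x in E, V x ∂μ := by
  classical
  calc ∑ ξ ∈ T, ∫⁻ x in s ξ, V x ∂μ = ∑ ξ ∈ T, ∫⁻ x, (s ξ).indicator V x ∂μ :=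
        Finset.sum_congr rfl fun ξ hξ => (lintegral_indicator (hs ξ hξ) _).symm
    _ = ∫⁻ x, ∑ ξ ∈ T, (s ξ).indicator V x ∂μ :=
        (lintegral_finsetSum' T fun ξ hξ => (hV.indicator (hs ξ hξ)).aemeasurable).symm
    _ ≤ ∫⁻ x, M * E.indicator V x ∂μ := by
        refine lintegral_mono fun x => ?_
        by_cases hx : x ∈ E
        · rw [indicator_of_mem hx]
          have h1 : ∑ ξ ∈ T, (s ξ).indicator V x = (T.filter fun ξ => x ∈ s ξ).card * V x := by
            simp [indicator_apply, Finset.sum_ite]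
          have h2 := hM x
          rw [show {ξ ∈ (T : Set ι) | x ∈ s ξ} = (T.filter fun ξ => x ∈ s ξ : Finset ι) by
            ext; simp, ncard_coe_finset] at h2
          simp only [h1]
          gcongr
        · rw [Finset.sum_eq_zero]
          · exact zero_le
          · intro ξ hξ
            exact indicator_of_notMem (fun h => hx (hE ξ hξ h)) _
    _ = M * ∫⁻ x in E, V x ∂μ := by
        rw [lintegral_const_mul _ (hV.indicator hEm), lintegral_indicator hEm]

/-- Summation over dyadic shells. -/
theorem sum_rpow_neg_le_of_card {s : ℝ} (hs : 1 < s) : ∃ K : ℝ≥0, ∀ {ι : Type*} (T : Finset ι)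
    (t : ι → ℝ) (ε : ℝ) (C₀ : ℝ≥0), 0 < ε → (∀ ξ ∈ T, ε ≤ t ξ) →
    (∀ x, ε ≤ x → ({ξ ∈ (T : Set ι) | t ξ ≤ x}.ncard : ℝ) ≤ C₀ * (ε ^ 2)⁻¹ * x) →
    ∑ ξ ∈ T, ENNReal.ofReal (t ξ ^ (-s)) ≤ K * C₀ * ENNReal.ofReal (ε ^ (-1 - s)) := by
  classical
  -- The shell 2^l ε ≤ t < 2^(l+1) ε has at most C₀ ε^(-2) 2^(l+1) ε members, each contributing at
  -- most (2^l ε)^(-s). The shell sums thus decay geometrically with ratio 2^(1-s).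
  set θ : ℝ≥0∞ := ENNReal.ofReal (2 ^ (1 - s))
  have hθ : θ < 1 := by
    rw [show (1 : ℝ≥0∞) = ENNReal.ofReal 1 by simp]
    exact (ENNReal.ofReal_lt_ofReal_iff one_pos).2
      (Real.rpow_lt_one_of_one_lt_of_neg one_lt_two (by linarith))
  have hfin : 2 * (1 - θ)⁻¹ ≠ ⊤ := by
    refine ENNReal.mul_ne_top (by simp) (ENNReal.inv_ne_top.2 ?_)
    exact (tsub_pos_of_lt hθ).ne'
  refine ⟨(2 * (1 - θ)⁻¹).toNNReal, fun {ι} T t ε C₀ hε ht hcard => ?_⟩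
  rw [ENNReal.coe_toNNReal hfin]
  have h2pos : ∀ l : ℕ, (0 : ℝ) < 2 ^ l := fun l => by positivity
  have h1 : ∀ ξ ∈ T, ENNReal.ofReal (t ξ ^ (-s)) ≤
      ∑' l : ℕ, if t ξ ≤ 2 ^ (l + 1) * ε then ENNReal.ofReal ((2 ^ l * ε) ^ (-s)) else 0 := by
    intro ξ hξ
    obtain ⟨l, hl1, hl2⟩ := exists_nat_pow_near (x := t ξ / ε) (y := (2 : ℝ))
      ((one_le_div hε).2 (ht ξ hξ)) one_lt_two
    rw [le_div_iff₀ hε] at hl1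
    rw [div_lt_iff₀ hε] at hl2
    refine le_trans ?_ (ENNReal.le_tsum l)
    rw [if_pos hl2.le]
    exact ENNReal.ofReal_le_ofReal
      (Real.rpow_le_rpow_of_nonpos (mul_pos (h2pos l) hε) hl1 (by linarith))
  have h2 : ∀ l : ℕ, ∑ ξ ∈ T, (if t ξ ≤ 2 ^ (l + 1) * ε then
      ENNReal.ofReal ((2 ^ l * ε) ^ (-s)) else 0) ≤
        2 * C₀ * ENNReal.ofReal (ε ^ (-1 - s)) * θ ^ l := by
    intro l
    rw [Finset.sum_ite, Finset.sum_const_zero, add_zero, Finset.sum_const, nsmul_eq_mul]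
    have hc := hcard (2 ^ (l + 1) * ε) (le_mul_of_one_le_left hε.le (one_le_pow₀ one_le_two))
    rw [show {ξ ∈ (T : Set ι) | t ξ ≤ 2 ^ (l + 1) * ε} =
      (T.filter fun ξ => t ξ ≤ 2 ^ (l + 1) * ε : Finset ι) by ext; simp, ncard_coe_finset] at hc
    rw [← ENNReal.ofReal_natCast, ← ENNReal.ofReal_mul (by positivity), ← ENNReal.ofReal_pow
      (by positivity), ← ENNReal.ofReal_coe_nnreal, show (2 : ℝ≥0∞) = ENNReal.ofReal 2 by simp,
      ← ENNReal.ofReal_mul (by positivity), ← ENNReal.ofReal_mul (by positivity),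
      ← ENNReal.ofReal_mul (by positivity)]
    refine ENNReal.ofReal_le_ofReal ?_
    have hr : 0 ≤ (2 ^ l * ε) ^ (-s) := by positivity
    refine (mul_le_mul_of_nonneg_right hc hr).trans (le_of_eq ?_)
    rw [Real.mul_rpow (h2pos l).le hε.le, Real.rpow_sub hε, Real.rpow_neg_one,
      Real.rpow_neg hε.le, Real.rpow_sub two_pos, Real.rpow_one, div_pow, ← Real.rpow_natCast (2 ^ s) l,
      ← Real.rpow_mul two_pos.le, ← Real.rpow_natCast 2 l, ← Real.rpow_mul two_pos.le,
      mul_comm s (l : ℝ), pow_succ, mul_neg, Real.rpow_neg two_pos.le]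
    have : (0 : ℝ) < ε ^ s := Real.rpow_pos_of_pos hε _
    have : (0 : ℝ) < 2 ^ ((l : ℝ) * s) := by positivity
    rw [Real.rpow_natCast]
    field_simp
    ring
  calc ∑ ξ ∈ T, ENNReal.ofReal (t ξ ^ (-s)) ≤ ∑ ξ ∈ T, ∑' l : ℕ,
        (if t ξ ≤ 2 ^ (l + 1) * ε then ENNReal.ofReal ((2 ^ l * ε) ^ (-s)) else 0) :=
        Finset.sum_le_sum h1
    _ = ∑' l : ℕ, ∑ ξ ∈ T,
        (if t ξ ≤ 2 ^ (l + 1) * ε then ENNReal.ofReal ((2 ^ l * ε) ^ (-s)) else 0) :=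
        (Summable.tsum_finsetSum fun _ _ => ENNReal.summable).symm
    _ ≤ ∑' l : ℕ, 2 * C₀ * ENNReal.ofReal (ε ^ (-1 - s)) * θ ^ l := ENNReal.tsum_le_tsum h2
    _ = _ := by
      rw [ENNReal.tsum_mul_left, ENNReal.tsum_geometric]
      ring

/-- The sum of the coefficients of one level. -/
theorem exists_sum_rpow_le {κ ρ τ : ℝ} (hτ0 : 0 < τ) (hτ2 : τ < 2)
    (hτκ : 1 / τ < 1 / 2 + (κ - ρ)) (K C₀ : ℝ≥0) : ∃ K' : ℝ≥0,
    ∀ {ι : Type*} (T : Finset ι) (a μ : ι → ℝ≥0∞) (t : ι → ℝ) (ε : ℝ) (X : ℝ≥0∞), 0 < ε →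
    (∀ ξ ∈ T, ε ≤ t ξ) →
    (∀ x, ε ≤ x → ({ξ ∈ (T : Set ι) | t ξ ≤ x}.ncard : ℝ) ≤ C₀ * (ε ^ 2)⁻¹ * x) →
    (∀ ξ ∈ T, a ξ ≤ K * ENNReal.ofReal (ε ^ κ * t ξ ^ (ρ - κ)) * μ ξ ^ (1 / 2 : ℝ)) →
    ∑ ξ ∈ T, μ ξ ≤ X →
    ∑ ξ ∈ T, a ξ ^ τ ≤ K' * ENNReal.ofReal (ε ^ (ρ * τ - (2 - τ) / 2)) * X ^ (τ / 2) := by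
  -- Conjugate exponents, chosen so that the Q-th power of μ^(τ/2) is μ.
  set P : ℝ := 2 / (2 - τ) with hP
  set Q : ℝ := 2 / τ with hQ
  have h2τ : 0 < 2 - τ := by linarith
  have hPQ : P.HolderConjugate Q := by
    rw [Real.holderConjugate_iff]
    constructor
    · rw [hP, one_lt_div h2τ]; linarith
    · rw [hP, hQ]; field_simp; ring
  -- The exponent of 1/t after Hölder's inequality. It equals 2τ(κ-ρ)/(2-τ), so s > 1 is equivalent
  -- to 1/τ < 1/2 + (κ-ρ).
  set s : ℝ := (κ - ρ) * (τ * P) with hs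
  have hs1 : 1 < s := by
    rw [hs, hP, show (κ - ρ) * (τ * (2 / (2 - τ))) = 2 * τ * (κ - ρ) / (2 - τ) by ring,
      one_lt_div h2τ]
    have := mul_lt_mul_of_pos_left hτκ hτ0
    rw [mul_one_div_cancel hτ0.ne'] at this
    linarith
  obtain ⟨K₁, hK₁⟩ := sum_rpow_neg_le_of_card hs1
  have hfin : (K : ℝ≥0∞) ^ τ * ((K₁ * C₀ : ℝ≥0∞)) ^ (1 / P) ≠ ⊤ := by
    have h1 := ENNReal.rpow_ne_top_of_nonneg hτ0.le (ENNReal.coe_ne_top (r := K))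
    have h2 : (K₁ * C₀ : ℝ≥0∞) ≠ ⊤ := by finiteness
    exact ENNReal.mul_ne_top h1 (ENNReal.rpow_ne_top_of_nonneg (by positivity) h2)
  refine ⟨((K : ℝ≥0∞) ^ τ * ((K₁ * C₀ : ℝ≥0∞)) ^ (1 / P)).toNNReal,
    fun {ι} T a μ t ε X hε ht hcard ha hX => ?_⟩
  rw [ENNReal.coe_toNNReal hfin]
  set w : ι → ℝ≥0∞ := fun ξ => ENNReal.ofReal (ε ^ κ * t ξ ^ (ρ - κ))
  have htp : ∀ ξ ∈ T, 0 < t ξ := fun ξ hξ => hε.trans_le (ht ξ hξ)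
  have h1 : ∑ ξ ∈ T, a ξ ^ τ ≤ (K : ℝ≥0∞) ^ τ * ∑ ξ ∈ T, w ξ ^ τ * μ ξ ^ (τ / 2) := by
    rw [Finset.mul_sum]
    refine Finset.sum_le_sum fun ξ hξ => ?_
    refine (ENNReal.rpow_le_rpow (ha ξ hξ) hτ0.le).trans (le_of_eq ?_)
    rw [ENNReal.mul_rpow_of_nonneg _ _ hτ0.le, ENNReal.mul_rpow_of_nonneg _ _ hτ0.le,
      ← ENNReal.rpow_mul, mul_assoc, one_div_mul_eq_div]
  have h2 := ENNReal.inner_le_Lp_mul_Lq T (fun ξ => w ξ ^ τ) (fun ξ => μ ξ ^ (τ / 2)) hPQ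
  have h3 : ∑ ξ ∈ T, (μ ξ ^ (τ / 2)) ^ Q = ∑ ξ ∈ T, μ ξ := by
    refine Finset.sum_congr rfl fun ξ _ => ?_
    rw [← ENNReal.rpow_mul, hQ, show τ / 2 * (2 / τ) = 1 by field_simp, ENNReal.rpow_one]
  -- The exponent of ε is κτP from the prefactor plus -1 - s from the shells, that is, ρτP - 1.
  have h4 : ∑ ξ ∈ T, (w ξ ^ τ) ^ P ≤
      K₁ * C₀ * ENNReal.ofReal (ε ^ (ρ * (τ * P) - 1)) := by
    have h5 : ∀ ξ ∈ T, (w ξ ^ τ) ^ P =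
        ENNReal.ofReal (ε ^ (κ * (τ * P))) * ENNReal.ofReal (t ξ ^ (-s)) := by
      intro ξ hξ
      have hP0 : 0 ≤ τ * P := by positivity
      have ht0 := Real.rpow_nonneg (htp ξ hξ).le (ρ - κ)
      rw [← ENNReal.rpow_mul, ← ENNReal.ofReal_mul (by positivity),
        ENNReal.ofReal_rpow_of_nonneg (by positivity) hP0, Real.mul_rpow (by positivity) ht0,
        ← Real.rpow_mul hε.le, ← Real.rpow_mul (htp ξ hξ).le, hs,
        show (ρ - κ) * (τ * P) = -((κ - ρ) * (τ * P)) by ring]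
    rw [Finset.sum_congr rfl h5, ← Finset.mul_sum]
    refine (mul_le_mul_right (hK₁ T t ε C₀ hε ht hcard) _).trans (le_of_eq ?_)
    rw [mul_left_comm, ← ENNReal.ofReal_mul (by positivity), ← Real.rpow_add hε, hs]
    congr 3
    ring
  calc ∑ ξ ∈ T, a ξ ^ τ ≤ (K : ℝ≥0∞) ^ τ *
        ((K₁ * C₀ * ENNReal.ofReal (ε ^ (ρ * (τ * P) - 1))) ^ (1 / P) * X ^ (1 / Q)) := by
        refine h1.trans ?_
        gcongr
        refine h2.trans ?_
        rw [h3]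
        have := hPQ.pos
        have := hPQ.symm.pos
        gcongr
    _ = _ := by
        rw [ENNReal.mul_rpow_of_nonneg _ _ (by positivity), ENNReal.ofReal_rpow_of_nonneg
          (by positivity) (by positivity), ← Real.rpow_mul hε.le,
          show (ρ * (τ * P) - 1) * (1 / P) = ρ * τ - (2 - τ) / 2 by rw [hP]; field_simp,
          show 1 / Q = τ / 2 by rw [hQ]; field_simp]
        ring

end Counting


/-! ### The sum over one level on one face of a cone. -/

section Face

/-- The data of an interior wavelet at scale `ε` in Cartesian coordinates of the plane of a patch
with interior `G` and parametrization `lam`: a parameter square, a ball containing its image, the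
support, and the wavelet as a function on the parameter square. -/
structure PlaneWavelet (lam : E2 → E2) (G : Set E2) (k : ℕ) (c₀ c₁ : ℝ) (c₂ : ℝ≥0) (ε : ℝ) where
  a : E2
  h : ℝ
  z : E2
  r : ℝ
  s : Set E2
  η : E2 → ℂ
  h_pos : 0 < h
  square_subset : closedSquare a h ⊆ openUnitSquare
  supp_subset : s ⊆ lam '' closedSquare a h
  image_subset : lam '' closedSquare a h ⊆ Metric.ball z r
  ball_subset : Metric.ball z r ⊆ G
  measurableSet_supp : MeasurableSet s
  le_volume : ENNReal.ofReal (c₀ * ε ^ 2) ≤ volume s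
  r_le : r ≤ c₁ * ε
  le_dist : ∀ y ∈ Metric.ball z r, ∀ p ∈ frontier G, ε ≤ dist y p
  memLp : MemLp η 2 (volume.restrict (closedSquare a h))
  norm_le : (∫⁻ x in closedSquare a h, ‖η x‖ₑ ^ 2) ^ (1 / 2 : ℝ) ≤ c₂
  moments : ∀ P : MvPolynomial (Fin 2) ℂ, P.totalDegree < k →
    ∫ x in closedSquare a h, MvPolynomial.eval (fun m => (x m : ℂ)) P * conj (η x) = 0

theorem mem_closedSquare_self (a : E2) {h : ℝ} (hh : 0 ≤ h) : a ∈ closedSquare a h := fun m =>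
  ⟨le_rfl, by linarith⟩

/-- The endpoints of one side of the square have images in a ball of radius at most c₁ ε, and lam
contracts distances by at most the factor L. -/
theorem PlaneWavelet.h_le {lam : E2 → E2} {G : Set E2} {k : ℕ} {c₀ c₁ : ℝ} {c₂ : ℝ≥0} {ε : ℝ}
    (w : PlaneWavelet lam G k c₀ c₁ c₂ ε) {L : ℝ≥0}
    (hL : ∀ x ∈ openUnitSquare, ∀ y ∈ openUnitSquare, dist x y ≤ L * dist (lam x) (lam y)) :
    w.h ≤ L * (2 * (c₁ * ε)) := by
  set b : E2 := w.a + EuclideanSpace.single 0 w.h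
  have ha : w.a ∈ closedSquare w.a w.h := mem_closedSquare_self _ w.h_pos.le
  have hb : b ∈ closedSquare w.a w.h := by
    intro m
    have := w.h_pos
    fin_cases m <;> simp [b, this.le]
  have h1 := hL _ (w.square_subset ha) _ (w.square_subset hb)
  have h2 : dist w.a b = w.h := by
    simp [b, dist_eq_norm, w.h_pos.le]
  rw [h2] at h1
  have h3 := w.image_subset (mem_image_of_mem lam ha)
  have h4 := w.image_subset (mem_image_of_mem lam hb)
  rw [Metric.mem_ball] at h3 h4
  have h5 := dist_triangle_right (lam w.a) (lam b) w.z
  have h6 := w.r_le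
  refine h1.trans (mul_le_mul_of_nonneg_left ?_ L.2)
  linarith

theorem mem_closure_of_derivSum_ne_zero {k : ℕ} {f : E2 → ℂ} {G V : Set E2} (hG : IsOpen G)
    (hf : ∀ y ∈ G \ V, f y = 0) {y : E2} (hy : y ∈ G) (hd : derivSum k f y ≠ 0) :
    y ∈ closure V := by
  by_contra hcon
  refine hd (Finset.sum_eq_zero fun m _ => ?_)
  have he : f =ᶠ[𝓝 y] fun _ => (0 : ℂ) := by
    filter_upwards [hG.mem_nhds hy, isClosed_closure.isOpen_compl.mem_nhds hcon] with z hz hz'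
    exact hf z ⟨hz, fun h => hz' (subset_closure h)⟩
  rw [(he.iteratedFDeriv ℝ m).eq_of_nhds]
  simp

/-- Near the support, the weight `q r` dominates the distance to the boundary of the patch. -/
theorem exists_polar_of_mem_closure {γ C₁ ε : ℝ} {G V : Set E2} (hγ : γ < 2 * Real.pi)
    (hC₁ : 0 < C₁)
    (hV : ∀ v ∈ V, ∀ p ∈ G \ sector γ, C₁ ≤ dist v p) {y : E2} (hy : y ∈ G) (hyV : y ∈ closure V)
    (hε : ∀ p ∈ frontier G, ε ≤ dist y p) :
    ∃ r φ, 0 < r ∧ φ ∈ Ioo 0 γ ∧ y = polarPoint r φ ∧ min C₁ ε ≤ angDist γ φ * r := by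
  have hcl : ∀ p ∈ G \ sector γ, C₁ ≤ dist y p := by
    intro p hp
    have hc : IsClosed {v : E2 | C₁ ≤ dist v p} := isClosed_le continuous_const (by fun_prop)
    exact closure_minimal (fun v hv => hV v hv p hp) hc hyV
  have hys : y ∈ sector γ := by
    by_contra h
    have := hcl y ⟨hy, h⟩
    rw [dist_self] at this
    linarith
  obtain ⟨r, φ, hr, hφ, rfl⟩ := hys
  refine ⟨r, φ, hr, hφ, rfl, ?_⟩
  -- There is a point p outside the sector at distance at most q r. If p lies in G, the separation
  -- by C₁ applies; otherwise the segment to p crosses the frontier of G, which is at distance at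
  -- least ε.
  obtain ⟨p, hp, hpd⟩ := exists_notMem_sector_dist_le hγ hr hφ
  refine le_trans ?_ hpd
  by_cases hpG : p ∈ G
  · exact (min_le_left _ _).trans (hcl p ⟨hpG, hp⟩)
  · obtain ⟨z, hz, hzd⟩ := exists_mem_frontier_dist_le hy hpG
    exact (min_le_right _ _).trans ((hε z hz).trans hzd)

theorem measurable_weightedSum (γ ρ : ℝ) (k : ℕ) {f : E2 → ℂ} (hf : ContDiff ℝ (⊤ : ℕ∞) f) :
    Measurable (weightedSum γ ρ k fun r φ => f (polarPoint r φ)) := by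
  refine Finset.measurable_fun_sum _ fun β _ => ?_
  have h1 := (continuous_polarDeriv (hf.comp contDiff_polarPoint) β.1 β.2).measurable
  have h2 : Measurable fun p : ℝ × ℝ => angDist γ p.2 := by unfold angDist; fun_prop
  have h3 : Measurable fun p : ℝ × ℝ => p.1 ^ (-ρ) * (1 + p.1) ^ ρ * (angDist γ p.2 * p.1) ^ β.1 *
      angDist γ p.2 ^ ((β.2 : ℝ) - ρ) := by fun_prop
  exact (h3.smul h1).norm

/-- The sum over the wavelets of one level, for the part of the function near one vertex. -/
theorem exists_sum_coefficient_rpow_le {γ ρ R₀ C₁ τ : ℝ} {k : ℕ} (hk : 1 ≤ k)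
    (hγ : γ < 2 * Real.pi) (hρ0 : 0 < ρ) (hρ : ρ < k) {lam : E2 → E2}
    (hlam : ContDiffOn ℝ k lam openUnitSquare) {D : ℝ}
    (hD : ∀ x ∈ openUnitSquare, ∀ i, 1 ≤ i → i ≤ k → ‖iteratedFDeriv ℝ i lam x‖ ≤ D ^ i) {L : ℝ≥0}
    (hL : ∀ x ∈ openUnitSquare, ∀ y ∈ openUnitSquare, dist x y ≤ L * dist (lam x) (lam y))
    {G V : Set E2} (hG : IsOpen G) (hGR : ∀ y ∈ G, ‖y‖ ≤ R₀) (hC₁ : 0 < C₁)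
    (hV : ∀ v ∈ V, ∀ p ∈ G \ sector γ, C₁ ≤ dist v p) (hτ0 : 0 < τ) (hτ2 : τ < 2)
    (hτκ : 1 / τ < 1 / 2 + (k - ρ)) {c₀ c₁ : ℝ} (hc₀ : 0 < c₀) (hc₁ : 0 ≤ c₁) (c₂ : ℝ≥0) (M : ℕ) :
    ∃ K : ℝ≥0, ∀ {ι : Type*} (T : Finset ι) (ε : ℝ), 0 < ε → ε ≤ 1 →
      ∀ w : ι → PlaneWavelet lam G k c₀ c₁ c₂ ε,
      (∀ x, {ξ ∈ (T : Set ι) | x ∈ (w ξ).s}.ncard ≤ M) →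
      ∀ f : E2 → ℂ, ContDiff ℝ (⊤ : ℕ∞) f → (∀ y ∈ G \ V, f y = 0) →
      ∑ ξ ∈ T, ‖∫ x in closedSquare (w ξ).a (w ξ).h, f (lam x) * conj ((w ξ).η x)‖ₑ ^ τ ≤
        K * ENNReal.ofReal (ε ^ (ρ * τ - (2 - τ) / 2)) *
          (∫⁻ p in {p : ℝ × ℝ | polarPoint p.1 p.2 ∈ G},
            ENNReal.ofReal (weightedSum γ ρ k (fun r φ => f (polarPoint r φ)) p) ^ 2
              ∂(polarMeasure γ)) ^ (τ / 2) := by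
  classical
  obtain ⟨K₁, hK₁⟩ := exists_enorm_coefficient_le (R₀ := R₀) hk hγ hρ0 hρ hlam hD hL
  set m := min C₁ 1
  have hm0 : 0 < m := lt_min hC₁ one_pos
  have hm1 : m ≤ 1 := min_le_right _ _
  -- Within one ball `lineDist` varies by at most 2 c₁ ε. The factor A absorbs this, so that q r ≥
  -- (m / A) t at every relevant point of the image.
  set A := 1 + 2 * c₁
  have hA : 1 ≤ A := by simp only [A]; linarith
  set c' := m / A
  have hc' : 0 < c' := by positivity
  set K₂ : ℝ≥0 := K₁ * (((L * (2 * c₁)) ^ k * c' ^ (ρ - k)) : ℝ).toNNReal * c₂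
  -- Area of two strips of length 2|R₀| and width 2Ax, times the overlap M, divided by the minimal
  -- area c₀ ε² of a support.
  set C₀ : ℝ≥0 := (M * (2 * (2 * |R₀| * (2 * A))) / c₀).toNNReal
  obtain ⟨K₃, hK₃⟩ := exists_sum_rpow_le hτ0 hτ2 hτκ K₂ C₀
  -- Overlap bound for the images of the squares, which may overlap more than the supports. All
  -- images through a given point carry supports within distance 2 c₁ ε of it, and their areas are
  -- counted.
  set B : ℝ≥0 := (M * (Real.pi * (2 * c₁) ^ 2) / c₀).toNNReal
  refine ⟨K₃ * (B : ℝ≥0) ^ (τ / 2), fun {ι} T ε hε hε1 w hM f hf hfz => ?_⟩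
  set W : ℝ × ℝ → ℝ≥0∞ := fun p =>
    ENNReal.ofReal (weightedSum γ ρ k (fun r φ => f (polarPoint r φ)) p) ^ 2
  have hW : Measurable W := (measurable_weightedSum γ ρ k hf).ennreal_ofReal.pow_const 2
  set Y := ∫⁻ p in {p : ℝ × ℝ | polarPoint p.1 p.2 ∈ G}, W p ∂(polarMeasure γ)
  have ha : ∀ ξ, (w ξ).a ∈ closedSquare (w ξ).a (w ξ).h := fun ξ =>
    mem_closedSquare_self _ (w ξ).h_pos.le
  have hya : ∀ ξ, lam (w ξ).a ∈ Metric.ball (w ξ).z (w ξ).r := fun ξ =>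
    (w ξ).image_subset (mem_image_of_mem lam (ha ξ))
  have hdiam : ∀ ξ, ∀ y ∈ Metric.ball (w ξ).z (w ξ).r, ∀ y' ∈ Metric.ball (w ξ).z (w ξ).r,
      dist y y' ≤ 2 * c₁ * ε := by
    intro ξ y hy y' hy'
    rw [Metric.mem_ball] at hy hy'
    have := dist_triangle_right y y' (w ξ).z
    linarith [(w ξ).r_le]
  -- Sampled at one corner of the square. The truncation at ε is essential because the bounding
  -- lines, prolonged beyond the rays, may cross a nonconvex sector.
  set t : ι → ℝ := fun ξ => max ε (lineDist γ (lam (w ξ).a))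
  have htε : ∀ ξ, ε ≤ t ξ := fun ξ => le_max_left _ _
  have ht0 : ∀ ξ, 0 < t ξ := fun ξ => hε.trans_le (htε ξ)
  have hcoef : ∀ ξ ∈ T, ‖∫ x in closedSquare (w ξ).a (w ξ).h, f (lam x) * conj ((w ξ).η x)‖ₑ ≤
      K₂ * ENNReal.ofReal (ε ^ (k : ℝ) * t ξ ^ (ρ - k)) *
        (∫⁻ p in {p : ℝ × ℝ | polarPoint p.1 p.2 ∈ lam '' closedSquare (w ξ).a (w ξ).h}, W p
          ∂(polarMeasure γ)) ^ (1 / 2 : ℝ) := by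
    intro ξ _
    have h1 := hK₁ f hf (w ξ).a (w ξ).h (c' * t ξ) (w ξ).η (w ξ).h_pos (mul_pos hc' (ht0 ξ))
      (w ξ).square_subset (w ξ).memLp (w ξ).moments ?_
    · refine h1.trans ?_
      refine mul_le_mul_left ?_ _
      rw [mul_assoc, mul_comm (ENNReal.ofReal _)]
      have h2 : (w ξ).h ^ k * (c' * t ξ) ^ (ρ - k) ≤
          ((L * (2 * c₁)) ^ k * c' ^ (ρ - k)) * (ε ^ (k : ℝ) * t ξ ^ (ρ - k)) := by
        have h3 : (w ξ).h ^ k ≤ (L * (2 * c₁)) ^ k * ε ^ k := by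
          rw [← mul_pow]
          exact pow_le_pow_left₀ (w ξ).h_pos.le (((w ξ).h_le hL).trans_eq (by ring)) k
        rw [Real.mul_rpow hc'.le (ht0 ξ).le, Real.rpow_natCast]
        have h4 := Real.rpow_nonneg hc'.le (ρ - k)
        have h5 := Real.rpow_nonneg (ht0 ξ).le (ρ - k)
        calc _ ≤ ((L * (2 * c₁)) ^ k * ε ^ k) * (c' ^ (ρ - k) * t ξ ^ (ρ - k)) := by gcongr
          _ = _ := by ring
      have h6 : 0 ≤ (L * (2 * c₁)) ^ k * c' ^ (ρ - k) := by positivity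
      calc (K₁ : ℝ≥0∞) * ((∫⁻ x in closedSquare (w ξ).a (w ξ).h, ‖(w ξ).η x‖ₑ ^ 2) ^ (1 / 2 : ℝ) *
            ENNReal.ofReal ((w ξ).h ^ k * (c' * t ξ) ^ (ρ - k)))
          ≤ K₁ * (c₂ * (ENNReal.ofReal ((L * (2 * c₁)) ^ k * c' ^ (ρ - k)) *
              ENNReal.ofReal (ε ^ (k : ℝ) * t ξ ^ (ρ - k)))) := by
            rw [← ENNReal.ofReal_mul h6]
            gcongr
            exact (w ξ).norm_le
        _ = _ := by
            simp only [K₂, ENNReal.coe_mul]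
            rw [show ((((L * (2 * c₁)) ^ k * c' ^ (ρ - k)) : ℝ).toNNReal : ℝ≥0∞) =
              ENNReal.ofReal ((L * (2 * c₁)) ^ k * c' ^ (ρ - k)) from rfl]
            ring
    · intro y hy hd
      have hyb := (w ξ).image_subset hy
      have hyG := (w ξ).ball_subset hyb
      obtain ⟨r, φ, hr, hφ, rfl, hmin⟩ := exists_polar_of_mem_closure hγ hC₁ hV hyG
        (mem_closure_of_derivSum_ne_zero hG hfz hyG hd) ((w ξ).le_dist _ hyb)
      refine ⟨r, φ, hr, hφ, rfl, ?_, ?_⟩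
      · set x := angDist γ φ * r
        have hx1 : m * ε ≤ x := by
          refine le_trans (le_min ?_ ?_) hmin
          · calc m * ε ≤ C₁ * 1 := by
                  gcongr
                  exact min_le_left _ _
              _ = C₁ := mul_one _
          · exact mul_le_of_le_one_left hε.le hm1
        have hx0 : 0 < x := (mul_pos hm0 hε).trans_le hx1
        have hx2 : lineDist γ (lam (w ξ).a) ≤ x + 2 * c₁ * ε :=
          (lineDist_le_add_dist γ _ (polarPoint r φ)).trans
            (add_le_add (lineDist_polarPoint_le hr hφ) (hdiam ξ _ (hya ξ) _ hyb))
        rw [show c' * t ξ = m * t ξ / A by simp only [c']; ring, div_le_iff₀ (by positivity)]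
        have hxA : x ≤ x * A := le_mul_of_one_le_right hx0.le hA
        rcases max_cases ε (lineDist γ (lam (w ξ).a)) with ⟨he, -⟩ | ⟨he, -⟩
        · simp only [t, he]
          linarith
        · simp only [t, he]
          have h7 : m * lineDist γ (lam (w ξ).a) ≤ m * (x + 2 * c₁ * ε) := by gcongr
          have h8 : m * x ≤ x := mul_le_of_le_one_left hx0.le hm1
          have h9 : 2 * c₁ * (m * ε) ≤ 2 * c₁ * x := by gcongr
          simp only [A]
          nlinarith
      · rw [← norm_polarPoint hr.le φ]
        exact hGR _ hyG
  have hcount : ∀ x, ε ≤ x → ({ξ ∈ (T : Set ι) | t ξ ≤ x}.ncard : ℝ) ≤ C₀ * (ε ^ 2)⁻¹ * x := by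
    intro x hx
    have hx0 : 0 < x := hε.trans_le hx
    set T' := T.filter fun ξ => t ξ ≤ x
    rw [show {ξ ∈ (T : Set ι) | t ξ ≤ x} = (T' : Finset ι) by ext; simp [T'], ncard_coe_finset]
    have h1 := card_mul_le_of_overlap volume T' (fun ξ => (w ξ).s)
      (fun ξ _ => (w ξ).measurableSet_supp) (E := {y : E2 | ‖y‖ ≤ R₀ ∧ lineDist γ y ≤ A * x})
      (fun ξ hξ y hy => by
        have hyb := (w ξ).image_subset ((w ξ).supp_subset hy)
        refine ⟨hGR y ((w ξ).ball_subset hyb), ?_⟩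
        have h2 := lineDist_le_add_dist γ y (lam (w ξ).a)
        have h3 := hdiam ξ _ hyb _ (hya ξ)
        have h4 : lineDist γ (lam (w ξ).a) ≤ x :=
          (le_max_right _ _).trans (Finset.mem_filter.1 hξ).2
        have h5 : 2 * c₁ * ε ≤ 2 * c₁ * x := by gcongr
        simp only [A]
        linarith)
      (fun ξ _ => (w ξ).le_volume) (M := M) (fun y => by
        refine (ncard_le_ncard (fun ξ hξ => ?_) (T.finite_toSet.subset (sep_subset _ _))).trans (hM y)
        exact ⟨(Finset.mem_filter.1 hξ.1).1, hξ.2⟩)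
    have h2 := h1.trans (mul_le_mul_right (volume_lineDist_le γ R₀ (A * x)) _)
    have h3 : (T'.card : ℝ) * (c₀ * ε ^ 2) ≤ M * (2 * (2 * |R₀| * (2 * (A * x)))) := by
      rw [← ENNReal.ofReal_le_ofReal_iff (by positivity)]
      rw [ENNReal.ofReal_mul (by positivity), ENNReal.ofReal_natCast]
      refine h2.trans ?_
      have e : ENNReal.ofReal (M * (2 * (2 * |R₀| * (2 * (A * x))))) =
          M * (2 * (ENNReal.ofReal (2 * |R₀|) * ENNReal.ofReal (2 * (A * x)))) := by
        rw [← ENNReal.ofReal_mul (by positivity), ENNReal.ofReal_mul (p := (M : ℝ)) (by positivity),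
          ENNReal.ofReal_natCast, ENNReal.ofReal_mul (p := 2) (q := 2 * |R₀| * _) (by positivity)]
        simp
      rw [e]
      gcongr
      exact le_abs_self _
    rw [show ((C₀ : ℝ≥0) : ℝ) = M * (2 * (2 * |R₀| * (2 * A))) / c₀ from
      Real.coe_toNNReal _ (by positivity)]
    rw [← le_div_iff₀ (by positivity)] at h3
    refine h3.trans (le_of_eq ?_)
    field_simp
  have hsum : ∑ ξ ∈ T, ∫⁻ p in {p : ℝ × ℝ | polarPoint p.1 p.2 ∈
      lam '' closedSquare (w ξ).a (w ξ).h}, W p ∂(polarMeasure γ) ≤ B * Y := by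
    refine sum_setLIntegral_le_of_overlap (polarMeasure γ) T
      (fun ξ => {p : ℝ × ℝ | polarPoint p.1 p.2 ∈ lam '' closedSquare (w ξ).a (w ξ).h})
      (fun ξ _ => measurable_polarPoint ((isCompact_closedSquare _ _).image_of_continuousOn
        (hlam.continuousOn.mono (w ξ).square_subset)).measurableSet)
      (measurable_polarPoint hG.measurableSet)
      (fun ξ _ p hp => (w ξ).ball_subset ((w ξ).image_subset hp)) hW fun p => ?_
    set y := polarPoint p.1 p.2
    set T' := T.filter fun ξ => y ∈ lam '' closedSquare (w ξ).a (w ξ).h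
    rw [show {ξ ∈ (T : Set ι) | p ∈ {p : ℝ × ℝ | polarPoint p.1 p.2 ∈
      lam '' closedSquare (w ξ).a (w ξ).h}} = (T' : Finset ι) by ext; simp [T', y], ncard_coe_finset]
    have h1 := card_mul_le_of_overlap volume T' (fun ξ => (w ξ).s)
      (fun ξ _ => (w ξ).measurableSet_supp) (E := Metric.closedBall y (2 * c₁ * ε))
      (fun ξ hξ x hx => hdiam ξ x ((w ξ).image_subset ((w ξ).supp_subset hx)) y
        ((w ξ).image_subset (Finset.mem_filter.1 hξ).2))
      (fun ξ _ => (w ξ).le_volume) (M := M) (fun y => by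
        refine (ncard_le_ncard (fun ξ hξ => ?_) (T.finite_toSet.subset (sep_subset _ _))).trans (hM y)
        exact ⟨(Finset.mem_filter.1 hξ.1).1, hξ.2⟩)
    have h3 : (T'.card : ℝ) * (c₀ * ε ^ 2) ≤ M * ((2 * c₁ * ε) ^ 2 * Real.pi) := by
      rw [← ENNReal.ofReal_le_ofReal_iff (by positivity)]
      rw [ENNReal.ofReal_mul (by positivity), ENNReal.ofReal_natCast]
      refine h1.trans (le_of_eq ?_)
      rw [EuclideanSpace.volume_closedBall_fin_two, ENNReal.ofReal_mul (p := (M : ℝ)) (by positivity),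
        ENNReal.ofReal_natCast, ENNReal.ofReal_mul (p := (2 * c₁ * ε) ^ 2) (by positivity),
        ENNReal.ofReal_pow (by positivity)]
    rw [← ENNReal.ofReal_natCast]
    refine ENNReal.ofReal_le_ofReal ?_
    rw [← le_div_iff₀ (by positivity)] at h3
    refine h3.trans (le_of_eq ?_)
    field_simp
  refine (hK₃ T _ _ t ε (B * Y) hε (fun ξ _ => htε ξ) hcount hcoef hsum).trans (le_of_eq ?_)
  rw [ENNReal.mul_rpow_of_nonneg _ _ (by positivity), ENNReal.coe_mul,
    ENNReal.coe_rpow_of_nonneg _ (by positivity)]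
  ring

end Face


/-! ### Combinatorics of patches, edges and vertices. -/

section Segments

/-- An endpoint is an extreme point: p cannot lie strictly between two points of the segment from p
to p' unless they coincide with it. -/
theorem eq_or_eq_of_mem_segment {p p' u w : E3} (hp : p ∈ segment ℝ u w) (hu : u ∈ segment ℝ p p')
    (hw : w ∈ segment ℝ p p') : p = u ∨ p = w := by
  rw [segment_eq_image'] at hp hu hw
  obtain ⟨c, hc, hp⟩ := hp
  obtain ⟨s, hs, hu⟩ := hu
  obtain ⟨t, ht, hw⟩ := hw
  simp only at hp hu hw
  have h : ((1 - c) * s + c * t) • (p' - p) = 0 := by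
    have h2 : p - u = c • (w - u) := by rw [← sub_eq_iff_eq_add'.2 hp.symm]
    rw [← hu, ← hw] at h2
    have h3 : ((1 - c) * s + c * t) • (p' - p) =
      c • (p + t • (p' - p) - (p + s • (p' - p))) - (p - (p + s • (p' - p))) := by module
    rw [h3, ← h2, sub_self]
  rcases smul_eq_zero.1 h with h | h
  · have h1 : 0 ≤ (1 - c) * s := mul_nonneg (by linarith [hc.2]) hs.1
    have h2 : 0 ≤ c * t := mul_nonneg hc.1 ht.1
    rcases mul_eq_zero.1 (show c * t = 0 by linarith) with h3 | h3
    · left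
      have : s = 0 := by
        rw [h3] at h
        linarith
      rw [← hu, this]
      simp
    · right
      rw [← hw, h3]
      simp
  · left
    rw [← hu, h]
    simp

end Segments

namespace PolyhedralSurface

variable {I N : ℕ} (S : PolyhedralSurface I N)

theorem edge_subset (i : Fin I) (a : Fin 4) :
    segment ℝ (S.vertex (S.corner i a)) (S.vertex (S.corner i (a + 1))) ⊆ S.patchBd i := by
  rw [patchBd, S.region_frontier]
  exact subset_iUnion (fun a => segment ℝ (S.vertex (S.corner i a)) (S.vertex (S.corner i (a + 1)))) a

theorem closure_patch (i : Fin I) : closure (S.patch i) = S.plane i '' closure (S.region i) :=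
  ((S.plane i).isometry.isClosedEmbedding.closure_image_eq _)

theorem patchBd_subset_closure (i : Fin I) : S.patchBd i ⊆ closure (S.patch i) := by
  rw [closure_patch]
  exact image_mono frontier_subset_closure

theorem disjoint_patchBd_patch (i : Fin I) : Disjoint (S.patchBd i) (S.patch i) := by
  rw [patchBd, patch, disjoint_image_iff (S.plane i).injective]
  rw [(S.region_isOpen i).frontier_eq]
  exact disjoint_sdiff_left

theorem vertex_mem_patchBd (i : Fin I) (a : Fin 4) : S.vertex (S.corner i a) ∈ S.patchBd i :=
  S.edge_subset i a (left_mem_segment ℝ _ _)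

/-- In each admissible configuration the two closed patches meet only on the boundary chain of `l`,
which misses the open patch. -/
theorem disjoint_closure_patch {i l : Fin I} (h : i ≠ l) :
    Disjoint (closure (S.patch i)) (S.patch l) := by
  have key : closure (S.patch i) ∩ closure (S.patch l) ⊆ S.patchBd l := by
    rcases S.essentially_disjoint i l h with h | ⟨a, b, hab, h⟩ | ⟨a, b, hab, h⟩
    · exact (h.subset.trans (empty_subset _))
    · refine h.subset.trans (singleton_subset_iff.2 ?_)
      rw [hab]
      exact S.vertex_mem_patchBd l b
    · rw [hab] at h
      exact h.subset.trans (S.edge_subset l b)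
  rw [Set.disjoint_left]
  intro x hx hxl
  exact (S.disjoint_patchBd_patch l).le_bot ⟨key ⟨hx, subset_closure hxl⟩, hxl⟩

theorem closure_patch_subset_bd (i : Fin I) : closure (S.patch i) ⊆ S.bd := by
  rw [bd, S.boundary_eq]
  exact subset_iUnion (fun i => closure (S.plane i '' S.region i)) i

/-- Translates between `dist_patch`, which speaks of closures, and incidence, which speaks of
corners. The delicate case is a shared edge: a corner of `l` on an edge of `l` is one of its ends by
`chain_adjacent`, and equal segments have the same ends. -/
theorem incident_of_mem_closure {n : Fin N} {i : Fin I} (h : S.vertex n ∈ closure (S.patch i)) :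
    S.Incident n i := by
  obtain ⟨l, a, rfl⟩ := S.vertex_used n
  by_cases hil : i = l
  · subst hil
    exact ⟨a, rfl⟩
  have hl : S.vertex (S.corner l a) ∈ closure (S.patch l) :=
    S.patchBd_subset_closure l (S.vertex_mem_patchBd l a)
  have hmem : S.vertex (S.corner l a) ∈ closure (S.patch i) ∩ closure (S.patch l) := ⟨h, hl⟩
  rcases S.essentially_disjoint i l hil with h' | ⟨a', b, hab, h'⟩ | ⟨a', b, hab, h'⟩
  · exact absurd (h'.subset hmem) (notMem_empty _)
  · have := h'.subset hmem
    exact ⟨a', S.vertex_injective this.symm⟩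
  · have hm : S.vertex (S.corner l a) ∈
        segment ℝ (S.vertex (S.corner i a')) (S.vertex (S.corner i (a' + 1))) := h'.subset hmem
    have hm' := hab.subset hm
    have hinj : ∀ x y, S.vertex (S.corner l x) = S.vertex (S.corner l y) → x = y := fun x y hxy =>
      S.corner_injective l (S.vertex_injective hxy)
    have hend : a = b ∨ a = b + 1 := by
      have hcases : a = b ∨ a = b + 1 ∨ a = b + 2 ∨ a = b + 3 := by
        have : ∀ a b : Fin 4, a = b ∨ a = b + 1 ∨ a = b + 2 ∨ a = b + 3 := by decide
        exact this a b
      rcases hcases with h1 | h1 | h1 | h1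
      · exact Or.inl h1
      · exact Or.inr h1
      · exfalso
        have h2 := (S.chain_adjacent l b).subset
          ⟨hm', by rw [h1]; exact right_mem_segment ℝ _ _⟩
        have h3 := hinj _ _ h2
        rw [h1] at h3
        revert h3
        have : ∀ b : Fin 4, ¬ b + 2 = b + 1 := by decide
        exact this b
      · exfalso
        have e1 : ∀ b : Fin 4, b + 3 + 1 = b := by decide
        have e2 : ∀ b : Fin 4, b + 3 + 2 = b + 1 := by decide
        have h2 := (S.chain_adjacent l (b + 3)).subset
          (show S.vertex (S.corner l a) ∈ _ from
            ⟨by rw [h1]; exact left_mem_segment ℝ _ _, by rw [e1, e2]; exact hm'⟩)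
        have h3 := hinj _ _ h2
        rw [h1] at h3
        revert h3
        have : ∀ b : Fin 4, ¬ b + 3 = b + 3 + 1 := by decide
        exact this b
    have hu := hab.subset (left_mem_segment ℝ _ _)
    have hw := hab.subset (right_mem_segment ℝ _ _)
    have : S.vertex (S.corner l a) = S.vertex (S.corner i a') ∨
        S.vertex (S.corner l a) = S.vertex (S.corner i (a' + 1)) := by
      rcases hend with h1 | h1
      · rw [h1] at hm ⊢
        exact eq_or_eq_of_mem_segment hm hu hw
      · rw [h1] at hm ⊢
        rw [segment_symm] at hu hw
        exact eq_or_eq_of_mem_segment hm hu hw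
    rcases this with h1 | h1
    · exact ⟨a', S.vertex_injective h1.symm⟩
    · exact ⟨a' + 1, S.vertex_injective h1.symm⟩

end PolyhedralSurface

/-! ### Sectors and the charts of the cone faces. -/

section Sectors

/-- A rotation moves the given point to the positive axis, near which `polarInverse` supplies
continuous polar coordinates. -/
theorem isOpen_sector (γ : ℝ) : IsOpen (sector γ) := by
  rw [isOpen_iff_mem_nhds]
  rintro _ ⟨r, φ, hr, hφ, rfl⟩
  set T := planeRotation φ
  have hT : T (polarPoint r 0) = polarPoint r φ := by
    rw [planeRotation_polarPoint, add_zero]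
  have hTs : T.symm (polarPoint r φ) = polarPoint r 0 := by
    rw [← hT, LinearIsometryEquiv.symm_apply_apply]
  have h0 : (0 : ℝ) < polarPoint r 0 0 := by simpa [polarPoint] using hr
  have hc0 : ContinuousAt (fun y : E2 => T.symm y 0) (polarPoint r φ) := by fun_prop
  have hc : ContinuousAt (fun y : E2 => φ + (polarInverse (T.symm y)).2) (polarPoint r φ) := by
    have h1 : ContinuousAt polarInverse (T.symm (polarPoint r φ)) := by
      rw [hTs]
      exact (contDiffAt_polarInverse h0 0).continuousAt
    exact continuousAt_const.add (continuous_snd.continuousAt.comp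
      (ContinuousAt.comp (g := polarInverse) (f := T.symm) h1 T.symm.continuous.continuousAt))
  have e1 : ∀ᶠ y in 𝓝 (polarPoint r φ), 0 < T.symm y 0 :=
    hc0.eventually (lt_mem_nhds (by
      change 0 < T.symm (polarPoint r φ) 0
      rw [hTs]
      exact h0))
  have e2 : ∀ᶠ y in 𝓝 (polarPoint r φ), φ + (polarInverse (T.symm y)).2 ∈ Ioo 0 γ := by
    refine hc.eventually (isOpen_Ioo.mem_nhds ?_)
    change φ + (polarInverse (T.symm (polarPoint r φ))).2 ∈ Ioo 0 γ
    rw [hTs]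
    simpa [polarInverse, polarPoint] using hφ
  filter_upwards [e1, e2] with y hy1 hy2
  refine ⟨(polarInverse (T.symm y)).1, _, ?_, hy2, ?_⟩
  · exact Real.sqrt_pos.2 (by positivity)
  · rw [← planeRotation_polarPoint, polarPoint_polarInverse hy1]
    exact (T.apply_symm_apply y).symm

theorem exists_mem_sector_norm_lt {γ ε : ℝ} (hγ : 0 < γ) (hε : 0 < ε) :
    ∃ y ∈ sector γ, ‖y‖ < ε := by
  refine ⟨polarPoint (ε / 2) (γ / 2), ⟨ε / 2, γ / 2, by positivity, ⟨by linarith, by linarith⟩, rfl⟩, ?_⟩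
  rw [norm_polarPoint (by positivity)]
  linarith

end Sectors

section Charts

/-- The affine isometry `c` takes its values in the plane of the patch `F_i`. -/
def IsPlaneChart {I N : ℕ} (S : PolyhedralSurface I N) (i : Fin I) (c : E2 →ᵃⁱ[ℝ] E3) : Prop :=
  ∀ y, c y ∈ range (S.plane i)

theorem affineIsometry_apply (c : E2 →ᵃⁱ[ℝ] E3) (y : E2) : c y = c.linearIsometry y + c 0 := by
  have := c.map_vadd 0 y
  simpa using this

/-- Near the vertex the face coincides with the patch. The preimage under the chart of the plane of
the patch is an affine subspace containing a nonempty open set, hence everything. -/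
theorem ConeCharts.isPlaneChart {I N : ℕ} {S : PolyhedralSurface I N} (R : ConeCharts S) {n : Fin N}
    {i : Fin I} (h : S.Incident n i) : IsPlaneChart S i (R.chart n i) := by
  set c := R.chart n i
  obtain ⟨ε, hε, hg⟩ := R.face_germ n i h
  set O : Set E2 := sector (R.angle n i) ∩ Metric.ball 0 ε
  have hO : IsOpen O := (isOpen_sector _).inter Metric.isOpen_ball
  have hOne : O.Nonempty := by
    obtain ⟨y, hy, hyε⟩ := exists_mem_sector_norm_lt (R.angle_mem n i h).1 hε
    exact ⟨y, hy, by simpa using hyε⟩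
  set Q : AffineSubspace ℝ E3 := (⊤ : AffineSubspace ℝ E2).map (S.plane i).toAffineMap
  have hOQ : O ⊆ (Q.comap c.toAffineMap : Set E2) := by
    rintro y ⟨hy, hyε⟩
    have h1 : c y ∈ Metric.ball (S.vertex n) ε := by
      rw [Metric.mem_ball, ← R.chart_zero n i h, c.dist_map]
      exact hyε
    have h2 := (hg.subset ⟨h1, mem_image_of_mem c hy⟩).2
    obtain ⟨x, -, hx⟩ := h2
    exact ⟨x, trivial, hx⟩
  have htop : Q.comap c.toAffineMap = ⊤ := by
    rw [eq_top_iff, ← hO.affineSpan_eq_top hOne, affineSpan_le]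
    exact hOQ
  intro y
  have : y ∈ Q.comap c.toAffineMap := by rw [htop]; trivial
  obtain ⟨x, -, hx⟩ := this
  exact ⟨x, hx⟩

/-- Two isometric coordinate systems of the same plane differ by a rigid motion, which transfers
areas, balls and frontiers from one to the other. -/
theorem IsPlaneChart.exists_equiv {I N : ℕ} {S : PolyhedralSurface I N} {i : Fin I}
    {c : E2 →ᵃⁱ[ℝ] E3} (hc : IsPlaneChart S i c) :
    ∃ A : E2 ≃ᵢ E2, (∀ y, c y = S.plane i (A y)) ∧ MeasurePreserving A := by
  set P := S.plane i
  obtain ⟨x₀, hx₀⟩ := hc 0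
  have hlin : ∀ y, ∃ x, P.linearIsometry x = c.linearIsometry y := by
    intro y
    obtain ⟨x, hx⟩ := hc y
    refine ⟨x - x₀, ?_⟩
    have h1 := affineIsometry_apply c y
    have h2 := affineIsometry_apply P x
    have h3 := affineIsometry_apply P x₀
    rw [map_sub]
    rw [← hx, ← hx₀, h2, h3] at h1
    rw [← sub_eq_iff_eq_add] at h1
    rw [← h1]
    abel
  choose g hg using hlin
  have hinj := P.linearIsometry.injective
  set U₀ : E2 →ₗᵢ[ℝ] E2 :=
    { toFun := g
      map_add' := fun x y => hinj (by rw [map_add, hg, hg, hg, map_add])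
      map_smul' := fun a x => hinj (by simp only [RingHom.id_apply, map_smul, hg])
      norm_map' := fun x => by
        change ‖g x‖ = ‖x‖
        rw [← P.linearIsometry.norm_map, hg, LinearIsometry.norm_map] }
  set U : E2 ≃ₗᵢ[ℝ] E2 := U₀.toLinearIsometryEquiv rfl
  have hU : ∀ y, P.linearIsometry (U y) = c.linearIsometry y := hg
  refine ⟨U.toIsometryEquiv.trans (IsometryEquiv.addRight x₀), fun y => ?_, ?_⟩
  · change c y = P (U y + x₀)
    rw [affineIsometry_apply P (U y + x₀), affineIsometry_apply c y, ← hU, ← hx₀,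
      affineIsometry_apply P x₀, map_add]
    abel
  · exact (measurePreserving_add_right volume x₀).comp U.measurePreserving

end Charts


/-- The affine map which is left inverse to the affine isometry `c`. -/
def chartInv (c : E2 →ᵃⁱ[ℝ] E3) (w : E3) : E2 :=
  ContinuousLinearMap.adjoint c.linearIsometry.toContinuousLinearMap (w - c 0)

theorem chartInv_apply (c : E2 →ᵃⁱ[ℝ] E3) (y : E2) : chartInv c (c y) = y := by
  rw [chartInv, affineIsometry_apply c y, add_sub_cancel_right]
  refine ext_inner_right ℝ fun v => ?_
  rw [ContinuousLinearMap.adjoint_inner_left]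
  exact c.linearIsometry.inner_map_map y v

theorem contDiff_chartInv (c : E2 →ᵃⁱ[ℝ] E3) {n : WithTop ℕ∞} : ContDiff ℝ n (chartInv c) := by
  unfold chartInv
  fun_prop

namespace PolyhedralSurface

variable {I N : ℕ} (S : PolyhedralSurface I N)

theorem isPlaneChart_plane (i : Fin I) : IsPlaneChart S i (S.plane i) := fun y => ⟨y, rfl⟩

theorem measurableSet_patch (i : Fin I) : MeasurableSet (S.patch i) :=
  (S.plane i).isometry.isClosedEmbedding.measurableEmbedding.measurableSet_image.2
    (S.region_isOpen i).measurableSet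

end PolyhedralSurface

namespace IsPlaneChart

variable {I N : ℕ} {S : PolyhedralSurface I N} {i : Fin I} {c : E2 →ᵃⁱ[ℝ] E3}

theorem apply_chartInv (hc : IsPlaneChart S i c) {x : E3} (hx : x ∈ closure (S.patch i)) :
    c (chartInv c x) = x := by
  obtain ⟨A, hA, -⟩ := hc.exists_equiv
  rw [S.closure_patch] at hx
  obtain ⟨z, -, rfl⟩ := hx
  obtain ⟨y, rfl⟩ := A.surjective z
  rw [← hA, chartInv_apply]

theorem isOpen_preimage (hc : IsPlaneChart S i c) : IsOpen (c ⁻¹' S.patch i) := by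
  obtain ⟨A, hA, -⟩ := hc.exists_equiv
  have : c ⁻¹' S.patch i = A ⁻¹' S.region i := by
    ext y
    rw [mem_preimage, hA, PolyhedralSurface.patch, (S.plane i).injective.mem_set_image]
    rfl
  rw [this]
  exact (S.region_isOpen i).preimage A.continuous

theorem mem_patchBd (hc : IsPlaneChart S i c) {p : E2} (hp : p ∈ frontier (c ⁻¹' S.patch i)) :
    c p ∈ S.patchBd i := by
  obtain ⟨A, hA, -⟩ := hc.exists_equiv
  have : c ⁻¹' S.patch i = A ⁻¹' S.region i := by
    ext y
    rw [mem_preimage, hA, PolyhedralSurface.patch, (S.plane i).injective.mem_set_image]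
    rfl
  rw [this] at hp
  have h2 := A.toHomeomorph.preimage_frontier (S.region i)
  have h3 : p ∈ A.toHomeomorph ⁻¹' frontier (S.region i) := by
    rw [h2]
    exact hp
  rw [hA]
  exact mem_image_of_mem _ h3

theorem exists_norm_preimage_le (i : Fin I) (c : E2 →ᵃⁱ[ℝ] E3) : ∃ R₀, ∀ y ∈ c ⁻¹' S.patch i, ‖y‖ ≤ R₀ := by
  have h1 : Bornology.IsBounded (S.patch i) :=
    (S.plane i).lipschitz.isBounded_image (S.region_isBounded i)
  have h2 : Bornology.IsBounded (c ⁻¹' S.patch i) := c.antilipschitz.isBounded_preimage h1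
  exact h2.exists_norm_le

theorem surfaceMeasure_eq (hc : IsPlaneChart S i c) {s : Set E3} (hs : MeasurableSet s)
    (hsi : s ⊆ S.patch i) : S.surfaceMeasure s = volume (c ⁻¹' s) := by
  obtain ⟨A, hA, hAm⟩ := hc.exists_equiv
  rw [PolyhedralSurface.surfaceMeasure, Measure.finsetSum_apply, Finset.sum_eq_single i]
  · rw [Measure.map_apply (S.plane i).continuous.measurable hs,
      Measure.restrict_apply ((S.plane i).continuous.measurable hs)]
    have h1 : S.plane i ⁻¹' s ∩ S.region i = S.plane i ⁻¹' s := by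
      refine inter_eq_left.2 fun y hy => ?_
      obtain ⟨x, hx, hxy⟩ := hsi hy
      rwa [← (S.plane i).injective hxy]
    rw [h1, ← hAm.measure_preimage ((S.plane i).continuous.measurable hs).nullMeasurableSet]
    congr 1
    ext y
    simp [hA]
  · intro l _ hl
    rw [Measure.map_apply (S.plane l).continuous.measurable hs,
      Measure.restrict_apply ((S.plane l).continuous.measurable hs)]
    convert measure_empty (μ := (volume : Measure E2))
    rw [eq_empty_iff_forall_notMem]
    rintro y ⟨hy, hyl⟩
    exact (S.disjoint_closure_patch hl.symm).le_bot
      ⟨subset_closure (hsi hy), mem_image_of_mem _ hyl⟩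
  · simp

theorem map_restrict_le (hc : IsPlaneChart S i c) :
    (volume.restrict (c ⁻¹' S.patch i)).map c ≤ S.surfaceMeasure := by
  refine Measure.le_iff.2 fun s hs => ?_
  rw [Measure.map_apply c.continuous.measurable hs,
    Measure.restrict_apply (c.continuous.measurable hs), ← preimage_inter,
    ← hc.surfaceMeasure_eq (hs.inter (S.measurableSet_patch i)) inter_subset_right]
  exact measure_mono inter_subset_left

end IsPlaneChart

/-! ### Parametrizations: comparison of measures and bounds for derivatives. -/

namespace PolyhedralSurface

variable {I N : ℕ} (S : PolyhedralSurface I N)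

theorem openUnitSquare_subset_unitSquare : openUnitSquare ⊆ unitSquare := fun _ hx m =>
  Ioo_subset_Icc_self (hx m)

theorem exists_dist_le (i : Fin I) : ∃ L : ℝ≥0, ∀ x ∈ unitSquare, ∀ y ∈ unitSquare,
    dist x y ≤ L * dist (S.κ i x) (S.κ i y) := by
  obtain ⟨L, hL, h⟩ := S.κ_bilipschitz i
  exact ⟨⟨L, hL.le⟩, fun x hx y hy => (h x hx y hy).2⟩

theorem continuousOn_param (i : Fin I) : ContinuousOn (S.κ i) unitSquare := by
  obtain ⟨L, hL, h⟩ := S.κ_bilipschitz i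
  have : LipschitzOnWith ⟨L, hL.le⟩ (S.κ i) unitSquare :=
    LipschitzOnWith.of_dist_le_mul fun x hx y hy => (h x hx y hy).1
  exact this.continuousOn

theorem param_mem_closure (i : Fin I) {x : E2} (hx : x ∈ unitSquare) :
    S.κ i x ∈ closure (S.patch i) := (S.κ_bijOn i).mapsTo hx

theorem dist_chartInv_param {i : Fin I} {c : E2 →ᵃⁱ[ℝ] E3} (hc : IsPlaneChart S i c) {x y : E2}
    (hx : x ∈ unitSquare) (hy : y ∈ unitSquare) :
    dist (chartInv c (S.κ i x)) (chartInv c (S.κ i y)) = dist (S.κ i x) (S.κ i y) := by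
  rw [← c.dist_map, hc.apply_chartInv (S.param_mem_closure i hx),
    hc.apply_chartInv (S.param_mem_closure i hy)]

/-- The parametrization is read in the plane of the patch, where the planar bi-Lipschitz estimate
applies. It transfers L₂-bounds from the surface to the parameter square. -/
theorem map_param_le {i : Fin I} {L : ℝ≥0}
    (hL : ∀ x ∈ unitSquare, ∀ y ∈ unitSquare, dist x y ≤ L * dist (S.κ i x) (S.κ i y))
    {Q : Set E2} (hQm : MeasurableSet Q) (hQ : Q ⊆ unitSquare) (hQi : MapsTo (S.κ i) Q (S.patch i)) :
    (volume.restrict Q).map (S.κ i) ≤ (L : ℝ≥0∞) ^ 2 • S.surfaceMeasure := by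
  set c := S.plane i
  have hc : IsPlaneChart S i c := S.isPlaneChart_plane i
  set lam : E2 → E2 := fun x => chartInv c (S.κ i x)
  have hcl : ∀ x ∈ Q, c (lam x) = S.κ i x := fun x hx =>
    hc.apply_chartInv (S.param_mem_closure i (hQ hx))
  have hlam : ContinuousOn lam Q :=
    (contDiff_chartInv c (n := 0)).continuous.comp_continuousOn ((S.continuousOn_param i).mono hQ)
  have h1 : (volume.restrict Q).map lam ≤ (L : ℝ≥0∞) ^ 2 • volume.restrict (c ⁻¹' S.patch i) := by
    refine map_restrict_le_of_dist_le hQm hlam (fun x hx y hy => ?_) (fun x hx => ?_)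
    · rw [S.dist_chartInv_param hc (hQ hx) (hQ hy)]
      exact hL x (hQ hx) y (hQ hy)
    · rw [mem_preimage, hcl x hx]
      exact hQi hx
  have h2 : (volume.restrict Q).map (S.κ i) = ((volume.restrict Q).map lam).map c := by
    rw [AEMeasurable.map_map_of_aemeasurable c.continuous.measurable.aemeasurable
      (hlam.aemeasurable hQm)]
    refine Measure.map_congr ?_
    filter_upwards [ae_restrict_mem hQm] with x hx
    exact (hcl x hx).symm
  rw [h2]
  refine (Measure.map_mono h1 c.continuous.measurable).trans ?_
  rw [Measure.map_smul]
  exact Measure.le_iff'.2 fun s => by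
    simpa only [Measure.smul_apply, smul_eq_mul] using mul_right_mono (hc.map_restrict_le s)

theorem SmoothParam.exists_iteratedFDeriv_chartInv_le {S : PolyhedralSurface I N} {k : ℕ}
    (h : S.SmoothParam k) (i : Fin I) (c : E2 →ᵃⁱ[ℝ] E3) :
    ContDiffOn ℝ k (fun x => chartInv c (S.κ i x)) openUnitSquare ∧
    ∃ D : ℝ, ∀ x ∈ openUnitSquare, ∀ m, 1 ≤ m → m ≤ k →
      ‖iteratedFDeriv ℝ m (fun x => chartInv c (S.κ i x)) x‖ ≤ D ^ m := by
  obtain ⟨h1, h2⟩ := h i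
  refine ⟨(contDiff_chartInv c).comp_contDiffOn h1, ?_⟩
  set T := ContinuousLinearMap.adjoint c.linearIsometry.toContinuousLinearMap
  have hE : ∀ m ≤ k, ∃ C : ℝ, ∀ x ∈ openUnitSquare, 1 ≤ m →
      ‖iteratedFDeriv ℝ m (fun x => chartInv c (S.κ i x)) x‖ ≤ C := by
    intro m hm
    obtain ⟨C, hC⟩ := h2 m hm
    refine ⟨‖T‖ * C, fun x hx hm1 => ?_⟩
    have hκ : ContDiffAt ℝ m (S.κ i) x :=
      ((h1 x hx).contDiffAt (isOpen_openUnitSquare.mem_nhds hx)).of_le (by exact_mod_cast hm)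
    have e : (fun x => chartInv c (S.κ i x)) = fun x => (T ∘ S.κ i) x - T (c 0) := by
      funext x
      exact map_sub T _ _
    rw [e, iteratedFDeriv_sub_const_apply hm1 (T.contDiff.contDiffAt.comp x hκ)]
    exact (T.norm_iteratedFDeriv_comp_left hκ le_rfl).trans
      (mul_le_mul_of_nonneg_left (hC x hx) (norm_nonneg _))
  choose! C hC using hE
  -- The summand 1 makes D ≥ 1, so that D ≤ D^m for every order m ≥ 1.
  refine ⟨1 + ∑ m ∈ Finset.range (k + 1), |C m|, fun x hx m hm1 hmk => ?_⟩
  have h3 : |C m| ≤ ∑ m ∈ Finset.range (k + 1), |C m| :=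
    Finset.single_le_sum (f := fun m => |C m|) (fun _ _ => abs_nonneg _)
      (Finset.mem_range.2 (by omega))
  have h4 : 1 ≤ 1 + ∑ m ∈ Finset.range (k + 1), |C m| := by
    linarith [abs_nonneg (C m)]
  calc ‖iteratedFDeriv ℝ m (fun x => chartInv c (S.κ i x)) x‖ ≤ C m := hC m hmk x hx hm1
    _ ≤ |C m| := le_abs_self _
    _ ≤ 1 + ∑ m ∈ Finset.range (k + 1), |C m| := by linarith
    _ ≤ _ := le_self_pow₀ h4 (by omega)

end PolyhedralSurface

theorem isCompact_unitSquare : IsCompact unitSquare := by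
  have : unitSquare = closedSquare 0 1 := by
    ext x
    simp [unitSquare, closedSquare]
  rw [this]
  exact isCompact_closedSquare _ _

theorem measurableSet_unitSquare : MeasurableSet unitSquare := isCompact_unitSquare.measurableSet

namespace PolyhedralSurface

variable {I N : ℕ} (S : PolyhedralSurface I N)

theorem mem_supp {f : E3 → ℂ} {x : E3} (hx : x ∈ S.bd) (hf : f x ≠ 0) : x ∈ S.supp f :=
  subset_closure ⟨hx, hf⟩

theorem supp_subset_bd (f : E3 → ℂ) : S.supp f ⊆ S.bd :=
  closure_minimal inter_subset_left isClosed_frontier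

theorem eq_zero_of_supp_subset_image {f : E3 → ℂ} {i : Fin I} {Q : Set E2} (hQ : Q ⊆ unitSquare)
    (hf : S.supp f ⊆ S.κ i '' Q) {x : E2} (hx : x ∈ unitSquare \ Q) : f (S.κ i x) = 0 := by
  by_contra h
  obtain ⟨y, hy, hyx⟩ := hf (S.mem_supp
    (S.closure_patch_subset_bd i (S.param_mem_closure i hx.1)) h)
  exact hx.2 ((S.κ_bijOn i).injOn (hQ hy) hx.1 hyx ▸ hy)

/-- Only patch `i` contributes: the support lies in the open patch, which the closures of all other
patches avoid. -/
theorem pairing_eq {f : E3 → ℂ} {i : Fin I} {Q : Set E2} (hQ : Q ⊆ unitSquare)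
    (hf : S.supp f ⊆ S.κ i '' Q) (hQi : MapsTo (S.κ i) Q (S.patch i)) (u : E3 → ℂ) :
    S.pairing u f = ∫ x in Q, u (S.κ i x) * conj (f (S.κ i x)) := by
  rw [pairing, Finset.sum_eq_single i]
  · refine setIntegral_eq_of_subset_of_forall_sdiff_eq_zero measurableSet_unitSquare hQ
      fun x hx => ?_
    rw [S.eq_zero_of_supp_subset_image hQ hf hx, map_zero, mul_zero]
  · intro l _ hl
    refine setIntegral_eq_zero_of_forall_eq_zero fun x hx => ?_
    have : f (S.κ l x) = 0 := by
      by_contra h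
      have hc := S.param_mem_closure l hx
      obtain ⟨y, hy, hyx⟩ := hf (S.mem_supp (S.closure_patch_subset_bd l hc) h)
      exact (S.disjoint_closure_patch hl).le_bot ⟨hc, hyx ▸ hQi hy⟩
    rw [this, map_zero, mul_zero]
  · simp

variable {S}

theorem eLpNorm_param_le {i : Fin I} {L : ℝ≥0}
    (hL : ∀ x ∈ unitSquare, ∀ y ∈ unitSquare, dist x y ≤ L * dist (S.κ i x) (S.κ i y))
    {Q : Set E2} (hQm : MeasurableSet Q) (hQ : Q ⊆ unitSquare) (hQi : MapsTo (S.κ i) Q (S.patch i))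
    {f : E3 → ℂ} (hf : AEStronglyMeasurable f S.surfaceMeasure) :
    eLpNorm (fun x => f (S.κ i x)) 2 (volume.restrict Q) ≤ L * eLpNorm f 2 S.surfaceMeasure := by
  have h1 := S.map_param_le hL hQm hQ hQi
  have hκ : AEMeasurable (S.κ i) (volume.restrict Q) :=
    ((S.continuousOn_param i).mono hQ).aemeasurable hQm
  have h2 : AEStronglyMeasurable f ((volume.restrict Q).map (S.κ i)) :=
    (hf.smul_measure ((L : ℝ≥0∞) ^ 2)).mono_measure h1
  calc eLpNorm (fun x => f (S.κ i x)) 2 (volume.restrict Q)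
      = eLpNorm f 2 ((volume.restrict Q).map (S.κ i)) := (eLpNorm_map_measure h2 hκ).symm
    _ ≤ eLpNorm f 2 ((L : ℝ≥0∞) ^ 2 • S.surfaceMeasure) := eLpNorm_mono_measure _ h1
    _ = L * eLpNorm f 2 S.surfaceMeasure := by
        rw [eLpNorm_smul_measure_of_ne_top (by norm_num), smul_eq_mul]
        congr 1
        rw [← ENNReal.rpow_natCast, ← ENNReal.rpow_mul]
        norm_num

theorem memLp_param {i : Fin I} {Q : Set E2} (hQm : MeasurableSet Q) (hQ : Q ⊆ unitSquare)
    (hQi : MapsTo (S.κ i) Q (S.patch i)) {f : E3 → ℂ} (hf : MemLp f 2 S.surfaceMeasure) :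
    MemLp (fun x => f (S.κ i x)) 2 (volume.restrict Q) := by
  obtain ⟨L, hL⟩ := S.exists_dist_le i
  have h1 := S.map_param_le hL hQm hQ hQi
  have hκ : AEMeasurable (S.κ i) (volume.restrict Q) :=
    ((S.continuousOn_param i).mono hQ).aemeasurable hQm
  exact ((hf.smul_measure (c := (L : ℝ≥0∞) ^ 2) (by finiteness)).mono_measure h1).comp_of_map hκ

end PolyhedralSurface

theorem le_dist_of_lt_setDist {X : Type*} [PseudoMetricSpace X] {A B : Set X} {t : ℝ}
    (h : ENNReal.ofReal t ≤ setDist A B) {a b : X} (ha : a ∈ A) (hb : b ∈ B) : t ≤ dist a b := by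
  have : setDist A B ≤ edist a b := (iInf₂_le a ha).trans (iInf₂_le b hb)
  rw [← ENNReal.ofReal_le_ofReal_iff dist_nonneg, ← edist_dist]
  exact h.trans this

/-! ### Interior wavelets in planar coordinates. -/

namespace DualWavelets

variable {I N : ℕ} {S : PolyhedralSurface I N} {d : ℕ} {Ξ : Type*} (W : DualWavelets S d Ξ)

theorem exists_planeWavelet {k : ℕ} (hkd : k ≤ d) (c' : ℝ) {C : ℝ} (hC : 0 < C) {i : Fin I}
    {c : E2 →ᵃⁱ[ℝ] E3} (hc : IsPlaneChart S i c) :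
    ∃ c₀ > 0, ∃ c₁ ≥ 0, ∃ c₂ : ℝ≥0, ∀ j ≥ W.j₀, ∀ ξ ∈ W.interiorGridPatch c' C j i,
      ∃ w : PlaneWavelet (fun x => chartInv c (S.κ i x)) (c ⁻¹' S.patch i) k c₀ c₁ c₂ (1 / 2 ^ j),
        w.s = c ⁻¹' S.supp (W.ψ j ξ) ∧ (w.η = fun x => W.ψ j ξ (S.κ i x)) ∧
        MapsTo (S.κ i) (closedSquare w.a w.h) (S.patch i) ∧
        S.supp (W.ψ j ξ) ⊆ S.κ i '' closedSquare w.a w.h := by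
  obtain ⟨c₀, Ca, hc₀, hs⟩ := W.supp_area
  obtain ⟨_, Cn, _, hn⟩ := W.normalized
  obtain ⟨L, hL⟩ := S.exists_dist_le i
  obtain ⟨A, hA, -⟩ := hc.exists_equiv
  -- The radius is at most C times the root of the area, and the area is at most Ca 4^(-j), which
  -- gives c₁; `max` is there because Ca is not assumed nonnegative. In c₂ the factor L comes from
  -- passing to the parameter square.
  refine ⟨c₀, hc₀, C * √(max Ca 0), by positivity, L * Cn.toNNReal, fun j hj ξ hξ => ?_⟩
  obtain ⟨hξg, a, h, z, r, hh, hr, hQ, hsQ, hQB, hBF, -, hrC, hdist⟩ := hξ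
  have hQu := hQ.trans PolyhedralSurface.openUnitSquare_subset_unitSquare
  have hQm : MeasurableSet (closedSquare a h) := (isClosed_closedSquare _ _).measurableSet
  have hQi : MapsTo (S.κ i) (closedSquare a h) (S.patch i) := fun x hx =>
    hBF (hQB (mem_image_of_mem _ hx))
  have hsi : S.supp (W.ψ j ξ) ⊆ S.patch i := hsQ.trans hQi.image_subset
  have hsm : MeasurableSet (S.supp (W.ψ j ξ)) := isClosed_closure.measurableSet
  have hball : ∀ y, dist y (A.symm z) = dist (A y) z := fun y => by
    rw [← A.dist_eq y, A.apply_symm_apply]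
  have hcball : ∀ y ∈ Metric.ball (A.symm z) r, c y ∈ S.plane i '' Metric.ball z r := by
    intro y hy
    refine ⟨A y, ?_, (hA y).symm⟩
    rw [Metric.mem_ball, ← hball]
    exact hy
  have hpow : (1 / 2 ^ (2 * j) : ℝ) = (1 / 2 ^ j) ^ 2 := by
    rw [div_pow, one_pow, ← pow_mul, mul_comm]
  refine ⟨⟨a, h, A.symm z, r, c ⁻¹' S.supp (W.ψ j ξ), fun x => W.ψ j ξ (S.κ i x), hh, hQ, ?_, ?_,
    ?_, ?_, ?_, ?_, ?_, ?_, ?_, ?_⟩, rfl, rfl, hQi, hsQ⟩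
  · intro y hy
    obtain ⟨x, hx, hxy⟩ := hsQ hy
    exact ⟨x, hx, by simp only [hxy, chartInv_apply]⟩
  · rintro _ ⟨x, hx, rfl⟩
    obtain ⟨t, ht, htx⟩ := hQB (mem_image_of_mem _ hx)
    rw [Metric.mem_ball, hball, ← (S.plane i).dist_map, ← hA,
      hc.apply_chartInv (S.param_mem_closure i (hQu hx)), ← htx, (S.plane i).dist_map]
    exact ht
  · exact fun y hy => hBF (hcball y hy)
  · exact c.continuous.measurable hsm
  · rw [← hc.surfaceMeasure_eq hsm hsi, ← hpow, mul_one_div]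
    exact (hs j hj i ξ hξg).1
  · refine hrC.trans ?_
    rw [mul_assoc]
    refine mul_le_mul_of_nonneg_left ?_ hC.le
    rw [← Real.sqrt_sq (show (0 : ℝ) ≤ 1 / 2 ^ j by positivity), ← Real.sqrt_mul (le_max_right _ _),
      ← hpow]
    refine Real.sqrt_le_sqrt (ENNReal.toReal_le_of_le_ofReal (by positivity)
      ((hs j hj i ξ hξg).2.trans (ENNReal.ofReal_le_ofReal ?_)))
    rw [mul_one_div]
    gcongr
    exact le_max_left _ _
  · intro y hy p hp
    rw [← c.dist_map]
    exact le_dist_of_lt_setDist hdist.le (hcball y hy) (hc.mem_patchBd hp)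
  · exact PolyhedralSurface.memLp_param hQm hQu hQi (W.memLp j hj i ξ hξg)
  · have h1 := PolyhedralSurface.eLpNorm_param_le hL hQm hQu hQi (W.memLp j hj i ξ hξg).1
    rw [eLpNorm_eq_lintegral_rpow_enorm_toReal (by norm_num) (by norm_num)] at h1
    simp only [ENNReal.toReal_ofNat, ENNReal.rpow_ofNat] at h1
    refine h1.trans ?_
    rw [ENNReal.coe_mul]
    exact mul_right_mono (hn j hj i ξ hξg).2
  · intro P hP
    rw [← W.vanishing_moments j hj i ξ hξg i hsi P (by omega)]
    refine (setIntegral_eq_of_subset_of_forall_sdiff_eq_zero measurableSet_unitSquare hQu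
      fun x hx => ?_).symm
    rw [S.eq_zero_of_supp_subset_image hQu hsQ hx, map_zero, mul_zero]

end DualWavelets

theorem polarDeriv_congr {g₁ g₂ : ℝ → ℝ → ℂ} {p : ℝ × ℝ}
    (h : ∀ᶠ q in 𝓝 p, g₁ q.1 q.2 = g₂ q.1 q.2) (a b : ℕ) :
    polarDeriv a b g₁ p = polarDeriv a b g₂ p := by
  have h1 : ∀ᶠ r in 𝓝 p.1, ∀ᶠ φ in 𝓝 p.2, g₁ r φ = g₂ r φ := by
    rw [← Prod.mk.eta (p := p), nhds_prod_eq] at h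
    exact h.curry
  have h2 : (fun r => iteratedDeriv b (fun φ => g₁ r φ) p.2) =ᶠ[𝓝 p.1]
      fun r => iteratedDeriv b (fun φ => g₂ r φ) p.2 := by
    filter_upwards [h1] with r hr
    exact EventuallyEq.iteratedDeriv_eq b hr
  exact h2.iteratedDeriv_eq a

/-! ### The weighted energy is bounded by the norm. -/

namespace SpecialResolution

variable {I N : ℕ} {S : PolyhedralSurface I N} {R : ConeCharts S} (Φ : SpecialResolution S R)

theorem coneNorm_le_smoothNorm (k : ℕ) (ρ : ℝ) (n : Fin N) (u : E3 → ℂ) :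
    Φ.coneNorm k ρ ρ n u ≤ Φ.smoothNorm k ρ u :=
  Finset.single_le_sum (f := fun n => Φ.coneNorm k ρ ρ n u) (fun _ _ => zero_le) (Finset.mem_univ n)

theorem sum_faceTerm_le_smoothNorm {n : Fin N} {i : Fin I} (h : S.Incident n i) (k : ℕ) (ρ : ℝ)
    (u : E3 → ℂ) : ∑ β ∈ multiIndices k, faceTerm (R.angle n i) ρ ρ β.1 β.2 (Φ.localPolar n i u) ≤
      Φ.smoothNorm k ρ u := by
  classical
  refine le_trans ?_ (Φ.coneNorm_le_smoothNorm k ρ n u)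
  rw [coneNorm]
  refine le_trans ?_ le_add_self
  exact Finset.single_le_sum (f := fun i => ∑ β ∈ multiIndices k,
    faceTerm (R.angle n i) ρ ρ β.1 β.2 (Φ.localPolar n i u)) (fun _ _ => zero_le)
    (by simpa using h)

/-- Minkowski's inequality splits the energy into the face terms. Above the open patch, f agrees
with `localPolar` in a neighbourhood of each point, so their derivatives agree; no smoothness of
`localPolar` elsewhere is used. -/
theorem lintegral_weightedSum_le {n : Fin N} {i : Fin I} (h : S.Incident n i) (k : ℕ) (ρ : ℝ)
    {u : E3 → ℂ} {f : E2 → ℂ} (hf : ContDiff ℝ (⊤ : ℕ∞) f)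
    (hfu : ∀ y ∈ R.chart n i ⁻¹' S.patch i, f y = Φ.φ n (R.chart n i y) * u (R.chart n i y)) :
    (∫⁻ p in {p : ℝ × ℝ | polarPoint p.1 p.2 ∈ R.chart n i ⁻¹' S.patch i},
      ENNReal.ofReal (weightedSum (R.angle n i) ρ k (fun r φ => f (polarPoint r φ)) p) ^ 2
        ∂(polarMeasure (R.angle n i))) ^ (1 / 2 : ℝ) ≤ Φ.smoothNorm k ρ u := by
  refine le_trans ?_ (Φ.sum_faceTerm_le_smoothNorm h k ρ u)
  set γ := R.angle n i
  set G := R.chart n i ⁻¹' S.patch i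
  have hG : IsOpen G := (R.isPlaneChart h).isOpen_preimage
  set E : Set (ℝ × ℝ) := {p : ℝ × ℝ | polarPoint p.1 p.2 ∈ G}
  have hE : IsOpen E := hG.preimage contDiff_polarPoint.continuous
  set F : ℕ × ℕ → ℝ × ℝ → ℂ := fun β p =>
    (p.1 ^ (-ρ) * (1 + p.1) ^ ρ * (angDist γ p.2 * p.1) ^ β.1 *
      angDist γ p.2 ^ ((β.2 : ℝ) - ρ)) • polarDeriv β.1 β.2 (fun r φ => f (polarPoint r φ)) p
  have hF : ∀ β, Measurable (F β) := by
    intro β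
    have h1 := (continuous_polarDeriv (hf.comp contDiff_polarPoint) β.1 β.2).measurable
    have h2 : Measurable fun p : ℝ × ℝ => angDist γ p.2 := by unfold angDist; fun_prop
    have h3 : Measurable fun p : ℝ × ℝ => p.1 ^ (-ρ) * (1 + p.1) ^ ρ *
      (angDist γ p.2 * p.1) ^ β.1 * angDist γ p.2 ^ ((β.2 : ℝ) - ρ) := by fun_prop
    exact h3.smul h1
  have e1 : (∫⁻ p in E, ENNReal.ofReal (weightedSum γ ρ k (fun r φ => f (polarPoint r φ)) p) ^ 2
      ∂(polarMeasure γ)) ^ (1 / 2 : ℝ) =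
      eLpNorm (∑ β ∈ multiIndices k, fun p => ‖F β p‖) 2 ((polarMeasure γ).restrict E) := by
    rw [eLpNorm_eq_lintegral_rpow_enorm_toReal (by norm_num) (by norm_num)]
    simp only [ENNReal.toReal_ofNat, ENNReal.rpow_ofNat]
    congr 1
    refine lintegral_congr fun p => ?_
    rw [Finset.sum_apply, Real.enorm_of_nonneg (Finset.sum_nonneg fun _ _ => norm_nonneg _)]
    rfl
  rw [e1]
  refine (eLpNorm_sum_le (fun β _ => (hF β).norm.aestronglyMeasurable) (by norm_num)).trans
    (Finset.sum_le_sum fun β _ => ?_)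
  rw [eLpNorm_norm, faceTerm]
  refine le_trans (eLpNorm_congr_ae ?_).le (eLpNorm_mono_measure _ Measure.restrict_le_self)
  filter_upwards [ae_restrict_mem hE.measurableSet] with p hp
  simp only [F]
  congr 1
  refine polarDeriv_congr ?_ _ _
  filter_upwards [hE.mem_nhds hp] with q hq
  have hq' : R.chart n i (polarPoint q.1 q.2) ∈ S.patch i := hq
  rw [localPolar, if_pos (subset_closure hq')]
  exact hfu _ hq

end SpecialResolution

/-! ### One level, one patch and one incident vertex. -/

namespace DualWavelets

variable {I N : ℕ} {S : PolyhedralSurface I N} {d : ℕ} {Ξ : Type*} (W : DualWavelets S d Ξ)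

theorem exists_sum_pairing_rpow_le_of_incident {R : ConeCharts S} (Φ : SpecialResolution S R)
    {k : ℕ} (hk : 1 ≤ k) (hkd : k ≤ d) (hκ : S.SmoothParam k) {ρ : ℝ} (hρ0 : 0 < ρ) (hρ : ρ < k)
    {τ : ℝ} (hτ0 : 0 < τ) (hτ2 : τ < 2) (hτκ : 1 / τ < 1 / 2 + (k - ρ)) (c' : ℝ) {C : ℝ}
    (hC : 0 < C) {n : Fin N} {i : Fin I} (h : S.Incident n i) :
    ∃ K : ℝ≥0, ∀ j ≥ W.j₀, ∀ T : Finset Ξ, (∀ ξ ∈ T, ξ ∈ W.interiorGridPatch c' C j i) →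
      ∀ v, S.PatchwiseSmooth v →
        ∑ ξ ∈ T, ‖S.pairing (fun x => Φ.φ n x * v x) (W.ψ j ξ)‖ₑ ^ τ ≤
          K * ENNReal.ofReal ((1 / 2 ^ j) ^ (ρ * τ - (2 - τ) / 2)) * Φ.smoothNorm k ρ v ^ τ := by
  set c := R.chart n i
  have hc : IsPlaneChart S i c := R.isPlaneChart h
  set G := c ⁻¹' S.patch i
  set V := c ⁻¹' Φ.U₁ n ∩ G
  obtain ⟨R₀, hR₀⟩ := IsPlaneChart.exists_norm_preimage_le (S := S) i c
  obtain ⟨hlam, D, hD⟩ := hκ.exists_iteratedFDeriv_chartInv_le i c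
  obtain ⟨L, hL⟩ := S.exists_dist_le i
  obtain ⟨M, hM⟩ := W.finite_overlap
  obtain ⟨c₀, hc₀, c₁, hc₁, c₂, hw⟩ := W.exists_planeWavelet hkd c' hC hc
  -- By `U₁_face` the set V lies in the face, so `dist_face` separates it from the part of the patch
  -- outside the sector.
  have hV : ∀ v ∈ V, ∀ p ∈ G \ sector (R.angle n i), Φ.C₁ ≤ dist v p := by
    rintro v ⟨hv, hvG⟩ p ⟨hp, hps⟩
    rw [← c.dist_map]
    refine le_dist_of_lt_setDist (Φ.dist_face n i h) ⟨hv, Φ.U₁_face n i h ⟨hv, hvG⟩⟩ ⟨hp, ?_⟩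
    rw [ConeCharts.face, c.injective.mem_set_image]
    exact hps
  obtain ⟨K, hK⟩ := exists_sum_coefficient_rpow_le hk (R.angle_mem n i h).2 hρ0 hρ hlam hD
    (fun x hx y hy => by
      have hx' := PolyhedralSurface.openUnitSquare_subset_unitSquare hx
      have hy' := PolyhedralSurface.openUnitSquare_subset_unitSquare hy
      rw [S.dist_chartInv_param hc hx' hy']
      exact hL x hx' y hy') hc.isOpen_preimage hR₀ Φ.C₁_pos hV hτ0 hτ2 hτκ hc₀ hc₁ c₂ M
  refine ⟨K, fun j hj T hT v hv => ?_⟩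
  choose w hws hwη hwm hwsQ using fun ξ : T => hw j hj ξ (hT ξ ξ.2)
  obtain ⟨gφ, hgφ, hgφ'⟩ := (Φ.smooth n).2 i
  obtain ⟨gv, hgv, hgv'⟩ := hv.2 i
  -- A product of smooth extensions from the patch: it is smooth on the whole plane, as the planar
  -- estimate requires, and equals φ_n v on the closed patch.
  set f : E2 → ℂ := fun y => gφ (c y) * gv (c y)
  have hcs : ContDiff ℝ (⊤ : ℕ∞) c := by
    have : (c : E2 → E3) = fun y => c.linearIsometry y + c 0 := funext (affineIsometry_apply c)
    rw [this]
    exact c.linearIsometry.contDiff.add contDiff_const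
  have hf : ContDiff ℝ (⊤ : ℕ∞) f := (hgφ.comp hcs).mul (hgv.comp hcs)
  have hfu : ∀ y, c y ∈ closure (S.patch i) → f y = Φ.φ n (c y) * v (c y) := fun y hy => by
    simp only [f]
    rw [← hgφ' hy, ← hgv' hy]
  have hfV : ∀ y ∈ G \ V, f y = 0 := by
    rintro y ⟨hy, hyV⟩
    have hy' : c y ∈ closure (S.patch i) := subset_closure hy
    rw [hfu y hy', Φ.eq_zero n _ ⟨S.closure_patch_subset_bd i hy', fun hU => hyV ⟨hU, hy⟩⟩]
    simp
  have hover : ∀ x, {ξ ∈ ((Finset.univ : Finset T) : Set T) | x ∈ (w ξ).s}.ncard ≤ M := by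
    intro x
    by_cases hx : c x ∈ S.bd
    · refine le_trans ?_ (hM j hj (c x) hx)
      rw [← ncard_image_of_injective _ Subtype.val_injective]
      refine ncard_le_ncard ?_ ?_
      · rintro _ ⟨ξ, ⟨-, hξ⟩, rfl⟩
        rw [hws] at hξ
        exact ⟨⟨i, (hT ξ ξ.2).1⟩, hξ⟩
      -- An infinite set has `ncard` zero, so monotonicity needs finiteness of the larger set.
      · refine Set.Finite.subset (s := ⋃ i, (W.grid j i : Set Ξ))
          (finite_iUnion fun i => (W.grid j i).finite_toSet) ?_
        rintro ξ ⟨⟨l, hl⟩, -⟩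
        exact mem_iUnion.2 ⟨l, hl⟩
    · have : {ξ ∈ ((Finset.univ : Finset T) : Set T) | x ∈ (w ξ).s} = ∅ := by
        rw [eq_empty_iff_forall_notMem]
        rintro ξ ⟨-, hξ⟩
        rw [hws] at hξ
        exact hx (S.supp_subset_bd _ hξ)
      rw [this, ncard_empty]
      exact Nat.zero_le _
  have hmain := hK Finset.univ (1 / 2 ^ j) (by positivity)
    (by rw [div_le_one (by positivity)]; exact one_le_pow₀ (by norm_num)) w hover f hf hfV
  have hY := Φ.lintegral_weightedSum_le h k ρ hf fun y hy => hfu y (subset_closure hy)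
  have hY2 := ENNReal.rpow_le_rpow hY hτ0.le
  rw [← ENNReal.rpow_mul, one_div_mul_eq_div] at hY2
  refine le_trans (le_of_eq ?_) (hmain.trans (mul_right_mono hY2))
  rw [← Finset.sum_coe_sort T]
  refine Finset.sum_congr rfl fun ξ _ => ?_
  have hQ := (w ξ).square_subset.trans PolyhedralSurface.openUnitSquare_subset_unitSquare
  rw [S.pairing_eq hQ (hwsQ ξ) (hwm ξ)]
  congr 2
  refine setIntegral_congr_fun (isClosed_closedSquare _ _).measurableSet fun x hx => ?_
  have hx' := S.param_mem_closure i (hQ hx)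
  have e := hc.apply_chartInv hx'
  rw [hfu _ (e.symm ▸ hx'), e, hwη]

end DualWavelets

theorem sum_rpow_le_card_rpow_mul {ι : Type*} (s : Finset ι) (a : ι → ℝ≥0∞) {τ : ℝ} (hτ : 0 < τ) :
    (∑ n ∈ s, a n) ^ τ ≤ (s.card : ℝ≥0∞) ^ τ * ∑ n ∈ s, a n ^ τ := by
  rcases s.eq_empty_or_nonempty with rfl | hs
  · simp [hτ]
  obtain ⟨m, hm, hmax⟩ := s.exists_max_image a hs
  calc (∑ n ∈ s, a n) ^ τ ≤ (s.card * a m) ^ τ := by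
        refine ENNReal.rpow_le_rpow ?_ hτ.le
        rw [← nsmul_eq_mul]
        exact Finset.sum_le_card_nsmul _ _ _ hmax
    _ = (s.card : ℝ≥0∞) ^ τ * a m ^ τ := ENNReal.mul_rpow_of_nonneg _ _ hτ.le
    _ ≤ _ := mul_right_mono
        (Finset.single_le_sum (f := fun n => a n ^ τ) (fun _ _ => zero_le) hm)

/-- Each a_i^p is at most the full sum, which bounds the surplus factor a_i^(q-p). -/
theorem tsum_rpow_le_rpow_tsum {ι : Type*} (a : ι → ℝ≥0∞) {p q : ℝ} (hp : 0 < p) (hpq : p ≤ q) :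
    ∑' i, a i ^ q ≤ (∑' i, a i ^ p) ^ (q / p) := by
  have hqp : 0 ≤ (q - p) / p := div_nonneg (by linarith) hp.le
  have h1 : ∀ i, a i ^ q ≤ a i ^ p * (∑' i, a i ^ p) ^ ((q - p) / p) := by
    intro i
    have e : a i ^ q = a i ^ p * (a i ^ p) ^ ((q - p) / p) := by
      rw [← ENNReal.rpow_mul, mul_div_cancel₀ _ hp.ne',
        ← ENNReal.rpow_add_of_nonneg _ _ hp.le (by linarith)]
      congr 1
      ring
    rw [e]
    exact mul_right_mono (ENNReal.rpow_le_rpow (ENNReal.le_tsum i) hqp)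
  refine (ENNReal.tsum_le_tsum h1).trans_eq ?_
  rw [ENNReal.tsum_mul_right]
  nth_rw 1 [← ENNReal.rpow_one (∑' i, a i ^ p)]
  rw [← ENNReal.rpow_add_of_nonneg _ _ zero_le_one hqp]
  congr 1
  field_simp
  ring

namespace PolyhedralSurface

variable {I N : ℕ} {S : PolyhedralSurface I N}

theorem memLp_param_of_continuousOn (i : Fin I) {Q : Set E2} (hQm : MeasurableSet Q)
    (hQ : Q ⊆ unitSquare) {f : E3 → ℂ} (hf : ContinuousOn f S.bd) :
    MemLp (fun x => f (S.κ i x)) 2 (volume.restrict Q) := by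
  have hc : ContinuousOn (fun x => f (S.κ i x)) unitSquare :=
    hf.comp (S.continuousOn_param i) fun x hx =>
      S.closure_patch_subset_bd i (S.param_mem_closure i hx)
  obtain ⟨B, hB⟩ := isCompact_unitSquare.exists_bound_of_continuousOn hc
  have : IsFiniteMeasure (volume.restrict Q) :=
    isFiniteMeasure_restrict.2
      ((measure_mono hQ).trans_lt isCompact_unitSquare.measure_lt_top).ne
  refine MemLp.of_bound ((hc.mono hQ).aestronglyMeasurable hQm) B ?_
  filter_upwards [ae_restrict_mem hQm] with x hx
  exact hB x (hQ hx)

theorem aestronglyMeasurable_of_continuousOn {f : E3 → ℂ} (hf : ContinuousOn f S.bd) :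
    AEStronglyMeasurable f S.surfaceMeasure := by
  have hbd : MeasurableSet S.bd := isClosed_frontier.measurableSet
  have h1 : S.surfaceMeasure.restrict S.bd = S.surfaceMeasure := by
    refine Measure.restrict_eq_self_of_ae_mem ?_
    change S.surfaceMeasure S.bdᶜ = 0
    rw [surfaceMeasure, Measure.finsetSum_apply]
    refine Finset.sum_eq_zero fun l _ => ?_
    rw [Measure.map_apply (S.plane l).continuous.measurable hbd.compl,
      Measure.restrict_apply ((S.plane l).continuous.measurable hbd.compl)]
    convert measure_empty (μ := (volume : Measure E2))
    rw [eq_empty_iff_forall_notMem]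
    rintro y ⟨hy, hyl⟩
    exact hy (S.closure_patch_subset_bd l (subset_closure (mem_image_of_mem _ hyl)))
  rw [← h1]
  exact hf.aestronglyMeasurable hbd

end PolyhedralSurface

/-! ### Localization and L₂-continuity of the coefficients. -/

namespace DualWavelets

variable {I N : ℕ} {S : PolyhedralSurface I N} {d : ℕ} {Ξ : Type*} (W : DualWavelets S d Ξ)

variable {W} in
theorem exists_square {c' C : ℝ} {j : ℕ} {i : Fin I} {ξ : Ξ}
    (hξ : ξ ∈ W.interiorGridPatch c' C j i) : ∃ Q : Set E2, MeasurableSet Q ∧ Q ⊆ unitSquare ∧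
      MapsTo (S.κ i) Q (S.patch i) ∧ S.supp (W.ψ j ξ) ⊆ S.κ i '' Q := by
  obtain ⟨-, a, h, z, r, hh, hr, hQ, hsQ, hQB, hBF, -⟩ := hξ
  exact ⟨closedSquare a h, (isClosed_closedSquare _ _).measurableSet,
    hQ.trans PolyhedralSurface.openUnitSquare_subset_unitSquare,
    fun x hx => hBF (hQB (mem_image_of_mem _ hx)), hsQ⟩

theorem pairing_eq_sum {R : ConeCharts S} (Φ : SpecialResolution S R) {c' C : ℝ} {j : ℕ}
    (hj : W.j₀ ≤ j) {i : Fin I} {ξ : Ξ} (hξ : ξ ∈ W.interiorGridPatch c' C j i) {v : E3 → ℂ}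
    (hv : ContinuousOn v S.bd) :
    S.pairing v (W.ψ j ξ) = ∑ n, S.pairing (fun x => Φ.φ n x * v x) (W.ψ j ξ) := by
  obtain ⟨Q, hQm, hQ, hQi, hs⟩ := exists_square hξ
  simp only [S.pairing_eq hQ hs hQi]
  rw [← integral_finsetSum]
  · refine setIntegral_congr_fun hQm fun x hx => ?_
    have hx' := S.closure_patch_subset_bd i (S.param_mem_closure i (hQ hx))
    have h1 : ∑ n, (Φ.φ n (S.κ i x) : ℂ) = 1 := by
      exact_mod_cast Φ.sum_eq_one _ hx'
    rw [← Finset.sum_mul, ← Finset.sum_mul, h1, one_mul]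
  · intro n _
    exact (PolyhedralSurface.memLp_param_of_continuousOn i hQm hQ
      ((Φ.smooth n).1.mul hv)).integrable_mul
        (PolyhedralSurface.memLp_param hQm hQ hQi (W.memLp j hj i ξ hξ.1)).star

/-- `U₁ n` keeps the positive distance C₁ from every patch without corner ν_n, so φ_n vanishes
there. -/
theorem pairing_eq_zero_of_not_incident {R : ConeCharts S} (Φ : SpecialResolution S R) {c' C : ℝ}
    {j : ℕ} {i : Fin I} {ξ : Ξ} (hξ : ξ ∈ W.interiorGridPatch c' C j i) {n : Fin N}
    (hn : ¬ S.Incident n i) (v : E3 → ℂ) :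
    S.pairing (fun x => Φ.φ n x * v x) (W.ψ j ξ) = 0 := by
  obtain ⟨Q, hQm, hQ, hQi, hs⟩ := exists_square hξ
  rw [S.pairing_eq hQ hs hQi]
  refine setIntegral_eq_zero_of_forall_eq_zero fun x hx => ?_
  have hx' := S.closure_patch_subset_bd i (S.param_mem_closure i (hQ hx))
  have hU : S.κ i x ∉ Φ.U₁ n := by
    intro hU
    have h1 := le_dist_of_lt_setDist
      (Φ.dist_patch n i fun h => hn (S.incident_of_mem_closure h)) hU (hQi hx)
    rw [dist_self] at h1
    exact h1.not_gt Φ.C₁_pos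
  rw [Φ.eq_zero n _ ⟨hx', hU⟩]
  simp

/-- Cauchy–Schwarz on the parameter square, together with the comparison of its L₂-norm with that of
the surface. -/
theorem tendsto_pairing {c' C : ℝ} {j : ℕ} (hj : W.j₀ ≤ j) {i : Fin I} {ξ : Ξ}
    (hξ : ξ ∈ W.interiorGridPatch c' C j i) {v : ℕ → E3 → ℂ} (hv : ∀ m, ContinuousOn (v m) S.bd)
    {u : E3 → ℂ} (hu : MemLp u 2 S.surfaceMeasure)
    (hvu : Tendsto (fun m => eLpNorm (v m - u) 2 S.surfaceMeasure) atTop (𝓝 0)) :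
    Tendsto (fun m => S.pairing (v m) (W.ψ j ξ)) atTop (𝓝 (S.pairing u (W.ψ j ξ))) := by
  obtain ⟨Q, hQm, hQ, hQi, hs⟩ := exists_square hξ
  obtain ⟨L, hL⟩ := S.exists_dist_le i
  have hψ := PolyhedralSurface.memLp_param hQm hQ hQi (W.memLp j hj i ξ hξ.1)
  have huκ := PolyhedralSurface.memLp_param hQm hQ hQi hu
  have hI : ∀ {w : E2 → ℂ}, MemLp w 2 (volume.restrict Q) →
      Integrable (fun x => w x * conj (W.ψ j ξ (S.κ i x))) (volume.restrict Q) :=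
    fun hw => hw.integrable_mul hψ.star
  set B := eLpNorm (fun x => W.ψ j ξ (S.κ i x)) 2 (volume.restrict Q)
  rw [tendsto_iff_edist_tendsto_0]
  refine tendsto_of_tendsto_of_tendsto_of_le_of_le tendsto_const_nhds
    (h := fun m => L * eLpNorm (v m - u) 2 S.surfaceMeasure * B) ?_ (fun _ => zero_le) fun m => ?_
  · have h1 := ENNReal.Tendsto.mul_const (b := B)
      (ENNReal.Tendsto.const_mul (a := (L : ℝ≥0∞)) hvu (Or.inr (by finiteness)))
      (Or.inr hψ.2.ne)
    simpa using h1
  · have hvκ := PolyhedralSurface.memLp_param_of_continuousOn i hQm hQ (hv m)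
    simp only [S.pairing_eq hQ hs hQi]
    rw [edist_eq_enorm_sub, ← integral_sub (hI hvκ) (hI huκ)]
    have h2 := PolyhedralSurface.eLpNorm_param_le hL hQm hQ hQi
      ((PolyhedralSurface.aestronglyMeasurable_of_continuousOn (hv m)).sub hu.1)
    have h3 : ∀ x, ‖v m (S.κ i x) * conj (W.ψ j ξ (S.κ i x)) -
        u (S.κ i x) * conj (W.ψ j ξ (S.κ i x))‖ₑ =
        ‖(v m - u) (S.κ i x)‖ₑ * ‖W.ψ j ξ (S.κ i x)‖ₑ := fun x => by
      rw [← sub_mul, enorm_mul, RCLike.enorm_conj]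
      rfl
    refine le_trans ?_ (mul_le_mul_left h2 B)
    refine (enorm_integral_le_lintegral_enorm _).trans ?_
    rw [lintegral_congr h3]
    refine (lintegral_mul_le_sqrt _ (hvκ.sub huκ).1.aemeasurable.enorm
      hψ.1.aemeasurable.enorm).trans_eq ?_
    rw [eLpNorm_eq_lintegral_rpow_enorm_toReal (by norm_num) (by norm_num)]
    simp only [B]
    rw [eLpNorm_eq_lintegral_rpow_enorm_toReal (by norm_num) (by norm_num)]
    simp only [ENNReal.toReal_ofNat, ENNReal.rpow_ofNat]
    rfl

end DualWavelets

/-! ### Summation over vertices, patches and levels, and passage to the completion. -/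

namespace DualWavelets

variable {I N : ℕ} {S : PolyhedralSurface I N} {d : ℕ} {Ξ : Type*} (W : DualWavelets S d Ξ)

theorem finite_interiorGridPatch (c C : ℝ) (j : ℕ) (i : Fin I) :
    (W.interiorGridPatch c C j i).Finite :=
  (W.grid j i).finite_toSet.subset fun _ hξ => hξ.1

theorem exists_sum_pairing_rpow_le {R : ConeCharts S} (Φ : SpecialResolution S R)
    {k : ℕ} (hk : 1 ≤ k) (hkd : k ≤ d) (hκ : S.SmoothParam k) {ρ : ℝ} (hρ0 : 0 < ρ) (hρ : ρ < k)
    {τ : ℝ} (hτ0 : 0 < τ) (hτ2 : τ < 2) (hτκ : 1 / τ < 1 / 2 + (k - ρ)) (c' : ℝ) {C : ℝ}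
    (hC : 0 < C) (i : Fin I) :
    ∃ K : ℝ≥0, ∀ j ≥ W.j₀, ∀ T : Finset Ξ, (∀ ξ ∈ T, ξ ∈ W.interiorGridPatch c' C j i) →
      ∀ v, S.PatchwiseSmooth v →
        ∑ ξ ∈ T, ‖S.pairing v (W.ψ j ξ)‖ₑ ^ τ ≤
          K * ENNReal.ofReal ((1 / 2 ^ j) ^ (ρ * τ - (2 - τ) / 2)) * Φ.smoothNorm k ρ v ^ τ := by
  have hn : ∀ n, ∃ K : ℝ≥0, ∀ j ≥ W.j₀, ∀ T : Finset Ξ,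
      (∀ ξ ∈ T, ξ ∈ W.interiorGridPatch c' C j i) → ∀ v, S.PatchwiseSmooth v →
        ∑ ξ ∈ T, ‖S.pairing (fun x => Φ.φ n x * v x) (W.ψ j ξ)‖ₑ ^ τ ≤
          K * ENNReal.ofReal ((1 / 2 ^ j) ^ (ρ * τ - (2 - τ) / 2)) * Φ.smoothNorm k ρ v ^ τ := by
    intro n
    by_cases h : S.Incident n i
    · exact W.exists_sum_pairing_rpow_le_of_incident Φ hk hkd hκ hρ0 hρ hτ0 hτ2 hτκ c' hC h
    · refine ⟨0, fun j hj T hT v hv => ?_⟩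
      rw [Finset.sum_eq_zero fun ξ hξ => ?_]
      · exact zero_le
      · rw [W.pairing_eq_zero_of_not_incident Φ (hT ξ hξ) h, enorm_zero, ENNReal.zero_rpow_of_pos hτ0]
  choose K hK using hn
  refine ⟨(N : ℝ≥0) ^ τ * ∑ n, K n, fun j hj T hT v hv => ?_⟩
  have h1 : ∀ ξ ∈ T, ‖S.pairing v (W.ψ j ξ)‖ₑ ^ τ ≤
      (N : ℝ≥0∞) ^ τ * ∑ n, ‖S.pairing (fun x => Φ.φ n x * v x) (W.ψ j ξ)‖ₑ ^ τ := by
    intro ξ hξ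
    rw [W.pairing_eq_sum Φ hj (hT ξ hξ) hv.1]
    refine (ENNReal.rpow_le_rpow (enorm_sum_le _ _) hτ0.le).trans ?_
    simpa using sum_rpow_le_card_rpow_mul Finset.univ
      (fun n => ‖S.pairing (fun x => Φ.φ n x * v x) (W.ψ j ξ)‖ₑ) hτ0
  refine (Finset.sum_le_sum h1).trans ?_
  rw [← Finset.mul_sum, Finset.sum_comm, ENNReal.coe_mul, ENNReal.ofNNReal_finsetSum,
    ENNReal.coe_rpow_of_nonneg _ hτ0.le, mul_assoc, mul_assoc]
  simp only [ENNReal.coe_natCast]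
  refine mul_right_mono ?_
  rw [Finset.sum_mul]
  refine Finset.sum_le_sum fun n _ => ?_
  rw [← mul_assoc]
  exact hK n j hj T hT v hv

theorem tsum_ofReal_rpow_lt_top {σ : ℝ} (hσ : 0 < σ) :
    ∑' j : ℕ, ENNReal.ofReal ((1 / 2 ^ j) ^ σ) < ⊤ := by
  have h1 : ∀ j : ℕ, ENNReal.ofReal ((1 / 2 ^ j : ℝ) ^ σ) = ENNReal.ofReal ((1 / 2 : ℝ) ^ σ) ^ j := by
    intro j
    rw [← ENNReal.ofReal_pow (by positivity), Real.rpow_pow_comm (by norm_num), one_div_pow]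
  simp only [h1]
  rw [ENNReal.tsum_geometric, ENNReal.inv_lt_top, tsub_pos_iff_lt, ENNReal.ofReal_lt_one]
  exact Real.rpow_lt_one (by norm_num) (by norm_num) hσ

/-- The sum of the `τ`-th powers of the interior wavelet coefficients. -/
def coefficientSum (c C τ : ℝ) (u : E3 → ℂ) : ℝ≥0∞ :=
  ∑' (j : {j : ℕ // W.j₀ ≤ j}) (ξ : W.interiorGrid c C j), ‖S.pairing u (W.ψ j ξ)‖ₑ ^ τ

theorem coefficientSum_eq_tsum_sigma (c C τ : ℝ) (u : E3 → ℂ) :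
    W.coefficientSum c C τ u =
      ∑' p : (j : {j : ℕ // W.j₀ ≤ j}) × W.interiorGrid c C j,
        ‖S.pairing u (W.ψ p.1 p.2)‖ₑ ^ τ :=
  (ENNReal.tsum_sigma fun (j : {j : ℕ // W.j₀ ≤ j}) (ξ : W.interiorGrid c C j) =>
    ‖S.pairing u (W.ψ j ξ)‖ₑ ^ τ).symm

theorem exists_coefficientSum_le_of_lt_two {R : ConeCharts S} (Φ : SpecialResolution S R)
    {k : ℕ} (hk : 1 ≤ k) (hkd : k ≤ d) (hκ : S.SmoothParam k) {ρ : ℝ} (hρ0 : 0 < ρ) (hρ : ρ < k)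
    {τ : ℝ} (hτ0 : 0 < τ) (hτ2 : τ < 2) (hτκ : 1 / τ < 1 / 2 + min ρ (k - ρ)) (c : ℝ) {C : ℝ}
    (hC : 0 < C) : ∃ K : ℝ≥0, ∀ v, S.PatchwiseSmooth v →
      W.coefficientSum c C τ v ≤ K * Φ.smoothNorm k ρ v ^ τ := by
  have h1 : 1 / τ < 1 / 2 + ρ := hτκ.trans_le (by gcongr; exact min_le_left _ _)
  have h2 : 1 / τ < 1 / 2 + (k - ρ) := hτκ.trans_le (by gcongr; exact min_le_right _ _)
  -- Equivalent to 1/τ < 1/2 + ρ; this makes the series over the levels converge.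
  have hσ : 0 < ρ * τ - (2 - τ) / 2 := by
    rw [div_lt_iff₀ hτ0] at h1
    linarith
  choose K hK using W.exists_sum_pairing_rpow_le Φ hk hkd hκ hρ0 hρ hτ0 hτ2 h2 c hC
  set A := ∑' j : ℕ, ENNReal.ofReal ((1 / 2 ^ j) ^ (ρ * τ - (2 - τ) / 2))
  have hA : A < ⊤ := tsum_ofReal_rpow_lt_top hσ
  refine ⟨(∑ i, K i) * A.toNNReal, fun v hv => ?_⟩
  have h3 : ∀ j : {j : ℕ // W.j₀ ≤ j}, ∑' ξ : W.interiorGrid c C j, ‖S.pairing v (W.ψ j ξ)‖ₑ ^ τ ≤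
      ENNReal.ofReal ((1 / 2 ^ (j : ℕ)) ^ (ρ * τ - (2 - τ) / 2)) *
        ((∑ i, K i : ℝ≥0) * Φ.smoothNorm k ρ v ^ τ) := by
    intro j
    refine (ENNReal.tsum_iUnion_le (fun ξ => ‖S.pairing v (W.ψ j ξ)‖ₑ ^ τ) _).trans ?_
    rw [ENNReal.ofNNReal_finsetSum, Finset.sum_mul, Finset.mul_sum]
    refine Finset.sum_le_sum fun i _ => ?_
    have h4 := hK i j j.2 (W.finite_interiorGridPatch c C j i).toFinset
      (fun ξ hξ => by simpa using hξ) v hv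
    rw [mul_left_comm, ← mul_assoc]
    refine le_trans (le_of_eq ?_) h4
    have h5 := Finset.tsum_subtype' (W.finite_interiorGridPatch c C j i).toFinset
      (fun ξ => ‖S.pairing v (W.ψ j ξ)‖ₑ ^ τ)
    rw [Finite.coe_toFinset] at h5
    exact h5
  refine (ENNReal.tsum_le_tsum h3).trans ?_
  rw [ENNReal.tsum_mul_right, ENNReal.coe_mul, ENNReal.coe_toNNReal hA.ne,
    mul_comm _ A, mul_assoc]
  refine mul_le_mul_left ?_ _
  exact ENNReal.tsum_comp_le_tsum_of_injective Subtype.val_injective _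

theorem exists_coefficientSum_le {R : ConeCharts S} (Φ : SpecialResolution S R)
    {k : ℕ} (hk : 1 ≤ k) (hkd : k ≤ d) (hκ : S.SmoothParam k) {ρ : ℝ} (hρ0 : 0 < ρ) (hρ : ρ < k)
    {τ : ℝ} (hτ0 : 0 < τ) (hτκ : 1 / τ < 1 / 2 + min ρ (k - ρ)) (c : ℝ) {C : ℝ}
    (hC : 0 < C) : ∃ K : ℝ≥0, ∀ v, S.PatchwiseSmooth v →
      W.coefficientSum c C τ v ≤ K * Φ.smoothNorm k ρ v ^ τ := by
  set μ := min ρ (k - ρ)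
  have hμ : 0 < μ := lt_min hρ0 (by linarith)
  -- The exponent 1/s is below 2, does not exceed τ and still satisfies the strict upper bound. This
  -- covers τ = 2, where the Hölder exponent 2/(2-τ) degenerates.
  obtain ⟨s, hs1, hs2⟩ : ∃ s, max (1 / τ) (1 / 2) < s ∧ s < 1 / 2 + μ :=
    exists_between (max_lt hτκ (by linarith))
  have hs0 : 0 < s := lt_of_lt_of_le (by norm_num) ((le_max_right _ _).trans hs1.le)
  have hp2 : 1 / s < 2 := by
    rw [div_lt_comm₀ hs0 (by norm_num)]
    exact (le_max_right _ _).trans_lt hs1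
  have hpτ : 1 / s ≤ τ := by
    rw [div_le_comm₀ hs0 hτ0]
    exact (le_max_left _ _).trans hs1.le
  have hp0 : 0 < 1 / s := by positivity
  obtain ⟨K, hK⟩ := W.exists_coefficientSum_le_of_lt_two Φ hk hkd hκ hρ0 hρ hp0 hp2
    (by rwa [one_div_one_div]) c hC
  have hq : 0 ≤ τ / (1 / s) := by positivity
  refine ⟨K ^ (τ / (1 / s)), fun v hv => ?_⟩
  have h1 := ENNReal.rpow_le_rpow (hK v hv) hq
  rw [ENNReal.mul_rpow_of_nonneg _ _ hq, ← ENNReal.rpow_mul, mul_div_cancel₀ _ hp0.ne',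
    ← ENNReal.coe_rpow_of_nonneg _ hq] at h1
  refine le_trans ?_ h1
  rw [coefficientSum_eq_tsum_sigma, coefficientSum_eq_tsum_sigma]
  exact tsum_rpow_le_rpow_tsum _ hp0 hpτ

/-- A Fatou-type argument: for a finite set of indices the sum converges along the sequence, while
the norms are eventually below B; then the supremum over finite sets is taken. -/
theorem coefficientSum_le_of_approximates {R : ConeCharts S} {Φ : SpecialResolution S R} {k : ℕ}
    {ρ τ c C : ℝ} (hτ0 : 0 < τ) {K : ℝ≥0}
    (hK : ∀ v, S.PatchwiseSmooth v → W.coefficientSum c C τ v ≤ K * Φ.smoothNorm k ρ v ^ τ)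
    {u : E3 → ℂ} (hu : MemLp u 2 S.surfaceMeasure) {v : ℕ → E3 → ℂ} (hv : Φ.Approximates k ρ v u)
    {B : ℝ≥0∞} (hB : limsup (fun m => Φ.smoothNorm k ρ (v m)) atTop < B) :
    W.coefficientSum c C τ u ≤ K * B ^ τ := by
  rw [coefficientSum_eq_tsum_sigma, ENNReal.tsum_eq_iSup_sum]
  refine iSup_le fun T => ?_
  have h1 : Tendsto (fun m => ∑ p ∈ T, ‖S.pairing (v m) (W.ψ p.1 p.2)‖ₑ ^ τ) atTop
      (𝓝 (∑ p ∈ T, ‖S.pairing u (W.ψ p.1 p.2)‖ₑ ^ τ)) := by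
    refine tendsto_finsetSum _ fun p _ => ?_
    obtain ⟨i, hi⟩ := mem_iUnion.1 p.2.2
    exact ((W.tendsto_pairing p.1.2 hi (fun m => (hv.1 m).1.1) hu hv.2.2).enorm).ennrpow_const τ
  refine le_of_tendsto h1 ?_
  filter_upwards [eventually_lt_of_limsup_lt hB] with m hm
  refine le_trans ?_ ((hK (v m) (hv.1 m).1).trans
    (mul_right_mono (ENNReal.rpow_le_rpow hm.le hτ0.le)))
  rw [coefficientSum_eq_tsum_sigma]
  exact ENNReal.sum_le_tsum T

theorem coefficientSum_le_xNorm {R : ConeCharts S} {Φ : SpecialResolution S R} {k : ℕ}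
    {ρ τ c C : ℝ} (hτ0 : 0 < τ) {K : ℝ≥0} (hK1 : 1 ≤ K)
    (hK : ∀ v, S.PatchwiseSmooth v → W.coefficientSum c C τ v ≤ K * Φ.smoothNorm k ρ v ^ τ)
    {u : E3 → ℂ} (hu : MemLp u 2 S.surfaceMeasure) :
    W.coefficientSum c C τ u ≤ K * Φ.xNorm k ρ u ^ τ := by
  -- When the norm is infinite the bound is trivial only for K ≠ 0, since 0 * ⊤ = 0; hence the
  -- assumption 1 ≤ K.
  rcases eq_or_ne (Φ.xNorm k ρ u) ⊤ with h | h
  · rw [h, ENNReal.top_rpow_of_pos hτ0, ENNReal.mul_top (by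
      rw [ENNReal.coe_ne_zero]
      exact (zero_lt_one.trans_le hK1).ne')]
    exact le_top
  -- The infimum over approximating sequences need not be attained, so the bound is proved for every
  -- B above the norm and B then decreases to it.
  have hne : (𝓝[>] Φ.xNorm k ρ u).NeBot := nhdsGT_neBot_of_exists_gt ⟨⊤, h.lt_top⟩
  have hlim : Tendsto (fun B : ℝ≥0∞ => K * B ^ τ) (𝓝[>] Φ.xNorm k ρ u)
      (𝓝 (K * Φ.xNorm k ρ u ^ τ)) :=
    ENNReal.Tendsto.const_mul
      ((ENNReal.continuous_rpow_const.tendsto _).mono_left nhdsWithin_le_nhds)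
      (Or.inr ENNReal.coe_ne_top)
  refine ge_of_tendsto hlim ?_
  filter_upwards [self_mem_nhdsWithin] with B hB
  obtain ⟨v, hv⟩ := iInf_lt_iff.1 (mem_Ioi.1 hB)
  obtain ⟨hv, hlt⟩ := iInf_lt_iff.1 hv
  exact W.coefficientSum_le_of_approximates hτ0 hK hu hv hlt

end DualWavelets
end BesovSurface
end

open BesovSurface

theorem mainTheorem7 {I N : ℕ} (S : PolyhedralSurface I N) (R : ConeCharts S)
    (Φ : SpecialResolution S R) {Ξ : Type*} (d : ℕ) (W : DualWavelets S d Ξ)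
    (k : ℕ) (hk : 1 ≤ k) (hkd : k ≤ d) (hκ : S.SmoothParam k)
    (ρ : ℝ) (hρ0 : 0 < ρ) (hρk : ρ < k)
    (τ : ℝ) (hτ : 1 / 2 ≤ 1 / τ) (hτ' : 1 / τ < 1 / 2 + min ρ (k - ρ))
    (c C : ℝ) (hc : 0 < c) (hC : 0 < C) :
    ∃ K : ℝ≥0, ∀ u : E3 → ℂ, Φ.MemX k ρ u →
      ∑' (j : {j : ℕ // W.j₀ ≤ j}) (ξ : W.interiorGrid c C j),
          ENNReal.ofReal (‖S.pairing u (W.ψ j ξ)‖ ^ τ) ≤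
        (K : ℝ≥0∞) * Φ.xNorm k ρ u ^ τ := by
  have hτ0 : 0 < τ := one_div_pos.1 (lt_of_lt_of_le (by norm_num) hτ)
  obtain ⟨K, hK⟩ := W.exists_coefficientSum_le Φ hk hkd hκ hρ0 hρk hτ0 hτ' c hC
  refine ⟨max K 1, fun u hu => ?_⟩
  have h1 := W.coefficientSum_le_xNorm hτ0 (le_max_right K 1)
    (fun v hv => (hK v hv).trans (mul_le_mul_left (ENNReal.coe_le_coe.2 (le_max_left K 1)) _)) hu.1
  refine le_trans (le_of_eq ?_) h1
  refine tsum_congr fun j => tsum_congr fun ξ => ?_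
  rw [← ENNReal.ofReal_rpow_of_nonneg (norm_nonneg _) hτ0.le, ofReal_norm]
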